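/- Let $N\ge 1$, $0<\gamma<1$, $1<p\le q$, and let $u_0,v_0\in C_0(\mathbb R^N)$ be nonnegative, where $C_0(\mathbb R^N)$ is the space of real continuous functions vanishing at infinity, with the supremum norm. Consider $$ {}^{C}D^{\gamma}_{0|t}u-\Delta u=|v|^p,\qquad {}^{C}D^{\gamma}_{0|t}v-\Delta v=|u|^q,\qquad u(0,\cdot)=u_0,\quad v(0,\cdot)=v_0 \qquad (t>0,\ x\in\mathbb R^N), \tag{1}$$ with the Caputo derivative of order $\gamma$ in time. Let $T(t)$ be the heat semigroup, $T(t)w(x)=\int_{\mathbb R^N}(4\pi t)^{-N/2}e^{-|x-y|^2/(4t)}w(y)\,dy$ for $t>0$ and $T(0)=I$; let $\phi_\gamma(z)=\sum_{k\ge0}\frac{(-z)^k}{k!\,\Gamma(1-\gamma-\gamma k)}$ (with $1/\Gamma=0$ at the poles of $\Gamma$), and let $$P_\gamma(t)w=\int_0^\infty\phi_\gamma(\theta)\,T(t^\gamma\theta)w\,d\theta,\qquad S_\gamma(t)w=\gamma\int_0^\infty\theta\,\phi_\gamma(\theta)\,T(t^\gamma\theta)w\,d\theta .$$ A mild solution of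 (1) on $[0,T']$, $T'>0$, is a pair $(u,v)\in C([0,T'];C_0(\mathbb R^N)\times C_0(\mathbb R^N))$ such that for all $t\in[0,T']$ $$u(t)=P_\gamma(t)u_0+\int_0^t(t-\tau)^{\gamma-1}S_\gamma(t-\tau)|v(\tau)|^p\,d\tau,\qquad v(t)=P_\gamma(t)v_0+\int_0^t(t-\tau)^{\gamma-1}S_\gamma(t-\tau)|u(\tau)|^q\,d\tau .$$ Let $$\chi(x)=\Big(\int_{\mathbb R^N}e^{-\sqrt{N^2+|y|^2}}\,dy\Big)^{-1}e^{-\sqrt{N^2+|x|^2}},\qquad Z_0=\int_{\mathbb R^N}(u_0(x)+v_0(x))\,\chi(x)\,dx .$$ If $Z_0>2^{p/(p-1)}$, then the solution of (1) blows up in finite time. That is, there are a finite time $T_{\max}>0$ and a pair $(u,v)$ on $[0,T_{\max})$ that is a mild solution on $[0,T']$ for every $T'\in(0,T_{\max})$, such that every mild solution of (1) on an interval $[0,T']$ with $T'>0$ has $T'<T_{\max}$ and is the restriction of $(u,v)$ to $[0,T']$, and $$\lim_{t\uparrow T_{\max}}\big(\|u(t)\|_\infty+\|v(t)\|_\infty\big)=\infty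 .$$ Moreover, the blow-up time satisfies $$T_{\max}\le\left[\frac{\ln\!\big(1-2^pZ_0^{1-p}\big)}{2(1-p)}\,\Gamma(\gamma+1)\right]^{1/\gamma}.$$ -/

import Mathlib

open scoped ZeroAtInfty

noncomputable section

namespace FracDiff

/-- Euclidean space `ℝ^N`. -/
abbrev Sp (N : ℕ) : Type := EuclideanSpace ℝ (Fin N)

/-- The Gauss kernel `G(t,x) = (4πt)^{-N/2} exp(-|x|²/(4t))`, for `t > 0`. -/
def heatKernel (N : ℕ) (t : ℝ) (x : Sp N) : ℝ :=
  (4 * Real.pi * t) ^ (-((N : ℝ) / 2)) * Real.exp (-(‖x‖ ^ 2) / (4 * t))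

/-- The heat semigroup `T(t)`: convolution with the Gauss kernel for `t > 0`, and `T(0) = Id`. -/
def heatSemigroup (N : ℕ) (t : ℝ) (w : Sp N → ℝ) (x : Sp N) : ℝ :=
  if t = 0 then w x else ∫ y : Sp N, heatKernel N t (x - y) * w y

/-- The Wright type function `φ_α(z) = ∑ (-z)^k / (k! Γ(-αk + 1 - α))`. At the poles of `Γ` Mathlib
has `Γ = 0`, so that the quotient vanishes, in agreement with the convention `1/Γ = 0` there. -/
def wrightPhi (α z : ℝ) : ℝ :=
  ∑' k : ℕ, (-z) ^ k / ((k.factorial : ℝ) * Real.Gamma (-α * k + 1 - α))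

/-- `P_α(t) w = ∫_0^∞ φ_α(θ) T(t^α θ) w dθ`. -/
def opP (N : ℕ) (α t : ℝ) (w : Sp N → ℝ) (x : Sp N) : ℝ :=
  ∫ θ in Set.Ioi (0 : ℝ), wrightPhi α θ * heatSemigroup N (t ^ α * θ) w x

/-- `S_α(t) w = α ∫_0^∞ θ φ_α(θ) T(t^α θ) w dθ`. -/
def opS (N : ℕ) (α t : ℝ) (w : Sp N → ℝ) (x : Sp N) : ℝ :=
  α * ∫ θ in Set.Ioi (0 : ℝ), θ * wrightPhi α θ * heatSemigroup N (t ^ α * θ) w x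

/-- `(u, v) ∈ C([0,T]; C₀(ℝ^N) × C₀(ℝ^N))` is a mild solution on `[0,T]` of
`ᶜD^{γ₁} u - Δu = f(v)`, `ᶜD^{γ₂} v - Δv = g(u)`, `u(0) = u₀`, `v(0) = v₀`.
(Only the values of `u` and `v` on `[0,T]` matter.) -/
structure IsMildSolution (N : ℕ) (γ₁ γ₂ : ℝ) (f g : ℝ → ℝ) (u₀ v₀ : C₀(Sp N, ℝ)) (T : ℝ)
    (u v : ℝ → C₀(Sp N, ℝ)) : Prop where
  continuousOn_u : ContinuousOn u (Set.Icc 0 T)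
  continuousOn_v : ContinuousOn v (Set.Icc 0 T)
  eq_u : ∀ t ∈ Set.Icc 0 T, ∀ x : Sp N,
    u t x = opP N γ₁ t u₀ x +
      ∫ τ in (0 : ℝ)..t, (t - τ) ^ (γ₁ - 1) * opS N γ₁ (t - τ) (fun y => f (v τ y)) x
  eq_v : ∀ t ∈ Set.Icc 0 T, ∀ x : Sp N,
    v t x = opP N γ₂ t v₀ x +
      ∫ τ in (0 : ℝ)..t, (t - τ) ^ (γ₂ - 1) * opS N γ₂ (t - τ) (fun y => g (u τ y)) x

/-- `(u, v)` is the maximal mild solution, and its time of existence is the finite number `T > 0`: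
it is a mild solution on each `[0,T']` with `0 < T' < T`, and every mild solution on some `[0,T']`
with `T' > 0` has `T' < T` and is the restriction of `(u, v)` to `[0,T']`. -/
structure IsMaximalMildSolution (N : ℕ) (γ₁ γ₂ : ℝ) (f g : ℝ → ℝ) (u₀ v₀ : C₀(Sp N, ℝ)) (T : ℝ)
    (u v : ℝ → C₀(Sp N, ℝ)) : Prop where
  pos : 0 < T
  isMild : ∀ T' : ℝ, 0 < T' → T' < T → IsMildSolution N γ₁ γ₂ f g u₀ v₀ T' u v
  maximal : ∀ (T' : ℝ) (u' v' : ℝ → C₀(Sp N, ℝ)), 0 < T' →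
    IsMildSolution N γ₁ γ₂ f g u₀ v₀ T' u' v' →
      T' < T ∧ ∀ t ∈ Set.Icc 0 T', u' t = u t ∧ v' t = v t

/-- The normalized weight
`χ(x) = (∫ exp(-√(N² + |y|²)) dy)⁻¹ exp(-√(N² + |x|²))`. -/
def weight (N : ℕ) (x : Sp N) : ℝ :=
  (∫ y : Sp N, Real.exp (-Real.sqrt ((N : ℝ) ^ 2 + ‖y‖ ^ 2)))⁻¹ *
    Real.exp (-Real.sqrt ((N : ℝ) ^ 2 + ‖x‖ ^ 2))

/-- `Z₀ = ∫ (u₀ + v₀) χ dx`. -/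
def Z0 (N : ℕ) (u₀ v₀ : C₀(Sp N, ℝ)) : ℝ :=
  ∫ x : Sp N, (u₀ x + v₀ x) * weight N x

end FracDiff

end

/-! Upper bound on the lifespan. Put Z(t) = ∫ (u(t) + v(t)) χ. The weight satisfies T(t)χ ≥ e^{-t}
χ, so, tested against χ, the operators P_γ(t) and t^{γ-1} S_γ(t) are bounded below by the scalars
e(t) = E_γ(-t^γ) (`relax`) and -e'(t) (`relaxKernel`), where E_γ is the Mittag-Leffler function.
Jensen's inequality for the probability density χ, the convexity of the power p and the inequality
a^q ≥ a^p - 1 then give Z(t) ≥ e(t) Z₀ + ∫₀ᵗ (-e')(t-τ) (2^{1-p} Z(τ)^p - 1) dτ. Let B solve the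
Bernoulli equation B' = 2^{1-p} B^p - 2B, B(0) = Z₀; it explodes because Z₀ > 2^{p/(p-1)}. The time
change y(t) = B(t^γ/Γ(γ+1)) satisfies the opposite inequality (`fracSub_le`). This rests on
integration by parts and on a rearrangement inequality for two kernels of equal mass whose graphs
cross once (`integral_rpow_mul_relax_mul_le`). Comparison yields Z ≥ y, so no solution reaches the
explosion time of y, which is the stated bound (`lt_of_super_solution`,
`IsVolterraSol.lt_bernoulliTime`).

The Wright function. The argument needs φ_γ ≥ 0 and ∫ z^m φ_γ = m!/Γ(1+γm). Both come from a
discrete model: the coefficients of (1-(1-X)^γ)^n (1-X)^{γ-1} are the laws of the number of renewals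
for Sibuya waiting times, hence nonnegative with explicit moments, and after rescaling they converge
to φ_γ (`tendsto_wrightApprox`, `integral_moment`).

Maximal solution. The system is an abstract Volterra equation with a weakly singular kernel in C₀ ×
C₀. A contraction argument for truncated nonlinearities gives local existence, uniqueness and
continuation of bounded solutions (`exists_maximal_isVolterraSol`).

Full limit of the norm. The equation has memory, so it cannot be restarted from the value at time s,
and the usual step from "unbounded" to "tends to infinity" is not available. Instead the past
contribution to u(t) is bounded by a constant times the Duhamel term at time s, which by positivity
is at most u(s) (`exists_norm_history_le`). This holds since a delayed kernel is dominated pointwise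
by the undelayed one followed by a bounded superposition of heat operators (`exists_semS_add_le`). A
solution of size K at time s then stays bounded for a time depending only on K and the data
(`exists_time_of_norm_le`), so a finite lower limit of the norm would allow continuation. -/

open scoped ZeroAtInfty

noncomputable section

namespace FracDiff

/-! ### Binomial series and Sibuya renewal masses -/

section

open Filter Topology Finset

/-- The coefficient of `X ^ J` in the power series of `(1 - X) ^ s`. -/
def binCoef (s : ℝ) (J : ℕ) : ℝ := ∏ i ∈ range J, ((i : ℝ) - s) / ((i : ℝ) + 1)

lemma binCoef_eq_choose (s : ℝ) (J : ℕ) : binCoef s J = (-1) ^ J * Ring.choose s J := by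
  have h : ∀ J : ℕ, (descPochhammer ℤ J).smeval s = ∏ i ∈ range J, (s - i) := by
    intro J
    induction J with
    | zero => simp [descPochhammer_zero]
    | succ n ih =>
      rw [descPochhammer_succ_right, Polynomial.smeval_mul, ih, prod_range_succ]
      congr 1
      simp [Polynomial.smeval_sub, Polynomial.smeval_X, Polynomial.smeval_natCast]
  rw [Ring.choose_eq_smul, h, smul_eq_mul]
  induction J with
  | zero => simp [binCoef]
  | succ n ih =>
    rw [binCoef] at ih ⊢
    rw [prod_range_succ, ih, prod_range_succ, Nat.factorial_succ]
    push_cast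
    have h1 : (n.factorial : ℝ) ≠ 0 := by positivity
    have h2 : (n : ℝ) + 1 ≠ 0 := by positivity
    field_simp
    ring

/-- The power series of `(1 - X) ^ s`. -/
def binSeries (s : ℝ) : PowerSeries ℝ := PowerSeries.mk (binCoef s)

lemma binSeries_eq (s : ℝ) :
    binSeries s = PowerSeries.rescale (-1 : ℝ) (PowerSeries.binomialSeries ℝ s) := by
  ext n
  simp [binSeries, PowerSeries.coeff_rescale, binCoef_eq_choose]

lemma binSeries_add (s t : ℝ) : binSeries (s + t) = binSeries s * binSeries t := by
  simp [binSeries_eq]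

lemma binSeries_zero : binSeries 0 = 1 := by
  simp [binSeries_eq]

lemma binSeries_pow (s : ℝ) (n : ℕ) : binSeries s ^ n = binSeries (s * n) := by
  induction n with
  | zero => simp [binSeries_zero]
  | succ n ih => rw [pow_succ, ih, ← binSeries_add]; congr 1; push_cast; ring

/-- The renewal masses: the coefficient of `X ^ J` in `(1 - (1 - X) ^ γ) ^ n * (1 - X) ^ (γ - 1)`. -/
def renewalMass (γ : ℝ) (n J : ℕ) : ℝ :=
  PowerSeries.coeff J ((1 - binSeries γ) ^ n * binSeries (γ - 1))

lemma coeff_mul_nonneg {f g : PowerSeries ℝ} (hf : ∀ n, 0 ≤ PowerSeries.coeff n f)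
    (hg : ∀ n, 0 ≤ PowerSeries.coeff n g) (n : ℕ) : 0 ≤ PowerSeries.coeff n (f * g) := by
  rw [PowerSeries.coeff_mul]
  exact sum_nonneg fun _ _ => mul_nonneg (hf _) (hg _)

lemma coeff_pow_nonneg {f : PowerSeries ℝ} (hf : ∀ n, 0 ≤ PowerSeries.coeff n f) (m n : ℕ) :
    0 ≤ PowerSeries.coeff n (f ^ m) := by
  induction m generalizing n with
  | zero => rw [pow_zero, PowerSeries.coeff_one]; split_ifs <;> norm_num
  | succ m ih => rw [pow_succ]; exact coeff_mul_nonneg ih hf n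

/-- Both 1 - (1-X)^γ and (1-X)^{γ-1} have nonnegative coefficients when 0 < γ < 1. In the first, the
factor (0 - γ) of the binomial product is the only negative one and is cancelled by the minus sign;
in the second all factors are nonnegative. -/
lemma renewalMass_nonneg {γ : ℝ} (h0 : 0 < γ) (h1 : γ < 1) (n J : ℕ) : 0 ≤ renewalMass γ n J := by
  refine coeff_mul_nonneg (coeff_pow_nonneg (fun k => ?_) n) (fun k => ?_) J
  · rcases k with _ | k
    · simp [binSeries, binCoef]
    · rw [map_sub, PowerSeries.coeff_one, binSeries, PowerSeries.coeff_mk, binCoef,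
        prod_range_succ', if_neg (Nat.succ_ne_zero k)]
      have : 0 ≤ ∏ i ∈ range k, (((i + 1 : ℕ) : ℝ) - γ) / (((i + 1 : ℕ) : ℝ) + 1) :=
        prod_nonneg fun i _ => div_nonneg (by push_cast; linarith [(Nat.cast_nonneg i : (0:ℝ) ≤ i)])
          (by positivity)
      simp only [Nat.cast_zero]
      nlinarith
  · rw [binSeries, PowerSeries.coeff_mk, binCoef]
    exact prod_nonneg fun i _ => div_nonneg (by linarith [(Nat.cast_nonneg i : (0:ℝ) ≤ i)])
      (by positivity)

/-- Binomial expansion of (1-(1-X)^γ)^n; the alternating terms turn into those of the Wright series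
after rescaling. -/
lemma renewalMass_eq_sum (γ : ℝ) (n J : ℕ) :
    renewalMass γ n J =
      ∑ k ∈ range (n + 1), (n.choose k : ℝ) * (-1) ^ k * binCoef (γ * k + γ - 1) J := by
  rw [renewalMass, sub_eq_neg_add, add_pow, sum_mul, map_sum]
  refine sum_congr rfl fun k _ => ?_
  rw [one_pow, mul_one, neg_pow, binSeries_pow]
  have : ((-1) ^ k * binSeries (γ * k) * (n.choose k : PowerSeries ℝ)) * binSeries (γ - 1)
      = PowerSeries.C ((n.choose k : ℝ) * (-1) ^ k) * binSeries (γ * k + γ - 1) := by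
    rw [add_sub_assoc, binSeries_add]
    simp only [map_mul, map_natCast, map_pow, map_neg, map_one]
    ring
  rw [this, PowerSeries.coeff_C_mul, binSeries, PowerSeries.coeff_mk]

lemma X_dvd_one_sub_binSeries (γ : ℝ) : PowerSeries.X ∣ 1 - binSeries γ := by
  rw [PowerSeries.X_dvd_iff, ← PowerSeries.coeff_zero_eq_constantCoeff_apply]
  simp [binSeries, binCoef]

lemma coeff_one_sub_binSeries_pow_mul (γ : ℝ) {n J : ℕ} (h : J < n) (f : PowerSeries ℝ) :
    PowerSeries.coeff J ((1 - binSeries γ) ^ n * f) = 0 := by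
  have : PowerSeries.X ^ n ∣ (1 - binSeries γ) ^ n * f :=
    (pow_dvd_pow_of_dvd (X_dvd_one_sub_binSeries γ) n).mul_right f
  exact PowerSeries.X_pow_dvd_iff.1 this J h

lemma renewalMass_eq_zero (γ : ℝ) {n J : ℕ} (h : J < n) : renewalMass γ n J = 0 :=
  coeff_one_sub_binSeries_pow_mul γ h _

/-- Truncation of the series ∑ C(n+m,m) Sⁿ = (1-S)^{-(m+1)}. The remainder is a multiple of S^{L+1},
so it does not affect low-order coefficients once S is divisible by X. -/
lemma exists_sum_choose_mul_pow {R : Type*} [CommRing R] (S : R) (L m : ℕ) :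
    ∃ r : R, (1 - S) ^ (m + 1) * ∑ n ∈ range (L + 1), ((n + m).choose m : R) * S ^ n
      = 1 - S ^ (L + 1) * r := by
  induction m with
  | zero =>
    refine ⟨1, ?_⟩
    have := geom_sum_mul_neg S (L + 1)
    simp only [Nat.add_zero, Nat.choose_zero_right, Nat.cast_one, one_mul, zero_add, pow_one,
      mul_one]
    rw [mul_comm, this]
  | succ m ih =>
    obtain ⟨r, hr⟩ := ih
    have key : ∀ L : ℕ, (1 - S) * ∑ n ∈ range (L + 1), ((n + (m + 1)).choose (m + 1) : R) * S ^ n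
        = ∑ n ∈ range (L + 1), ((n + m).choose m : R) * S ^ n
          - S ^ (L + 1) * ((L + (m + 1)).choose (m + 1) : R) := by
      intro L
      induction L with
      | zero => simp
      | succ L ihL =>
        rw [sum_range_succ, mul_add, ihL, sum_range_succ _ (L + 1)]
        have : (L + 1 + (m + 1)).choose (m + 1)
            = (L + 1 + m).choose m + (L + (m + 1)).choose (m + 1) := by
          rw [show L + 1 + (m + 1) = (L + 1 + m) + 1 by ring, Nat.choose_succ_succ]
          rw [show L + 1 + m = L + (m + 1) by ring]
        rw [this]; push_cast; ring
    refine ⟨r + (1 - S) ^ (m + 1) * ((L + (m + 1)).choose (m + 1) : R), ?_⟩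
    rw [pow_succ, mul_assoc, key L, mul_sub, hr]; ring

/-- These are the rising factorial moments of the renewal law. With S = 1 - (1-X)^γ, summing
C(n+m,m) Sⁿ gives (1-X)^{-γ(m+1)}, and multiplication by (1-X)^{γ-1} leaves (1-X)^{-1-γm}. -/
lemma sum_choose_mul_renewalMass (γ : ℝ) (m : ℕ) {J L : ℕ} (h : J ≤ L) :
    ∑ n ∈ range (L + 1), ((n + m).choose m : ℝ) * renewalMass γ n J
      = binCoef (-1 - γ * m) J := by
  obtain ⟨r, hr⟩ := exists_sum_choose_mul_pow (1 - binSeries γ) L m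
  rw [sub_sub_cancel, binSeries_pow] at hr
  have e : binSeries (γ - 1) = binSeries (γ * (m + 1 : ℕ)) * binSeries (-1 - γ * m) := by
    rw [← binSeries_add]; congr 1; push_cast; ring
  have h2 : (∑ n ∈ range (L + 1), (((n + m).choose m : ℕ) : PowerSeries ℝ) *
      (1 - binSeries γ) ^ n) * binSeries (γ - 1)
      = binSeries (-1 - γ * m) - (1 - binSeries γ) ^ (L + 1) * (r * binSeries (-1 - γ * m)) := by
    rw [e, ← mul_assoc, mul_comm (∑ n ∈ _, _), hr]; ring
  have h3 := congrArg (PowerSeries.coeff J) h2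
  rw [map_sub, coeff_one_sub_binSeries_pow_mul γ (Nat.lt_succ_of_le h), sub_zero, sum_mul,
    map_sum] at h3
  rw [show PowerSeries.coeff J (binSeries (-1 - γ * m)) = binCoef (-1 - γ * m) J by
    rw [binSeries, PowerSeries.coeff_mk]] at h3
  rw [← h3]
  refine sum_congr rfl fun n _ => ?_
  rw [renewalMass, mul_assoc, ← PowerSeries.coeff_C_mul]
  simp

end

/-! ### Asymptotics and bounds of binomial coefficients; the Wright series -/

section

open Filter Topology Finset

/-- Apart from the factor j/(j+1), the left side is the inverse of Euler's sequence for Γ(s). At a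
pole of Γ the product contains a zero factor for large j, which agrees with the convention 1/0 = 0.
-/
lemma tendsto_binCoef (s : ℝ) :
    Tendsto (fun j : ℕ => binCoef (-s) (j + 1) * (j : ℝ) ^ (1 - s)) atTop (𝓝 (1 / Real.Gamma s)) := by
  have hprod : ∀ j : ℕ, binCoef (-s) (j + 1)
      = (∏ i ∈ range (j + 1), (s + i)) / ((j + 1 : ℕ).factorial : ℝ) := by
    intro j
    rw [binCoef, prod_div_distrib]
    congr 1
    · exact prod_congr rfl fun i _ => by ring
    · rw [← Finset.prod_range_add_one_eq_factorial]; push_cast; rfl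
  by_cases hs : Real.Gamma s = 0
  · rw [hs, div_zero]
    obtain ⟨m, hm⟩ := (Real.Gamma_eq_zero_iff s).1 hs
    refine tendsto_const_nhds.congr' ?_
    filter_upwards [eventually_ge_atTop m] with j hj
    rw [hprod, Finset.prod_eq_zero (mem_range.2 (Nat.lt_succ_of_le hj)) (by rw [hm]; ring)]
    simp
  · have h1 := (Real.GammaSeq_tendsto_Gamma s).inv₀ hs
    have h2 : Tendsto (fun j : ℕ => (j : ℝ) / ((j : ℝ) + 1)) atTop (𝓝 1) :=
      tendsto_natCast_div_add_atTop (1 : ℝ)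
    have h3 := h2.mul h1
    rw [one_mul, ← one_div] at h3
    refine h3.congr' ?_
    filter_upwards [eventually_gt_atTop 0] with j hj
    have hj' : (0 : ℝ) < j := by exact_mod_cast hj
    rw [hprod, Real.GammaSeq, Real.rpow_sub hj', Real.rpow_one, Nat.factorial_succ]
    have h4 : (j.factorial : ℝ) ≠ 0 := by positivity
    have h5 : (j : ℝ) ^ s ≠ 0 := by positivity
    push_cast
    rw [inv_div]
    field_simp

lemma prod_one_sub_div_le {f : ℝ} (h0 : 0 ≤ f) (h1 : f ≤ 1) (L : ℕ) :
    ∏ l ∈ range L, (1 - f / ((l : ℝ) + 1)) ≤ ((L : ℝ) + 1) ^ (-f) := by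
  induction L with
  | zero => simp
  | succ L ih =>
    rw [prod_range_succ]
    have hL : (0 : ℝ) < (L : ℝ) + 1 := by positivity
    have hf : f / ((L : ℝ) + 1) ≤ 1 := by rw [div_le_one hL]; linarith [(Nat.cast_nonneg L : (0:ℝ) ≤ L)]
    have hf0 : 0 ≤ f / ((L : ℝ) + 1) := by positivity
    refine (mul_le_mul_of_nonneg_right ih (by linarith)).trans ?_
    have hb := rpow_one_add_le_one_add_mul_self (s := 1 / ((L : ℝ) + 1)) (p := f)
      (by have : 0 ≤ 1 / ((L : ℝ) + 1) := by positivity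
          linarith) h0 h1
    have e : (1 : ℝ) + 1 / ((L : ℝ) + 1) = ((L : ℝ) + 2) / ((L : ℝ) + 1) := by field_simp; ring
    rw [e, Real.div_rpow (by positivity) hL.le] at hb
    push_cast
    rw [Real.rpow_neg hL.le, Real.rpow_neg (by positivity), show (L : ℝ) + 1 + 1 = L + 2 by ring]
    have hA : 0 < ((L : ℝ) + 1) ^ f := by positivity
    have hB : 0 < ((L : ℝ) + 2) ^ f := by positivity
    rw [inv_mul_le_iff₀ hA, ← div_eq_mul_inv, le_div_iff₀ hB]
    rw [div_le_iff₀ hA] at hb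
    calc (1 - f / ((L : ℝ) + 1)) * ((L : ℝ) + 2) ^ f
        ≤ (1 - f / ((L : ℝ) + 1)) * ((1 + f * (1 / ((L : ℝ) + 1))) * ((L : ℝ) + 1) ^ f) :=
          mul_le_mul_of_nonneg_left hb (by linarith)
      _ = (1 - (f / ((L : ℝ) + 1)) ^ 2) * ((L : ℝ) + 1) ^ f := by ring
      _ ≤ 1 * ((L : ℝ) + 1) ^ f := by
          gcongr; linarith [sq_nonneg (f / ((L : ℝ) + 1))]
      _ = _ := one_mul _

/-- The bound for rescaled binomial coefficients. -/
def binBound (γ : ℝ) (k : ℕ) : ℝ :=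
  (⌊γ * (k + 1)⌋₊.factorial : ℝ) * 2 ^ (⌊γ * (k + 1)⌋₊ + 1)

/-- With m = ⌊β⌋ and f = β - m, the first m factors of the product have absolute value at most
(m-i)/(i+1), hence product at most 1. The others split into m!/(J(J-1)⋯(J-m+1)), which is at most m!
2^m / J^m because J ≥ 2m, and ∏(1 - f/(l+1)), which is at most 2 J^{-f}. -/
lemma abs_binCoef_le {β : ℝ} (hβ : 0 < β) {J : ℕ} (hJ : 0 < J) (hm : 2 * ⌊β⌋₊ ≤ J) :
    |binCoef (β - 1) J| * (J : ℝ) ^ β ≤ (⌊β⌋₊.factorial : ℝ) * 2 ^ (⌊β⌋₊ + 1) := by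
  set m := ⌊β⌋₊ with hmdef
  obtain ⟨L, rfl⟩ : ∃ L, J = m + L := ⟨J - m, by omega⟩
  have hmβ : (m : ℝ) ≤ β := Nat.floor_le hβ.le
  have hβm : β < m + 1 := Nat.lt_floor_add_one β
  set f := β - m with hf
  have hmL : (m : ℝ) ≤ L := by exact_mod_cast (by omega : m ≤ L)
  have hJ' : (0 : ℝ) < (m : ℝ) + L := by exact_mod_cast hJ
  have first : |∏ i ∈ range m, ((i : ℝ) - (β - 1)) / ((i : ℝ) + 1)| ≤ 1 := by
    rw [Finset.abs_prod]
    calc ∏ i ∈ range m, |((i : ℝ) - (β - 1)) / ((i : ℝ) + 1)|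
        ≤ ∏ i ∈ range m, ((m - i : ℕ) : ℝ) / ((i : ℝ) + 1) := by
          refine prod_le_prod (fun _ _ => abs_nonneg _) fun i hi => ?_
          have hi' : i < m := mem_range.1 hi
          have : (i : ℝ) + 1 ≤ m := by exact_mod_cast hi'
          rw [abs_div, abs_of_pos (by positivity : (0 : ℝ) < (i : ℝ) + 1),
            abs_of_nonpos (by linarith), Nat.cast_sub hi'.le]
          gcongr; linarith
      _ = 1 := by
          have hd : ∏ i ∈ range m, ((i : ℝ) + 1) = (m.factorial : ℝ) := by
            rw [← Finset.prod_range_add_one_eq_factorial]; push_cast; rfl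
          have hn : ∏ i ∈ range m, ((m - i : ℕ) : ℝ) = (m.factorial : ℝ) := by
            rw [← hd, ← Finset.prod_range_reflect]
            refine prod_congr rfl fun i hi => ?_
            have hi' : i < m := mem_range.1 hi
            rw [show m - (m - 1 - i) = i + 1 by omega]; push_cast; rfl
          rw [prod_div_distrib, hn, hd, div_self (by positivity)]
  have second : ∏ l ∈ range L, (((m + l : ℕ) : ℝ) - (β - 1)) / (((m + l : ℕ) : ℝ) + 1)
      = (∏ l ∈ range L, ((l : ℝ) + 1) / ((m : ℝ) + l + 1)) *
        ∏ l ∈ range L, (1 - f / ((l : ℝ) + 1)) := by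
    rw [← prod_mul_distrib]
    refine prod_congr rfl fun l _ => ?_
    have : (l : ℝ) + 1 ≠ 0 := by positivity
    have : (m : ℝ) + l + 1 ≠ 0 := by positivity
    push_cast
    rw [hf]
    field_simp
    ring
  have hthird : ∏ l ∈ range L, ((l : ℝ) + 1) / ((m : ℝ) + l + 1)
      = (m.factorial : ℝ) / ((m + L).descFactorial m : ℝ) := by
    have h1 : (m.factorial : ℝ) * ∏ l ∈ range L, ((m : ℝ) + l + 1) = ((m + L).factorial : ℝ) := by
      rw [← Finset.prod_range_add_one_eq_factorial, ← Finset.prod_range_add_one_eq_factorial,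
        prod_range_add]
      push_cast; rfl
    have h2 : (L.factorial : ℝ) * ((m + L).descFactorial m : ℝ) = ((m + L).factorial : ℝ) := by
      have := Nat.factorial_mul_descFactorial (Nat.le_add_right m L)
      rw [Nat.add_sub_cancel_left] at this
      exact_mod_cast this
    have h3 : ∏ l ∈ range L, ((l : ℝ) + 1) = (L.factorial : ℝ) := by
      rw [← Finset.prod_range_add_one_eq_factorial]; push_cast; rfl
    have h4 : (0 : ℝ) < ((m + L).descFactorial m : ℝ) := by
      exact_mod_cast Nat.descFactorial_pos.2 (Nat.le_add_right m L)
    have h5 : (0 : ℝ) < ∏ l ∈ range L, ((m : ℝ) + l + 1) := prod_pos fun l _ => by positivity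
    rw [prod_div_distrib, h3, div_eq_div_iff h5.ne' h4.ne', h2, ← h1]
  have hdesc : ((m : ℝ) + L) ^ m ≤ 2 ^ m * ((m + L).descFactorial m : ℝ) := by
    have h1 : ((m + L + 1 - m : ℕ) : ℝ) ^ m ≤ ((m + L).descFactorial m : ℝ) := by
      exact_mod_cast Nat.pow_sub_le_descFactorial (m + L) m
    refine le_trans ?_ (mul_le_mul_of_nonneg_left h1 (by positivity))
    rw [← mul_pow, show m + L + 1 - m = L + 1 by omega]
    push_cast
    gcongr
    linarith
  have hf0 : 0 ≤ f := by rw [hf]; linarith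
  have hf1 : f ≤ 1 := by rw [hf]; linarith
  have hfac : ∀ l : ℕ, 0 ≤ 1 - f / ((l : ℝ) + 1) := fun l => by
    have : f / ((l : ℝ) + 1) ≤ 1 := by
      rw [div_le_one (by positivity)]; linarith [(Nat.cast_nonneg l : (0:ℝ) ≤ l)]
    linarith
  have hlast : (∏ l ∈ range L, (1 - f / ((l : ℝ) + 1))) * ((m : ℝ) + L) ^ f ≤ 2 := by
    refine (mul_le_mul_of_nonneg_right (prod_one_sub_div_le hf0 hf1 L) (by positivity)).trans ?_
    rw [Real.rpow_neg (by positivity), inv_mul_le_iff₀ (by positivity)]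
    calc ((m : ℝ) + L) ^ f ≤ (2 * ((L : ℝ) + 1)) ^ f :=
          Real.rpow_le_rpow hJ'.le (by linarith) hf0
      _ = 2 ^ f * ((L : ℝ) + 1) ^ f := Real.mul_rpow (by norm_num) (by positivity)
      _ ≤ 2 ^ (1 : ℝ) * ((L : ℝ) + 1) ^ f := by gcongr; norm_num
      _ = _ := by rw [Real.rpow_one]; ring
  have hpow : ((m + L : ℕ) : ℝ) ^ β = ((m : ℝ) + L) ^ m * ((m : ℝ) + L) ^ f := by
    rw [← Real.rpow_natCast, ← Real.rpow_add hJ']; push_cast; congr 1; rw [hf]; ring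
  have hP : 0 ≤ ∏ l ∈ range L, (1 - f / ((l : ℝ) + 1)) := prod_nonneg fun l _ => hfac l
  rw [binCoef, prod_range_add, abs_mul, second, hthird, hpow]
  have h4 : (0 : ℝ) < ((m + L).descFactorial m : ℝ) := by
    exact_mod_cast Nat.descFactorial_pos.2 (Nat.le_add_right m L)
  rw [abs_of_nonneg (mul_nonneg (by positivity) hP)]
  calc _ ≤ 1 * ((m.factorial : ℝ) / ((m + L).descFactorial m : ℝ) *
        ∏ l ∈ range L, (1 - f / ((l : ℝ) + 1))) * (((m : ℝ) + L) ^ m * ((m : ℝ) + L) ^ f) := by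
        gcongr
    _ = ((m.factorial : ℝ) / ((m + L).descFactorial m : ℝ)) * ((m : ℝ) + L) ^ m *
        ((∏ l ∈ range L, (1 - f / ((l : ℝ) + 1))) * ((m : ℝ) + L) ^ f) := by ring
    _ ≤ ((m.factorial : ℝ) / ((m + L).descFactorial m : ℝ)) *
        (2 ^ m * ((m + L).descFactorial m : ℝ)) * 2 := by gcongr
    _ = _ := by field_simp; ring

/-- Log-convexity of Γ between 1 and k+2, where m+1 is the convex combination with weight m/(k+1) ≤
γ. -/
lemma factorial_floor_le {γ : ℝ} (h0 : 0 < γ) (h1 : γ < 1) (k : ℕ) :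
    (⌊γ * (k + 1)⌋₊.factorial : ℝ) ≤ ((k + 1).factorial : ℝ) ^ γ := by
  set m := ⌊γ * ((k : ℝ) + 1)⌋₊ with hm
  have hk : (0 : ℝ) < (k : ℝ) + 1 := by positivity
  have hmle : (m : ℝ) ≤ γ * (k + 1) := Nat.floor_le (by positivity)
  have hone : (1 : ℝ) ≤ ((k + 1).factorial : ℝ) := by
    exact_mod_cast Nat.one_le_iff_ne_zero.2 (Nat.factorial_ne_zero _)
  rcases Nat.eq_zero_or_pos m with h | h
  · rw [h, Nat.factorial_zero, Nat.cast_one]; exact Real.one_le_rpow hone h0.le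
  · have hm0 : (0 : ℝ) < m := by exact_mod_cast h
    have hl : (m : ℝ) / (k + 1) ≤ γ := by rwa [div_le_iff₀ hk]
    have := Real.Gamma_mul_add_mul_le_rpow_Gamma_mul_rpow_Gamma (s := (k : ℝ) + 1 + 1) (t := 1)
      (a := (m : ℝ) / (k + 1)) (b := 1 - (m : ℝ) / (k + 1)) (by positivity) one_pos
      (by positivity) (by linarith) (by ring)
    rw [Real.Gamma_one, Real.one_rpow, mul_one, mul_one, show (m : ℝ) / (k + 1) * ((k : ℝ) + 1 + 1)
      + (1 - (m : ℝ) / (k + 1)) = m + 1 by field_simp; ring, Real.Gamma_nat_eq_factorial,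
      show (k : ℝ) + 1 + 1 = ((k + 1 : ℕ) : ℝ) + 1 by push_cast; ring,
      Real.Gamma_nat_eq_factorial] at this
    exact this.trans (Real.rpow_le_rpow_of_exponent_le hone hl)

/-- By `factorial_floor_le` the terms are at most a geometric factor times (k+1)!^γ / k!, whose
ratios decay like k^{γ-1}. -/
lemma summable_binBound {γ : ℝ} (h0 : 0 < γ) (h1 : γ < 1) (A : ℝ) :
    Summable fun k : ℕ => |A| ^ k / (k.factorial : ℝ) * binBound γ k := by
  set B := |A| + 1 with hB
  have hBpos : 0 < B := by positivity
  have hs : Summable fun k : ℕ => (2 * B) ^ k * ((k + 1).factorial : ℝ) ^ γ / (k.factorial : ℝ) := by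
    refine summable_of_ratio_test_tendsto_lt_one (l := 0) one_pos
      (Eventually.of_forall fun k => by positivity) ?_
    have e : ∀ k : ℕ, ‖(2 * B) ^ (k + 1) * ((k + 1 + 1).factorial : ℝ) ^ γ / ((k + 1).factorial : ℝ)‖ /
        ‖(2 * B) ^ k * ((k + 1).factorial : ℝ) ^ γ / (k.factorial : ℝ)‖
        = 2 * B * (((k : ℝ) + 2) / (k + 1)) ^ γ * ((k : ℝ) + 1) ^ (-(1 - γ)) := by
      intro k
      rw [Real.norm_of_nonneg (by positivity), Real.norm_of_nonneg (by positivity),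
        Nat.factorial_succ (k + 1)]
      rw [Nat.cast_mul, Real.mul_rpow (by positivity) (by positivity), Nat.factorial_succ k,
        Real.div_rpow (by positivity) (by positivity), show -(1 - γ) = γ - 1 by ring,
        Real.rpow_sub (by positivity), Real.rpow_one]
      have : (k.factorial : ℝ) ≠ 0 := by positivity
      have : (((k + 1) * k.factorial : ℕ) : ℝ) ^ γ ≠ 0 := by positivity
      have : ((k : ℝ) + 1) ^ γ ≠ 0 := by positivity
      push_cast at *
      rw [show (k : ℝ) + 1 + 1 = k + 2 by ring]
      field_simp
      ring
    simp_rw [e]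
    have t1 : Tendsto (fun k : ℕ => ((k : ℝ) + 1) ^ (-(1 - γ))) atTop (𝓝 0) :=
      (tendsto_rpow_neg_atTop (by linarith)).comp
        (tendsto_atTop_add_const_right _ _ tendsto_natCast_atTop_atTop)
    refine squeeze_zero (g := fun k : ℕ => 2 * B * 2 * ((k : ℝ) + 1) ^ (-(1 - γ)))
      (fun k => by positivity) (fun k => ?_) (by simpa using t1.const_mul (2 * B * 2))
    refine mul_le_mul_of_nonneg_right (mul_le_mul_of_nonneg_left ?_ (by positivity)) (by positivity)
    calc (((k : ℝ) + 2) / (k + 1)) ^ γ ≤ 2 ^ γ := by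
          gcongr; rw [div_le_iff₀ (by positivity)]; linarith [(Nat.cast_nonneg k : (0:ℝ) ≤ k)]
      _ ≤ 2 ^ (1 : ℝ) := by gcongr; norm_num
      _ = 2 := Real.rpow_one 2
  refine Summable.of_nonneg_of_le (fun k => by unfold binBound; positivity) (fun k => ?_)
    (hs.mul_left 4)
  have hm : ⌊γ * ((k : ℝ) + 1)⌋₊ ≤ k + 1 := by
    refine Nat.floor_le_of_le ?_
    push_cast
    nlinarith [(Nat.cast_nonneg k : (0:ℝ) ≤ k)]
  calc |A| ^ k / (k.factorial : ℝ) * binBound γ k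
      ≤ B ^ k / (k.factorial : ℝ) * (((k + 1).factorial : ℝ) ^ γ * 2 ^ (k + 1 + 1)) := by
        unfold binBound
        gcongr
        · linarith
        · exact factorial_floor_le h0 h1 k
        · norm_num
    _ = _ := by rw [mul_pow]; ring

/-- The bound of `abs_binCoef_le` passes to the limit in `tendsto_binCoef`, so the same majorant
serves the Wright series and its discrete approximations. -/
lemma abs_inv_Gamma_le {γ : ℝ} (h0 : 0 < γ) (k : ℕ) :
    |1 / Real.Gamma (-γ * k + 1 - γ)| ≤ binBound γ k := by
  have h := (tendsto_binCoef (-γ * k + 1 - γ)).abs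
  refine le_of_tendsto h ?_
  filter_upwards [eventually_ge_atTop (2 * ⌊γ * ((k : ℝ) + 1)⌋₊)] with j hj
  have := abs_binCoef_le (β := γ * (k + 1)) (by positivity) (J := j + 1) (by omega) (by omega)
  refine le_trans ?_ this
  rw [abs_mul, show -(-γ * k + 1 - γ) = γ * ((k : ℝ) + 1) - 1 by ring,
    show 1 - (-γ * k + 1 - γ) = γ * ((k : ℝ) + 1) by ring]
  rw [abs_of_nonneg (by positivity : (0 : ℝ) ≤ (j : ℝ) ^ (γ * ((k : ℝ) + 1)))]
  gcongr
  linarith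

lemma continuous_wrightPhi {γ : ℝ} (h0 : 0 < γ) (h1 : γ < 1) : Continuous (wrightPhi γ) := by
  rw [continuous_iff_continuousAt]
  intro z
  have hc : ContinuousOn (wrightPhi γ) (Set.Icc (z - 1) (z + 1)) := by
    refine continuousOn_tsum (fun k => by fun_prop) (summable_binBound h0 h1 (|z| + 1))
      fun k x hx => ?_
    rw [Real.norm_eq_abs, ← div_div, div_eq_mul_one_div _ (Real.Gamma _), abs_mul, abs_div, abs_pow,
      abs_neg, Nat.abs_cast]
    have : |x| ≤ |(|z| + 1)| := by
      rw [abs_of_nonneg (by positivity : 0 ≤ |z| + 1)]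
      have : |x - z| ≤ 1 := abs_le.2 ⟨by linarith [hx.1], by linarith [hx.2]⟩
      calc |x| = |z + (x - z)| := by ring_nf
        _ ≤ _ := (abs_add_le _ _).trans (by linarith)
    gcongr
    exact abs_inv_Gamma_le h0 k
  exact hc.continuousAt (Icc_mem_nhds (by linarith) (by linarith))

lemma wrightPhi_zero_pos {γ : ℝ} (h1 : γ < 1) : 0 < wrightPhi γ 0 := by
  rw [wrightPhi, tsum_eq_single 0]
  · simp only [pow_zero, Nat.factorial_zero, Nat.cast_one, one_mul, Nat.cast_zero, mul_zero, zero_add]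
    have := Real.Gamma_pos_of_pos (s := 1 - γ) (by linarith)
    positivity
  · intro k hk; simp [hk]

end

/-! ### Convergence of the rescaled renewal masses to the Wright function -/

section

open Filter Topology Finset

/-- The rescaled renewal masses, which converge to the Wright function. -/
def wrightApprox (γ : ℝ) (j : ℕ) (z : ℝ) : ℝ :=
  (j : ℝ) ^ γ * renewalMass γ ⌊z * (j : ℝ) ^ γ⌋₊ (j + 1)

lemma wrightApprox_nonneg {γ : ℝ} (h0 : 0 < γ) (h1 : γ < 1) (j : ℕ) (z : ℝ) :
    0 ≤ wrightApprox γ j z :=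
  mul_nonneg (by positivity) (renewalMass_nonneg h0 h1 _ _)

/-- The terms of the expansion of `wrightApprox`. -/
def wrightApproxTerm (γ : ℝ) (j : ℕ) (z : ℝ) (k : ℕ) : ℝ :=
  ((⌊z * (j : ℝ) ^ γ⌋₊.choose k : ℝ) / ((j : ℝ) ^ γ) ^ k * (-1) ^ k) *
    (binCoef (γ * k + γ - 1) (j + 1) * (j : ℝ) ^ (γ * (k + 1)))

lemma wrightApprox_eq_tsum (γ : ℝ) {j : ℕ} (hj : 0 < j) (z : ℝ) :
    wrightApprox γ j z = ∑' k, wrightApproxTerm γ j z k := by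
  have hj' : (0 : ℝ) < j := by exact_mod_cast hj
  rw [tsum_eq_sum (s := range (⌊z * (j : ℝ) ^ γ⌋₊ + 1))]
  · rw [wrightApprox, renewalMass_eq_sum, mul_sum]
    refine sum_congr rfl fun k _ => ?_
    have : (j : ℝ) ^ (γ * (k + 1)) = ((j : ℝ) ^ γ) ^ k * (j : ℝ) ^ γ := by
      rw [Real.rpow_mul hj'.le, ← pow_succ, ← Real.rpow_natCast]; push_cast; rfl
    rw [wrightApproxTerm, this]
    have h2 : ((j : ℝ) ^ γ) ^ k ≠ 0 := by positivity
    field_simp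
  · intro k hk
    rw [mem_range, not_lt] at hk
    rw [wrightApproxTerm, Nat.choose_eq_zero_of_lt (by omega)]
    simp

/-- Terms with k > n = ⌊z j^γ⌋ vanish. For k ≤ n the condition 2⌊γ(k+1)⌋ ≤ j+1 of `abs_binCoef_le`
holds for large j, since n ≤ R j^γ is of smaller order than j. -/
lemma eventually_abs_wrightApproxTerm_le {γ : ℝ} (h0 : 0 < γ) (h1 : γ < 1) (R : ℝ) :
    ∀ᶠ j : ℕ in atTop, ∀ z ∈ Set.Icc 0 R, ∀ k,
      |wrightApproxTerm γ j z k| ≤ |R| ^ k / (k.factorial : ℝ) * binBound γ k := by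
  have hlim : Tendsto (fun j : ℕ => (j : ℝ) ^ (1 - γ)) atTop atTop :=
    (tendsto_rpow_atTop (by linarith)).comp tendsto_natCast_atTop_atTop
  filter_upwards [eventually_gt_atTop 0, hlim.eventually_ge_atTop (2 * |R| + 1)] with j hj hj2 z hz k
  have hj' : (0 : ℝ) < j := by exact_mod_cast hj
  have hj1 : (1 : ℝ) ≤ j := by exact_mod_cast hj
  have hR : 0 ≤ R := hz.1.trans hz.2
  set n := ⌊z * (j : ℝ) ^ γ⌋₊ with hn
  have hnle : (n : ℝ) ≤ R * (j : ℝ) ^ γ :=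
    (Nat.floor_le (mul_nonneg hz.1 (by positivity))).trans
      (mul_le_mul_of_nonneg_right hz.2 (by positivity))
  by_cases hk : n < k
  · rw [wrightApproxTerm, ← hn, Nat.choose_eq_zero_of_lt hk]
    simp only [Nat.cast_zero, zero_div, zero_mul, abs_zero]
    unfold binBound; positivity
  push Not at hk
  have hfl : ⌊γ * ((k : ℝ) + 1)⌋₊ ≤ k + 1 := by
    refine Nat.floor_le_of_le ?_
    push_cast
    nlinarith [(Nat.cast_nonneg k : (0:ℝ) ≤ k)]
  have hg1 : (1 : ℝ) ≤ (j : ℝ) ^ γ := Real.one_le_rpow hj1 h0.le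
  have hsplit : (j : ℝ) = (j : ℝ) ^ (1 - γ) * (j : ℝ) ^ γ := by
    rw [← Real.rpow_add hj']; simp
  have hsmall : 2 * ⌊γ * ((k : ℝ) + 1)⌋₊ ≤ j + 1 := by
    have hn2 : 2 * (n : ℝ) + 1 ≤ j := by
      rw [abs_of_nonneg hR] at hj2
      calc 2 * (n : ℝ) + 1 ≤ 2 * (R * (j : ℝ) ^ γ) + (j : ℝ) ^ γ := by linarith
        _ = (2 * R + 1) * (j : ℝ) ^ γ := by ring
        _ ≤ (j : ℝ) ^ (1 - γ) * (j : ℝ) ^ γ := by gcongr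
        _ = j := hsplit.symm
    have : 2 * n + 1 ≤ j := by exact_mod_cast hn2
    omega
  have hb := abs_binCoef_le (β := γ * (k + 1)) (by positivity) (Nat.succ_pos j) hsmall
  have hA : |((n.choose k : ℝ) / ((j : ℝ) ^ γ) ^ k * (-1) ^ k)| ≤ |R| ^ k / (k.factorial : ℝ) := by
    rw [abs_mul, abs_pow, abs_neg, abs_one, one_pow, mul_one, abs_of_nonneg (by positivity),
      div_le_iff₀ (by positivity), abs_of_nonneg hR]
    calc (n.choose k : ℝ) ≤ (n : ℝ) ^ k / (k.factorial : ℝ) := Nat.choose_le_pow_div k n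
      _ ≤ (R * (j : ℝ) ^ γ) ^ k / (k.factorial : ℝ) := by gcongr
      _ = _ := by rw [mul_pow]; ring
  rw [wrightApproxTerm, abs_mul]
  refine mul_le_mul hA ?_ (abs_nonneg _) (by positivity)
  refine le_trans ?_ hb
  rw [abs_mul, show γ * (k : ℝ) + γ - 1 = γ * ((k : ℝ) + 1) - 1 by ring,
    abs_of_nonneg (by positivity : (0 : ℝ) ≤ (j : ℝ) ^ (γ * ((k : ℝ) + 1)))]
  gcongr
  linarith

lemma tendsto_choose_div_pow (z : ℝ) (hz : 0 ≤ z) {c : ℕ → ℝ} (hc : Tendsto c atTop atTop) (k : ℕ) :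
    Tendsto (fun j => ((⌊z * c j⌋₊.choose k : ℕ) : ℝ) / c j ^ k) atTop
      (𝓝 (z ^ k / (k.factorial : ℝ))) := by
  have h1 : Tendsto (fun j => ((⌊z * c j⌋₊ : ℕ) : ℝ) / c j) atTop (𝓝 z) :=
    (tendsto_nat_floor_mul_div_atTop hz).comp hc
  have h2 : ∀ i : ℕ, Tendsto (fun j => ((⌊z * c j⌋₊ - i : ℕ) : ℝ) / c j) atTop (𝓝 z) := by
    intro i
    have h3 : Tendsto (fun j => ((⌊z * c j⌋₊ : ℕ) : ℝ) / c j - i / c j) atTop (𝓝 z) := by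
      simpa using h1.sub (hc.const_div_atTop (i : ℝ))
    refine tendsto_of_tendsto_of_tendsto_of_le_of_le' h3 h1 ?_ ?_
    · filter_upwards [hc.eventually_gt_atTop 0] with j hj
      rw [← sub_div]
      gcongr
      rw [sub_le_iff_le_add]
      exact_mod_cast (by omega : ⌊z * c j⌋₊ ≤ ⌊z * c j⌋₊ - i + i)
    · filter_upwards [hc.eventually_gt_atTop 0] with j hj
      gcongr
      omega
  have h3 := (tendsto_finsetProd (range k) fun i _ => h2 i).div_const (k.factorial : ℝ)
  rw [prod_const, card_range] at h3
  refine h3.congr fun j => ?_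
  rw [Nat.choose_eq_descFactorial_div_factorial, Nat.descFactorial_eq_prod_range,
    Nat.cast_div (by rw [← Nat.descFactorial_eq_prod_range]; exact Nat.factorial_dvd_descFactorial _ _)
      (by positivity), prod_div_distrib, prod_const, card_range]
  push_cast
  ring

lemma tendsto_natCast_rpow {γ : ℝ} (h0 : 0 < γ) :
    Tendsto (fun j : ℕ => (j : ℝ) ^ γ) atTop atTop :=
  (tendsto_rpow_atTop h0).comp tendsto_natCast_atTop_atTop

/-- Dominated convergence for series: C(n,k)/j^{γk} tends to z^k/k!, and the rescaled binomial
coefficient tends to 1/Γ(1-γ-γk). -/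
lemma tendsto_wrightApprox {γ : ℝ} (h0 : 0 < γ) (h1 : γ < 1) {z : ℝ} (hz : 0 ≤ z) :
    Tendsto (fun j => wrightApprox γ j z) atTop (𝓝 (wrightPhi γ z)) := by
  have key : Tendsto (fun j => ∑' k, wrightApproxTerm γ j z k) atTop (𝓝 (wrightPhi γ z)) := by
    refine tendsto_tsum_of_dominated_convergence (summable_binBound h0 h1 z) (fun k => ?_) ?_
    · have hb := tendsto_binCoef (-γ * k + 1 - γ)
      rw [show -(-γ * (k : ℝ) + 1 - γ) = γ * k + γ - 1 by ring,
        show 1 - (-γ * (k : ℝ) + 1 - γ) = γ * (k + 1) by ring] at hb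
      have := ((tendsto_choose_div_pow z hz (tendsto_natCast_rpow h0) k).mul_const ((-1) ^ k)).mul hb
      have e : (-z) ^ k / ((k.factorial : ℝ) * Real.Gamma (-γ * k + 1 - γ))
          = z ^ k / (k.factorial : ℝ) * (-1) ^ k * (1 / Real.Gamma (-γ * k + 1 - γ)) := by
        rw [neg_pow, ← div_div]; ring
      rw [e]
      exact this
    · filter_upwards [eventually_abs_wrightApproxTerm_le h0 h1 z] with j hj k
      exact hj z ⟨hz, le_rfl⟩ k
  refine key.congr' ?_
  filter_upwards [eventually_gt_atTop 0] with j hj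
  exact (wrightApprox_eq_tsum γ hj z).symm

lemma wrightPhi_nonneg {γ : ℝ} (h0 : 0 < γ) (h1 : γ < 1) {z : ℝ} (hz : 0 ≤ z) :
    0 ≤ wrightPhi γ z :=
  ge_of_tendsto' (tendsto_wrightApprox h0 h1 hz) fun j => wrightApprox_nonneg h0 h1 j z

lemma eventually_wrightApprox_le {γ : ℝ} (h0 : 0 < γ) (h1 : γ < 1) (R : ℝ) :
    ∃ C, ∀ᶠ j : ℕ in atTop, ∀ z ∈ Set.Icc 0 R, wrightApprox γ j z ≤ C := by
  refine ⟨∑' k, |R| ^ k / (k.factorial : ℝ) * binBound γ k, ?_⟩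
  filter_upwards [eventually_abs_wrightApproxTerm_le h0 h1 R, eventually_gt_atTop 0] with j hj hj0 z hz
  rw [wrightApprox_eq_tsum γ hj0]
  have hs : Summable fun k => wrightApproxTerm γ j z k :=
    Summable.of_norm_bounded (summable_binBound h0 h1 R) (hj z hz)
  exact hs.tsum_le_tsum (fun k => (le_abs_self _).trans (hj z hz k)) (summable_binBound h0 h1 R)

end

/-! ### Moments of the Wright function -/

section

open Filter Topology Finset MeasureTheory

lemma integral_floor_eq_sum (f : ℕ → ℝ) (L : ℕ) (hf : ∀ n, L ≤ n → f n = 0) :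
    IntegrableOn (fun z : ℝ => f ⌊z⌋₊) (Set.Ioi 0) ∧
      ∫ z in Set.Ioi (0 : ℝ), f ⌊z⌋₊ = ∑ n ∈ range L, f n := by
  have hind : Set.EqOn (fun z : ℝ => f ⌊z⌋₊)
      (fun z => ∑ n ∈ range L, (Set.Ico (n : ℝ) (n + 1)).indicator (fun _ => f n) z) (Set.Ioi 0) := by
    intro z hz
    have hz0 : (0 : ℝ) ≤ z := le_of_lt hz
    have hmem : ∀ n : ℕ, z ∈ Set.Ico (n : ℝ) (n + 1) ↔ ⌊z⌋₊ = n := fun n => by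
      rw [Nat.floor_eq_iff hz0]; rfl
    simp only [Set.indicator, hmem]
    rw [sum_ite_eq]
    split_ifs with h
    · rfl
    · exact hf _ (by simpa using h)
  have hint : ∀ n ∈ range L, IntegrableOn
      ((Set.Ico (n : ℝ) (n + 1)).indicator (fun _ => f n)) (Set.Ioi 0) := by
    intro n _
    refine Integrable.integrableOn ?_
    rw [integrable_indicator_iff measurableSet_Ico]
    exact integrableOn_const (by simp)
  refine ⟨IntegrableOn.congr_fun (integrable_finsetSum _ hint) hind.symm measurableSet_Ioi, ?_⟩
  · rw [setIntegral_congr_fun measurableSet_Ioi hind, integral_finsetSum _ hint]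
    refine sum_congr rfl fun n _ => ?_
    rw [← integral_Ici_eq_integral_Ioi, setIntegral_indicator measurableSet_Ico,
      Set.inter_eq_right.2 (Set.Ico_subset_Ici_self.trans (Set.Ici_subset_Ici.2 (Nat.cast_nonneg n)))]
    simp

/-- The integrands which approximate `z ^ m * wrightPhi γ z`. -/
def momentApprox (γ : ℝ) (m j : ℕ) (z : ℝ) : ℝ :=
  ((⌊z * (j : ℝ) ^ γ⌋₊ + 1).ascFactorial m : ℝ) / ((j : ℝ) ^ γ) ^ m * wrightApprox γ j z

lemma momentApprox_nonneg {γ : ℝ} (h0 : 0 < γ) (h1 : γ < 1) (m j : ℕ) (z : ℝ) :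
    0 ≤ momentApprox γ m j z :=
  mul_nonneg (by positivity) (wrightApprox_nonneg h0 h1 j z)

/-- The integrand is a step function of mesh j^{-γ}. The rising factorial (n+1)⋯(n+m) = m! C(n+m,m)
is used instead of n^m because `sum_choose_mul_renewalMass` then evaluates the integral exactly. -/
lemma integral_momentApprox (γ : ℝ) (m : ℕ) {j : ℕ} (hj : 0 < j) :
    IntegrableOn (momentApprox γ m j) (Set.Ioi 0) ∧
    ∫ z in Set.Ioi (0 : ℝ), momentApprox γ m j z
      = m.factorial * (binCoef (-(1 + γ * m)) (j + 1) * (j : ℝ) ^ (1 - (1 + γ * m))) := by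
  have hj' : (0 : ℝ) < j := by exact_mod_cast hj
  have hc : (0 : ℝ) < (j : ℝ) ^ γ := by positivity
  set f : ℕ → ℝ := fun n => ((n + 1).ascFactorial m : ℝ) / ((j : ℝ) ^ γ) ^ m *
    ((j : ℝ) ^ γ * renewalMass γ n (j + 1)) with hf
  obtain ⟨hi, he⟩ := integral_floor_eq_sum f (j + 1 + 1)
    (fun n hn => by rw [hf]; simp [renewalMass_eq_zero γ (show j + 1 < n by omega)])
  have hmom : momentApprox γ m j = fun z => (fun z => f ⌊z⌋₊) (z * (j : ℝ) ^ γ) := rfl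
  rw [hmom]
  refine ⟨(integrableOn_Ioi_comp_mul_right_iff (fun z => f ⌊z⌋₊) 0 hc).2
    (by rw [zero_mul]; exact hi), ?_⟩
  rw [integral_comp_mul_right_Ioi _ _ hc, zero_mul, he, smul_eq_mul, mul_sum]
  have hs := sum_choose_mul_renewalMass γ m (le_refl (j + 1))
  have hexp : (j : ℝ) ^ (1 - (1 + γ * m)) = (((j : ℝ) ^ γ) ^ m)⁻¹ := by
    rw [show 1 - (1 + γ * (m : ℝ)) = -(γ * m) by ring, Real.rpow_neg hj'.le, Real.rpow_mul hj'.le,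
      Real.rpow_natCast]
  rw [show -(1 + γ * (m : ℝ)) = -1 - γ * m by ring, ← hs, hexp, sum_mul, mul_sum]
  refine sum_congr rfl fun n _ => ?_
  rw [hf]
  simp only
  rw [Nat.ascFactorial_eq_factorial_mul_choose]
  push_cast
  field_simp

lemma tendsto_integral_momentApprox (γ : ℝ) (m : ℕ) :
    Tendsto (fun j => ∫ z in Set.Ioi (0 : ℝ), momentApprox γ m j z) atTop
      (𝓝 (m.factorial / Real.Gamma (1 + γ * m))) := by
  have := (tendsto_binCoef (1 + γ * m)).const_mul (m.factorial : ℝ)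
  rw [mul_one_div] at this
  refine this.congr' ?_
  filter_upwards [eventually_gt_atTop 0] with j hj
  exact (integral_momentApprox γ m hj).2.symm

lemma tendsto_momentApprox {γ : ℝ} (h0 : 0 < γ) (h1 : γ < 1) (m : ℕ) {z : ℝ} (hz : 0 ≤ z) :
    Tendsto (fun j => momentApprox γ m j z) atTop (𝓝 (z ^ m * wrightPhi γ z)) := by
  refine Tendsto.mul ?_ (tendsto_wrightApprox h0 h1 hz)
  have hc := tendsto_natCast_rpow h0
  have hfl : Tendsto (fun j : ℕ => ((⌊z * (j : ℝ) ^ γ⌋₊ : ℕ) : ℝ) / (j : ℝ) ^ γ) atTop (𝓝 z) :=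
    (tendsto_nat_floor_mul_div_atTop hz).comp hc
  have hup : Tendsto (fun j : ℕ => (((⌊z * (j : ℝ) ^ γ⌋₊ : ℕ) : ℝ) / (j : ℝ) ^ γ
      + m / (j : ℝ) ^ γ) ^ m) atTop (𝓝 (z ^ m)) := by
    simpa using (hfl.add (hc.const_div_atTop (m : ℝ))).pow m
  refine tendsto_of_tendsto_of_tendsto_of_le_of_le (hfl.pow m) hup (fun j => ?_) (fun j => ?_)
  · simp only
    rw [div_pow]
    gcongr
    exact_mod_cast (Nat.pow_le_pow_left (Nat.le_succ _) m).trans (Nat.pow_succ_le_ascFactorial _ m)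
  · simp only
    rw [← add_div, div_pow]
    gcongr
    exact_mod_cast Nat.ascFactorial_le_pow_add _ m

/-- Passing from m to m+1 multiplies the integrand by (n+1+m)/j^γ, where n = ⌊z j^γ⌋, and this
exceeds z ≥ R. It is the Markov inequality that prevents mass from escaping to infinity. -/
lemma mul_momentApprox_le {γ : ℝ} (h0 : 0 < γ) (h1 : γ < 1) (m : ℕ) {j : ℕ} (hj : 0 < j) {z R : ℝ}
    (hz : R ≤ z) : R * momentApprox γ m j z ≤ momentApprox γ (m + 1) j z := by
  have hj' : (0 : ℝ) < j := by exact_mod_cast hj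
  have hc : (0 : ℝ) < (j : ℝ) ^ γ := by positivity
  rw [momentApprox, momentApprox, ← mul_assoc]
  refine mul_le_mul_of_nonneg_right ?_ (wrightApprox_nonneg h0 h1 j z)
  rw [Nat.ascFactorial_succ, ← mul_div_assoc, pow_succ, div_le_div_iff₀ (by positivity) (by positivity)]
  have hfl : z * (j : ℝ) ^ γ ≤ (⌊z * (j : ℝ) ^ γ⌋₊ : ℝ) + 1 := (Nat.lt_floor_add_one _).le
  have hR : R * (j : ℝ) ^ γ ≤ (⌊z * (j : ℝ) ^ γ⌋₊ : ℝ) + 1 + m :=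
    (mul_le_mul_of_nonneg_right hz hc.le).trans (hfl.trans (by linarith [(Nat.cast_nonneg m : (0:ℝ) ≤ m)]))
  push_cast
  calc _ = (R * (j : ℝ) ^ γ) * (((⌊z * (j : ℝ) ^ γ⌋₊ + 1).ascFactorial m : ℝ) * ((j : ℝ) ^ γ) ^ m) := by
        ring
    _ ≤ ((⌊z * (j : ℝ) ^ γ⌋₊ : ℝ) + 1 + m) *
        (((⌊z * (j : ℝ) ^ γ⌋₊ + 1).ascFactorial m : ℝ) * ((j : ℝ) ^ γ) ^ m) := by gcongr
    _ = _ := by ring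

lemma eventually_momentApprox_le {γ : ℝ} (h0 : 0 < γ) (h1 : γ < 1) (m : ℕ) (R : ℝ) :
    ∃ C, ∀ᶠ j : ℕ in atTop, ∀ z ∈ Set.Icc 0 R, momentApprox γ m j z ≤ C := by
  obtain ⟨C, hC⟩ := eventually_wrightApprox_le h0 h1 R
  refine ⟨(R + m) ^ m * |C|, ?_⟩
  filter_upwards [hC, eventually_gt_atTop 0] with j hj hj0 z hz
  have hj1 : (1 : ℝ) ≤ j := by exact_mod_cast hj0
  have hc : (1 : ℝ) ≤ (j : ℝ) ^ γ := Real.one_le_rpow hj1 h0.le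
  have hR : 0 ≤ R := hz.1.trans hz.2
  refine mul_le_mul ?_ ((hj z hz).trans (le_abs_self C)) (wrightApprox_nonneg h0 h1 j z) (by positivity)
  rw [div_le_iff₀ (by positivity), ← mul_pow]
  have h2 : ((⌊z * (j : ℝ) ^ γ⌋₊ + 1).ascFactorial m : ℝ) ≤ ((⌊z * (j : ℝ) ^ γ⌋₊ : ℝ) + m) ^ m := by
    exact_mod_cast Nat.ascFactorial_le_pow_add _ m
  refine h2.trans (pow_le_pow_left₀ (by positivity) ?_ m)
  have := Nat.floor_le (mul_nonneg hz.1 (by positivity : (0:ℝ) ≤ (j : ℝ) ^ γ))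
  have h3 : z * (j : ℝ) ^ γ ≤ R * (j : ℝ) ^ γ := mul_le_mul_of_nonneg_right hz.2 (by positivity)
  nlinarith [(Nat.cast_nonneg m : (0:ℝ) ≤ m)]

lemma tendsto_intervalIntegral_momentApprox {γ : ℝ} (h0 : 0 < γ) (h1 : γ < 1) (m : ℕ) {R : ℝ}
    (hR : 0 ≤ R) : Tendsto (fun j => ∫ z in (0 : ℝ)..R, momentApprox γ m j z) atTop
      (𝓝 (∫ z in (0 : ℝ)..R, z ^ m * wrightPhi γ z)) := by
  obtain ⟨C, hC⟩ := eventually_momentApprox_le h0 h1 m R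
  refine intervalIntegral.tendsto_integral_filter_of_dominated_convergence (fun _ => C) ?_ ?_
    (by simp) ?_
  · filter_upwards [eventually_gt_atTop 0] with j hj
    rw [Set.uIoc_of_le hR]
    exact (((integral_momentApprox γ m hj).1.mono_set Set.Ioc_subset_Ioi_self)).aestronglyMeasurable
  · filter_upwards [hC] with j hj
    refine Eventually.of_forall fun z hz => ?_
    rw [Set.uIoc_of_le hR] at hz
    rw [Real.norm_of_nonneg (momentApprox_nonneg h0 h1 m j z)]
    exact hj z ⟨hz.1.le, hz.2⟩
  · refine Eventually.of_forall fun z hz => ?_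
    rw [Set.uIoc_of_le hR] at hz
    exact tendsto_momentApprox h0 h1 m hz.1.le

lemma intervalIntegral_moment_le {γ : ℝ} (h0 : 0 < γ) (h1 : γ < 1) (m : ℕ) {R : ℝ} (hR : 0 ≤ R) :
    ∫ z in (0 : ℝ)..R, z ^ m * wrightPhi γ z ≤ m.factorial / Real.Gamma (1 + γ * m) := by
  refine le_of_tendsto_of_tendsto (tendsto_intervalIntegral_momentApprox h0 h1 m hR)
    (tendsto_integral_momentApprox γ m) ?_
  filter_upwards [eventually_gt_atTop 0] with j hj
  rw [intervalIntegral.integral_of_le hR]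
  exact setIntegral_mono_set (integral_momentApprox γ m hj).1
    (Eventually.of_forall fun z => momentApprox_nonneg h0 h1 m j z)
    (Eventually.of_forall Set.Ioc_subset_Ioi_self)

/-- The part of the m-th moment beyond R is at most the (m+1)-st moment divided by R. With the upper
bound `intervalIntegral_moment_le`, letting R tend to infinity gives the exact moment. -/
lemma le_intervalIntegral_moment {γ : ℝ} (h0 : 0 < γ) (h1 : γ < 1) (m : ℕ) {R : ℝ} (hR : 0 < R) :
    m.factorial / Real.Gamma (1 + γ * m)
      - ((m + 1).factorial / Real.Gamma (1 + γ * (m + 1 : ℕ))) / R ≤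
    ∫ z in (0 : ℝ)..R, z ^ m * wrightPhi γ z := by
  refine le_of_tendsto_of_tendsto ((tendsto_integral_momentApprox γ m).sub
    ((tendsto_integral_momentApprox γ (m + 1)).div_const R))
    (tendsto_intervalIntegral_momentApprox h0 h1 m hR.le) ?_
  filter_upwards [eventually_gt_atTop 0] with j hj
  have hi := (integral_momentApprox γ m hj).1
  have hi' := (integral_momentApprox γ (m + 1) hj).1
  have hsplit : ∫ z in Set.Ioi (0 : ℝ), momentApprox γ m j z
      = (∫ z in (0 : ℝ)..R, momentApprox γ m j z) + ∫ z in Set.Ioi R, momentApprox γ m j z := by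
    rw [intervalIntegral.integral_of_le hR.le, ← setIntegral_union
      (Set.Ioc_disjoint_Ioi le_rfl) measurableSet_Ioi
      (hi.mono_set Set.Ioc_subset_Ioi_self) (hi.mono_set (Set.Ioi_subset_Ioi hR.le)),
      Set.Ioc_union_Ioi_eq_Ioi hR.le]
  have htail : ∫ z in Set.Ioi R, momentApprox γ m j z
      ≤ (∫ z in Set.Ioi (0 : ℝ), momentApprox γ (m + 1) j z) / R := by
    rw [le_div_iff₀ hR, mul_comm, ← integral_const_mul]
    calc ∫ z in Set.Ioi R, R * momentApprox γ m j z
        ≤ ∫ z in Set.Ioi R, momentApprox γ (m + 1) j z := by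
          refine setIntegral_mono_on ((hi.mono_set (Set.Ioi_subset_Ioi hR.le)).const_mul R)
            (hi'.mono_set (Set.Ioi_subset_Ioi hR.le)) measurableSet_Ioi fun z hz => ?_
          exact mul_momentApprox_le h0 h1 m hj (le_of_lt hz)
      _ ≤ _ := setIntegral_mono_set hi'
          (Eventually.of_forall fun z => momentApprox_nonneg h0 h1 (m + 1) j z)
          (Eventually.of_forall (Set.Ioi_subset_Ioi hR.le))
  linarith

lemma integrableOn_moment {γ : ℝ} (h0 : 0 < γ) (h1 : γ < 1) (m : ℕ) :
    IntegrableOn (fun z => z ^ m * wrightPhi γ z) (Set.Ioi 0) := by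
  have hc : Continuous fun z => z ^ m * wrightPhi γ z :=
    (continuous_id.pow m).mul (continuous_wrightPhi h0 h1)
  refine integrableOn_Ioi_of_intervalIntegral_norm_bounded
    (m.factorial / Real.Gamma (1 + γ * m)) 0 (fun i : ℝ => (hc.integrableOn_Icc).mono_set
      Set.Ioc_subset_Icc_self) tendsto_id ?_
  filter_upwards [eventually_ge_atTop 0] with R hR
  rw [id]
  refine le_trans (le_of_eq ?_) (intervalIntegral_moment_le h0 h1 m hR)
  refine intervalIntegral.integral_congr fun z hz => ?_
  rw [Set.uIcc_of_le hR] at hz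
  exact Real.norm_of_nonneg (mul_nonneg (pow_nonneg hz.1 m) (wrightPhi_nonneg h0 h1 hz.1))

/-- The moments of the Wright function. -/
lemma integral_moment {γ : ℝ} (h0 : 0 < γ) (h1 : γ < 1) (m : ℕ) :
    ∫ z in Set.Ioi (0 : ℝ), z ^ m * wrightPhi γ z = m.factorial / Real.Gamma (1 + γ * m) := by
  have hlim := intervalIntegral_tendsto_integral_Ioi 0 (integrableOn_moment h0 h1 m) tendsto_id
  refine le_antisymm (le_of_tendsto hlim ?_) (le_of_tendsto_of_tendsto
    (f := fun R : ℝ => m.factorial / Real.Gamma (1 + γ * m)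
      - ((m + 1).factorial / Real.Gamma (1 + γ * (m + 1 : ℕ))) / R) ?_ hlim ?_)
  · filter_upwards [eventually_ge_atTop 0] with R hR
    exact intervalIntegral_moment_le h0 h1 m hR
  · simpa using tendsto_const_nhds.sub (tendsto_id.const_div_atTop
      (((m + 1).factorial : ℝ) / Real.Gamma (1 + γ * (m + 1 : ℕ))))
  · filter_upwards [eventually_gt_atTop 0] with R hR
    exact le_intervalIntegral_moment h0 h1 m hR

end

/-! ### Laplace transform of the Wright function -/

section

open Filter Topology MeasureTheory

/-- The Laplace transform of the Wright function. -/
def wrightLaplace (γ z : ℝ) : ℝ := ∫ θ in Set.Ioi (0 : ℝ), wrightPhi γ θ * Real.exp (-z * θ)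

/-- Minus the derivative of the Laplace transform of the Wright function. -/
def wrightLaplace' (γ z : ℝ) : ℝ :=
  ∫ θ in Set.Ioi (0 : ℝ), θ * wrightPhi γ θ * Real.exp (-z * θ)

variable {γ : ℝ}

lemma integrableOn_wrightPhi (h0 : 0 < γ) (h1 : γ < 1) :
    IntegrableOn (wrightPhi γ) (Set.Ioi 0) := by
  simpa using integrableOn_moment h0 h1 0

lemma integrableOn_mul_wrightPhi (h0 : 0 < γ) (h1 : γ < 1) :
    IntegrableOn (fun θ => θ * wrightPhi γ θ) (Set.Ioi 0) := by
  simpa using integrableOn_moment h0 h1 1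

lemma integral_wrightPhi (h0 : 0 < γ) (h1 : γ < 1) : ∫ θ in Set.Ioi (0 : ℝ), wrightPhi γ θ = 1 := by
  simpa using integral_moment h0 h1 0

lemma integral_mul_wrightPhi (h0 : 0 < γ) (h1 : γ < 1) :
    γ * ∫ θ in Set.Ioi (0 : ℝ), θ * wrightPhi γ θ = 1 / Real.Gamma γ := by
  have h := integral_moment h0 h1 1
  simp only [pow_one, Nat.factorial_one, Nat.cast_one, mul_one] at h
  rw [h, add_comm, Real.Gamma_add_one h0.ne']
  have := (Real.Gamma_pos_of_pos h0).ne'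
  field_simp

lemma integrableOn_mul_exp {f : ℝ → ℝ} (hf : IntegrableOn f (Set.Ioi 0)) {z : ℝ} (hz : 0 ≤ z) :
    IntegrableOn (fun θ => f θ * Real.exp (-z * θ)) (Set.Ioi 0) := by
  refine Integrable.mono hf (hf.aestronglyMeasurable.mul
    (by fun_prop : Continuous fun θ : ℝ => Real.exp (-z * θ)).aestronglyMeasurable) ?_
  filter_upwards [ae_restrict_mem measurableSet_Ioi] with θ hθ
  rw [norm_mul, Real.norm_of_nonneg (Real.exp_pos _).le]
  refine mul_le_of_le_one_right (norm_nonneg _) (Real.exp_le_one_iff.2 ?_)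
  have : 0 ≤ z * θ := mul_nonneg hz (le_of_lt hθ)
  linarith

lemma continuousOn_integral_mul_exp {f : ℝ → ℝ} (hf : IntegrableOn f (Set.Ioi 0)) :
    ContinuousOn (fun z => ∫ θ in Set.Ioi (0 : ℝ), f θ * Real.exp (-z * θ)) (Set.Ici 0) := by
  refine continuousOn_of_dominated (bound := fun θ => ‖f θ‖) (fun z _ => ?_) (fun z hz => ?_) hf.norm ?_
  · exact hf.aestronglyMeasurable.mul
      (by fun_prop : Continuous fun θ : ℝ => Real.exp (-z * θ)).aestronglyMeasurable
  · filter_upwards [ae_restrict_mem measurableSet_Ioi] with θ hθ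
    rw [norm_mul, Real.norm_of_nonneg (Real.exp_pos _).le]
    refine mul_le_of_le_one_right (norm_nonneg _) (Real.exp_le_one_iff.2 ?_)
    have : 0 ≤ z * θ := mul_nonneg hz (le_of_lt hθ)
    linarith
  · exact Eventually.of_forall fun θ => by fun_prop

lemma continuousOn_wrightLaplace (h0 : 0 < γ) (h1 : γ < 1) :
    ContinuousOn (wrightLaplace γ) (Set.Ici 0) :=
  continuousOn_integral_mul_exp (integrableOn_wrightPhi h0 h1)

lemma continuousOn_wrightLaplace' (h0 : 0 < γ) (h1 : γ < 1) :
    ContinuousOn (wrightLaplace' γ) (Set.Ici 0) :=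
  continuousOn_integral_mul_exp (integrableOn_mul_wrightPhi h0 h1)

lemma wrightLaplace_zero (h0 : 0 < γ) (h1 : γ < 1) : wrightLaplace γ 0 = 1 := by
  simp [wrightLaplace, integral_wrightPhi h0 h1]

lemma wrightLaplace'_nonneg (h0 : 0 < γ) (h1 : γ < 1) (z : ℝ) : 0 ≤ wrightLaplace' γ z :=
  setIntegral_nonneg measurableSet_Ioi fun _ hθ =>
    mul_nonneg (mul_nonneg (le_of_lt hθ) (wrightPhi_nonneg h0 h1 (le_of_lt hθ))) (Real.exp_pos _).le

/-- The Wright function is bounded below near the origin. -/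
lemma exists_le_wrightPhi (h0 : 0 < γ) (h1 : γ < 1) :
    ∃ z₀ c : ℝ, 0 < z₀ ∧ 0 < c ∧ ∀ z ∈ Set.Icc 0 z₀, c ≤ wrightPhi γ z := by
  have hpos := wrightPhi_zero_pos h1
  have hev : ∀ᶠ z in 𝓝 (0 : ℝ), wrightPhi γ 0 / 2 < wrightPhi γ z :=
    (continuous_wrightPhi h0 h1).continuousAt.eventually (lt_mem_nhds (by linarith))
  obtain ⟨ε, hε, h⟩ := Metric.eventually_nhds_iff.1 hev
  refine ⟨ε / 2, wrightPhi γ 0 / 2, by positivity, by positivity, fun z hz => (h ?_).le⟩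
  rw [Real.dist_eq, sub_zero, abs_of_nonneg hz.1]
  linarith [hz.2]

lemma wrightLaplace_pos (h0 : 0 < γ) (h1 : γ < 1) {z : ℝ} (hz : 0 ≤ z) : 0 < wrightLaplace γ z := by
  obtain ⟨z₀, c, hz₀, hc, h⟩ := exists_le_wrightPhi h0 h1
  have hi := integrableOn_mul_exp (integrableOn_wrightPhi h0 h1) hz
  calc (0 : ℝ) < ∫ θ in Set.Ioc 0 z₀, c * Real.exp (-z * z₀) := by
        rw [setIntegral_const]
        simp only [measureReal_def, Real.volume_Ioc, sub_zero, smul_eq_mul]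
        rw [ENNReal.toReal_ofReal hz₀.le]
        positivity
    _ ≤ ∫ θ in Set.Ioc 0 z₀, wrightPhi γ θ * Real.exp (-z * θ) := by
        refine setIntegral_mono_on (integrableOn_const (by simp))
          (hi.mono_set Set.Ioc_subset_Ioi_self) measurableSet_Ioc fun θ hθ => ?_
        refine mul_le_mul (h θ ⟨hθ.1.le, hθ.2⟩) (Real.exp_le_exp.2 ?_) (Real.exp_pos _).le
          (wrightPhi_nonneg h0 h1 hθ.1.le)
        nlinarith [hθ.2]
    _ ≤ _ := setIntegral_mono_set hi
        (by filter_upwards [ae_restrict_mem measurableSet_Ioi] with θ hθ using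
              mul_nonneg (wrightPhi_nonneg h0 h1 (le_of_lt hθ)) (Real.exp_pos _).le)
        (Eventually.of_forall Set.Ioc_subset_Ioi_self)

lemma hasDerivAt_wrightLaplace (h0 : 0 < γ) (h1 : γ < 1) {z : ℝ} (hz : 0 < z) :
    HasDerivAt (wrightLaplace γ) (-wrightLaplace' γ z) z := by
  have h := (hasDerivAt_integral_of_dominated_loc_of_deriv_le (μ := volume.restrict (Set.Ioi (0 : ℝ)))
    (F := fun z θ => wrightPhi γ θ * Real.exp (-z * θ))
    (F' := fun z θ => -(θ * wrightPhi γ θ * Real.exp (-z * θ)))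
    (bound := fun θ => ‖θ * wrightPhi γ θ‖) (s := Set.Ioi 0) (x₀ := z) (Ioi_mem_nhds hz)
    (Eventually.of_forall fun x => (((continuous_wrightPhi h0 h1).mul
      (by fun_prop)).aestronglyMeasurable))
    (integrableOn_mul_exp (integrableOn_wrightPhi h0 h1) hz.le)
    ((integrableOn_mul_exp (integrableOn_mul_wrightPhi h0 h1) hz.le).neg.aestronglyMeasurable)
    ?_ (integrableOn_mul_wrightPhi h0 h1).norm ?_).2
  · rw [integral_neg] at h
    exact h
  · filter_upwards [ae_restrict_mem measurableSet_Ioi] with θ hθ x hx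
    rw [norm_neg, norm_mul _ (Real.exp _), Real.norm_of_nonneg (Real.exp_pos _).le]
    refine mul_le_of_le_one_right (norm_nonneg _) (Real.exp_le_one_iff.2 ?_)
    have : 0 ≤ x * θ := mul_nonneg (le_of_lt hx) (le_of_lt hθ)
    linarith
  · refine Eventually.of_forall fun θ x _ => ?_
    have h2 : HasDerivAt (fun x : ℝ => Real.exp (-x * θ)) (Real.exp (-x * θ) * (-1 * θ)) x :=
      (((hasDerivAt_id x).neg.mul_const θ).exp)
    exact (h2.const_mul (wrightPhi γ θ)).congr_deriv (by ring)

/-- The logarithmic derivative of the Laplace transform of the Wright function is monotone. -/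
lemma wrightLaplace'_mul_le (h0 : 0 < γ) (h1 : γ < 1) {z w : ℝ} (hz : 0 ≤ z) (hzw : z ≤ w) :
    wrightLaplace' γ w * wrightLaplace γ z ≤ wrightLaplace' γ z * wrightLaplace γ w := by
  have hw := hz.trans hzw
  have hLw := wrightLaplace_pos h0 h1 hw
  -- c is the mean of θ under the law proportional to φ(θ) e^{-wθ}. Since θ - c and e^{(w-z)θ} -
  -- e^{(w-z)c} have the same sign, integrating their product against φ(θ) e^{-wθ} shows that the
  -- corresponding mean for z ≤ w is at least c.
  set c := wrightLaplace' γ w / wrightLaplace γ w with hc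
  have hint : ∀ x : ℝ, 0 ≤ x → ∫ θ in Set.Ioi (0 : ℝ),
      (θ * wrightPhi γ θ * Real.exp (-x * θ) - c * (wrightPhi γ θ * Real.exp (-x * θ)))
      = wrightLaplace' γ x - c * wrightLaplace γ x := by
    intro x hx
    rw [integral_sub (integrableOn_mul_exp (integrableOn_mul_wrightPhi h0 h1) hx)
      ((integrableOn_mul_exp (integrableOn_wrightPhi h0 h1) hx).const_mul c), integral_const_mul]
    rfl
  have hle : Real.exp ((w - z) * c) * (wrightLaplace' γ w - c * wrightLaplace γ w)
      ≤ wrightLaplace' γ z - c * wrightLaplace γ z := by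
    rw [← hint w hw, ← hint z hz, ← integral_const_mul]
    refine setIntegral_mono_on ?_ ?_ measurableSet_Ioi fun θ hθ => ?_
    · exact ((integrableOn_mul_exp (integrableOn_mul_wrightPhi h0 h1) hw).sub
        ((integrableOn_mul_exp (integrableOn_wrightPhi h0 h1) hw).const_mul c)).const_mul _
    · exact (integrableOn_mul_exp (integrableOn_mul_wrightPhi h0 h1) hz).sub
        ((integrableOn_mul_exp (integrableOn_wrightPhi h0 h1) hz).const_mul c)
    · have hφ := wrightPhi_nonneg h0 h1 (le_of_lt hθ)
      have e1 : Real.exp (-z * θ) = Real.exp ((w - z) * θ) * Real.exp (-w * θ) := by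
        rw [← Real.exp_add]; ring_nf
      have key : 0 ≤ (θ - c) * (Real.exp ((w - z) * θ) - Real.exp ((w - z) * c)) := by
        rcases le_total c θ with h | h
        · exact mul_nonneg (by linarith) (sub_nonneg.2 (Real.exp_le_exp.2
            (mul_le_mul_of_nonneg_left h (by linarith))))
        · exact mul_nonneg_of_nonpos_of_nonpos (by linarith) (sub_nonpos.2 (Real.exp_le_exp.2
            (mul_le_mul_of_nonneg_left h (by linarith))))
      have := mul_nonneg (mul_nonneg hφ (Real.exp_pos (-w * θ)).le) key
      rw [e1]
      linarith
  have hzero : wrightLaplace' γ w - c * wrightLaplace γ w = 0 := by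
    rw [hc, div_mul_cancel₀ _ hLw.ne', sub_self]
  rw [hzero, mul_zero, hc] at hle
  have h2 : wrightLaplace' γ w / wrightLaplace γ w * wrightLaplace γ z ≤ wrightLaplace' γ z := by
    linarith
  rwa [div_mul_eq_mul_div, div_le_iff₀ hLw] at h2

/-- Log-convexity at x = (1-γ)(x+γ) + γ(x+γ-1), combined with the functional equation. It provides
the ratio test for the Mittag-Leffler series. -/
lemma Gamma_add_ge (h0 : 0 < γ) (h1 : γ < 1) {x : ℝ} (hx : 1 ≤ x) :
    Real.Gamma x * (x + γ - 1) ^ γ ≤ Real.Gamma (x + γ) := by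
  have hx1 : 0 < x + γ - 1 := by linarith
  have h := Real.Gamma_mul_add_mul_le_rpow_Gamma_mul_rpow_Gamma (s := x + γ) (t := x + γ - 1)
    (a := 1 - γ) (b := γ) (by linarith) hx1 (by linarith) h0 (by ring)
  rw [show (1 - γ) * (x + γ) + γ * (x + γ - 1) = x by ring] at h
  have hG : Real.Gamma (x + γ) = (x + γ - 1) * Real.Gamma (x + γ - 1) := by
    rw [← Real.Gamma_add_one hx1.ne']; ring_nf
  have hGp := Real.Gamma_pos_of_pos hx1
  calc Real.Gamma x * (x + γ - 1) ^ γ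
      ≤ Real.Gamma (x + γ) ^ (1 - γ) * Real.Gamma (x + γ - 1) ^ γ * (x + γ - 1) ^ γ := by gcongr
    _ = Real.Gamma (x + γ) ^ (1 - γ) * Real.Gamma (x + γ) ^ γ := by
        rw [mul_assoc, ← Real.mul_rpow hGp.le hx1.le, hG]; ring_nf
    _ = Real.Gamma (x + γ) := by
        rw [← Real.rpow_add (Real.Gamma_pos_of_pos (by linarith))]; simp

lemma summable_pow_div_Gamma (h0 : 0 < γ) (h1 : γ < 1) {A : ℝ} (hA : 0 ≤ A) :
    Summable fun n : ℕ => A ^ n / Real.Gamma (1 + γ * n) := by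
  rcases hA.eq_or_lt with rfl | hA
  · exact summable_of_ne_finset_zero (s := {0}) fun n hn => by
      rw [zero_pow (by simpa using hn), zero_div]
  have hpos : ∀ n : ℕ, 0 < Real.Gamma (1 + γ * n) := fun n => Real.Gamma_pos_of_pos (by positivity)
  refine summable_of_ratio_test_tendsto_lt_one (l := 0) one_pos
    (Eventually.of_forall fun n => (div_pos (pow_pos hA n) (hpos n)).ne') ?_
  have hlim : Tendsto (fun n : ℕ => A / (γ * ((n : ℝ) + 1)) ^ γ) atTop (𝓝 0) := by
    refine Tendsto.const_div_atTop ((tendsto_rpow_atTop h0).comp ?_) A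
    exact (tendsto_atTop_add_const_right _ _ tendsto_natCast_atTop_atTop).const_mul_atTop h0
  refine squeeze_zero (fun n => by positivity) (fun n => ?_) hlim
  rw [Real.norm_of_nonneg (div_pos (pow_pos hA _) (hpos _)).le,
    Real.norm_of_nonneg (div_pos (pow_pos hA _) (hpos _)).le]
  have h := Gamma_add_ge h0 h1 (x := 1 + γ * n) (by
    have : 0 ≤ γ * (n : ℝ) := by positivity
    linarith)
  rw [show 1 + γ * (n : ℝ) + γ - 1 = γ * (n + 1) by ring] at h
  rw [show 1 + γ * ((n + 1 : ℕ) : ℝ) = 1 + γ * n + γ by push_cast; ring]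
  have h2 := hpos n
  have h3 : 0 < (γ * ((n : ℝ) + 1)) ^ γ := by positivity
  have h4 : 0 < Real.Gamma (1 + γ * n + γ) := lt_of_lt_of_le (by positivity) h
  rw [div_div_div_eq, div_le_div_iff₀ (by positivity) h3]
  rw [pow_succ]
  nlinarith [mul_le_mul_of_nonneg_left h (mul_pos hA (pow_pos hA n)).le]

/-- The Laplace transform of the Wright function is the Mittag-Leffler function. -/
lemma hasSum_wrightLaplace (h0 : 0 < γ) (h1 : γ < 1) {z : ℝ} (hz : 0 ≤ z) :
    HasSum (fun n : ℕ => (-z) ^ n / Real.Gamma (1 + γ * n)) (wrightLaplace γ z) := by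
  have hF : ∀ n : ℕ, IntegrableOn (fun θ => (-z) ^ n / (n.factorial : ℝ) * (θ ^ n * wrightPhi γ θ))
      (Set.Ioi 0) := fun n => (integrableOn_moment h0 h1 n).const_mul _
  have hval : ∀ n : ℕ, ∫ θ in Set.Ioi (0 : ℝ), (-z) ^ n / (n.factorial : ℝ) * (θ ^ n * wrightPhi γ θ)
      = (-z) ^ n / Real.Gamma (1 + γ * n) := fun n => by
    rw [integral_const_mul, integral_moment h0 h1]
    have : (n.factorial : ℝ) ≠ 0 := by positivity
    field_simp
  have hnorm : ∀ n : ℕ, ∫ θ in Set.Ioi (0 : ℝ), ‖(-z) ^ n / (n.factorial : ℝ) * (θ ^ n * wrightPhi γ θ)‖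
      = z ^ n / Real.Gamma (1 + γ * n) := fun n => by
    rw [← mul_one (z ^ n)]
    have : ∀ θ ∈ Set.Ioi (0 : ℝ), ‖(-z) ^ n / (n.factorial : ℝ) * (θ ^ n * wrightPhi γ θ)‖
        = z ^ n / (n.factorial : ℝ) * (θ ^ n * wrightPhi γ θ) := fun θ hθ => by
      have hθ' : (0 : ℝ) ≤ θ := le_of_lt hθ
      have := mul_nonneg (pow_nonneg hθ' n) (wrightPhi_nonneg h0 h1 hθ')
      rw [norm_mul, norm_div, norm_pow, norm_neg, Real.norm_of_nonneg hz, Real.norm_of_nonneg this,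
        Real.norm_of_nonneg (by positivity : (0 : ℝ) ≤ (n.factorial : ℝ))]
    rw [setIntegral_congr_fun measurableSet_Ioi this, integral_const_mul, integral_moment h0 h1]
    have : (n.factorial : ℝ) ≠ 0 := by positivity
    field_simp
  have h := hasSum_integral_of_summable_integral_norm hF
    (by simp_rw [hnorm]; exact summable_pow_div_Gamma h0 h1 hz)
  simp_rw [hval] at h
  have e : ∫ θ in Set.Ioi (0 : ℝ), ∑' n : ℕ, (-z) ^ n / (n.factorial : ℝ) * (θ ^ n * wrightPhi γ θ)
      = wrightLaplace γ z := by
    refine setIntegral_congr_fun measurableSet_Ioi fun θ _ => ?_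
    have hexp := (NormedSpace.expSeries_div_hasSum_exp (-z * θ)).mul_left (wrightPhi γ θ)
    rw [← Real.exp_eq_exp_ℝ] at hexp
    rw [← hexp.tsum_eq]
    refine tsum_congr fun n => ?_
    rw [mul_pow]; ring
  rwa [e] at h

end

/-! ### The relaxation function and the rearrangement inequality -/

section

open Filter Topology MeasureTheory

variable {γ : ℝ}

/-- The relaxation function, i.e. the solution of `ᶜD^γ e + e = 0`, `e(0) = 1`. -/
def relax (γ t : ℝ) : ℝ := wrightLaplace γ (t ^ γ)

/-- Minus the derivative of the relaxation function. -/
def relaxKernel (γ t : ℝ) : ℝ := t ^ (γ - 1) * (γ * wrightLaplace' γ (t ^ γ))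

lemma integral_rpow_mul_sub_rpow {s t a : ℝ} (hs : 0 < s) (ht : 0 < t) (ha : 0 < a) :
    ∫ x in (0 : ℝ)..a, x ^ (s - 1) * (a - x) ^ (t - 1)
      = a ^ (s + t - 1) * (Real.Gamma s * Real.Gamma t / Real.Gamma (s + t)) := by
  have h := Complex.betaIntegral_scaled s t ha
  rw [Complex.betaIntegral_eq_Gamma_mul_div _ _ (by simpa using hs) (by simpa using ht)] at h
  have e : ∫ x in (0 : ℝ)..a, (x : ℂ) ^ ((s : ℂ) - 1) * ((a : ℂ) - x) ^ ((t : ℂ) - 1)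
      = ((∫ x in (0 : ℝ)..a, x ^ (s - 1) * (a - x) ^ (t - 1) : ℝ) : ℂ) := by
    rw [← intervalIntegral.integral_ofReal]
    refine intervalIntegral.integral_congr fun x hx => ?_
    rw [Set.uIcc_of_le ha.le] at hx
    push_cast
    rw [Complex.ofReal_cpow hx.1, Complex.ofReal_cpow (sub_nonneg.2 hx.2)]
    push_cast; rfl
  rw [e, Complex.Gamma_ofReal, Complex.Gamma_ofReal, ← Complex.ofReal_add, Complex.Gamma_ofReal,
    ← Complex.ofReal_one, ← Complex.ofReal_sub, ← Complex.ofReal_cpow ha.le] at h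
  exact_mod_cast h

lemma continuousOn_relax (h0 : 0 < γ) (h1 : γ < 1) : ContinuousOn (relax γ) (Set.Ici 0) :=
  (continuousOn_wrightLaplace h0 h1).comp (Real.continuous_rpow_const h0.le).continuousOn
    fun _ ht => Real.rpow_nonneg ht γ

lemma relax_zero (h0 : 0 < γ) (h1 : γ < 1) : relax γ 0 = 1 := by
  rw [relax, Real.zero_rpow h0.ne', wrightLaplace_zero h0 h1]

lemma relax_pos (h0 : 0 < γ) (h1 : γ < 1) {t : ℝ} (ht : 0 ≤ t) : 0 < relax γ t :=
  wrightLaplace_pos h0 h1 (Real.rpow_nonneg ht γ)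

lemma relaxKernel_nonneg (h0 : 0 < γ) (h1 : γ < 1) {t : ℝ} (ht : 0 ≤ t) : 0 ≤ relaxKernel γ t :=
  mul_nonneg (Real.rpow_nonneg ht _) (mul_nonneg h0.le (wrightLaplace'_nonneg h0 h1 _))

lemma relaxKernel_le (h0 : 0 < γ) (h1 : γ < 1) {t : ℝ} (ht : 0 ≤ t) :
    relaxKernel γ t ≤ t ^ (γ - 1) * (1 / Real.Gamma γ) := by
  rw [relaxKernel, ← integral_mul_wrightPhi h0 h1, wrightLaplace']
  have hz := Real.rpow_nonneg ht γ
  refine mul_le_mul_of_nonneg_left (mul_le_mul_of_nonneg_left ?_ h0.le) (Real.rpow_nonneg ht _)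
  refine setIntegral_mono_on (integrableOn_mul_exp (integrableOn_mul_wrightPhi h0 h1) hz)
    (integrableOn_mul_wrightPhi h0 h1) measurableSet_Ioi fun θ hθ => ?_
  have hθ' : (0 : ℝ) ≤ θ := le_of_lt hθ
  refine mul_le_of_le_one_right (mul_nonneg hθ' (wrightPhi_nonneg h0 h1 hθ')) (Real.exp_le_one_iff.2 ?_)
  have := mul_nonneg hz hθ'
  linarith

lemma hasDerivAt_relax (h0 : 0 < γ) (h1 : γ < 1) {t : ℝ} (ht : 0 < t) :
    HasDerivAt (relax γ) (-relaxKernel γ t) t := by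
  have h := (hasDerivAt_wrightLaplace h0 h1 (Real.rpow_pos_of_pos ht γ)).comp t
    (Real.hasDerivAt_rpow_const (p := γ) (Or.inl ht.ne'))
  exact h.congr_deriv (by rw [relaxKernel]; ring)

lemma continuousOn_comp_sub {f : ℝ → ℝ} (hf : ContinuousOn f (Set.Ici 0)) (t : ℝ) :
    ContinuousOn (fun τ => f (t - τ)) (Set.Icc 0 t) :=
  hf.comp (by fun_prop) fun τ hτ => by simpa using hτ.2

lemma intervalIntegrable_sub_rpow (h0 : 0 < γ) (t : ℝ) :
    IntervalIntegrable (fun τ => (t - τ) ^ (γ - 1)) volume 0 t := by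
  have := (intervalIntegral.intervalIntegrable_rpow' (a := 0) (b := t) (r := γ - 1)
    (by linarith)).comp_sub_left t
  simpa using this.symm

lemma intervalIntegrable_relaxKernel_mul (h0 : 0 < γ) (h1 : γ < 1) {t : ℝ} (ht : 0 ≤ t) {f : ℝ → ℝ}
    (hf : ContinuousOn f (Set.Icc 0 t)) :
    IntervalIntegrable (fun τ => relaxKernel γ (t - τ) * f τ) volume 0 t := by
  have hc : ContinuousOn (fun τ => γ * wrightLaplace' γ ((t - τ) ^ γ) * f τ) (Set.uIcc 0 t) := by
    rw [Set.uIcc_of_le ht]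
    refine ContinuousOn.mul (continuousOn_const.mul ?_) hf
    exact continuousOn_comp_sub (f := fun s => wrightLaplace' γ (s ^ γ))
      ((continuousOn_wrightLaplace' h0 h1).comp (Real.continuous_rpow_const h0.le).continuousOn
        fun _ ht => Real.rpow_nonneg ht γ) t
  refine ((intervalIntegrable_sub_rpow h0 t).mul_continuousOn hc).congr fun τ _ => ?_
  simp only [relaxKernel]; ring

lemma intervalIntegrable_rpow_mul (h0 : 0 < γ) {t : ℝ} (ht : 0 ≤ t) {f : ℝ → ℝ}
    (hf : ContinuousOn f (Set.Icc 0 t)) :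
    IntervalIntegrable (fun τ => τ ^ (γ - 1) * f τ) volume 0 t :=
  (intervalIntegral.intervalIntegrable_rpow' (by linarith)).mul_continuousOn
    (by rwa [Set.uIcc_of_le ht])

/-- Integration by parts for the relaxation function. -/
lemma integral_relaxKernel_mul (h0 : 0 < γ) (h1 : γ < 1) {t : ℝ} (ht : 0 ≤ t) {y g : ℝ → ℝ}
    (hy : ContinuousOn y (Set.Icc 0 t)) (hg : ContinuousOn g (Set.Icc 0 t))
    (hd : ∀ τ ∈ Set.Ioo 0 t, HasDerivAt y (τ ^ (γ - 1) * g τ) τ) :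
    ∫ τ in (0 : ℝ)..t, relaxKernel γ (t - τ) * y τ
      = y t - relax γ t * y 0 - ∫ τ in (0 : ℝ)..t, τ ^ (γ - 1) * (relax γ (t - τ) * g τ) := by
  have he : ContinuousOn (fun τ => relax γ (t - τ)) (Set.Icc 0 t) :=
    continuousOn_comp_sub (continuousOn_relax h0 h1) t
  have hi : IntervalIntegrable (fun τ => τ ^ (γ - 1) * (relax γ (t - τ) * g τ)) volume 0 t :=
    intervalIntegrable_rpow_mul h0 ht (he.mul hg)
  have h := intervalIntegral.integral_eq_sub_of_hasDerivAt_of_le ht (he.mul hy)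
    (f' := fun τ => relaxKernel γ (t - τ) * y τ + τ ^ (γ - 1) * (relax γ (t - τ) * g τ))
    (fun τ hτ => ?_)
    ((intervalIntegrable_relaxKernel_mul h0 h1 ht hy).add hi)
  · rw [intervalIntegral.integral_add (intervalIntegrable_relaxKernel_mul h0 h1 ht hy) hi] at h
    simp only [sub_self, sub_zero, relax_zero h0 h1, one_mul, Pi.mul_apply] at h
    linarith
  · have h2 : HasDerivAt (fun τ => relax γ (t - τ)) (relaxKernel γ (t - τ)) τ := by
      have := (hasDerivAt_relax h0 h1 (sub_pos.2 hτ.2)).comp τ ((hasDerivAt_id τ).const_sub t)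
      exact this.congr_deriv (by simp)
    exact (h2.mul (hd τ hτ)).congr_deriv (by ring)

lemma integral_relaxKernel (h0 : 0 < γ) (h1 : γ < 1) {t : ℝ} (ht : 0 ≤ t) :
    ∫ τ in (0 : ℝ)..t, relaxKernel γ (t - τ) = 1 - relax γ t := by
  have := integral_relaxKernel_mul h0 h1 ht (y := fun _ => 1) (g := fun _ => 0)
    continuousOn_const continuousOn_const fun τ _ => by simpa using hasDerivAt_const τ (1 : ℝ)
  simpa using this

/-- The relaxation equation in integrated form. -/
lemma integral_rpow_mul_relax (h0 : 0 < γ) (h1 : γ < 1) {t : ℝ} (ht : 0 < t) :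
    ∫ τ in (0 : ℝ)..t, τ ^ (γ - 1) * relax γ (t - τ) = Real.Gamma γ * (1 - relax γ t) := by
  have hGγ := Real.Gamma_pos_of_pos h0
  -- Integrate the Mittag-Leffler series term by term. Each Beta integral raises the index by one,
  -- so the result is the same series with its constant term removed and the sign changed.
  set F : ℕ → ℝ → ℝ := fun n τ =>
    (-1) ^ n / Real.Gamma (1 + γ * n) * (τ ^ (γ - 1) * (t - τ) ^ (γ * n)) with hF
  have hval : ∀ n : ℕ, ∫ τ in (0 : ℝ)..t, τ ^ (γ - 1) * (t - τ) ^ (γ * n)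
      = (t ^ γ) ^ (n + 1) * (Real.Gamma γ * Real.Gamma (1 + γ * n) / Real.Gamma (1 + γ * (n + 1 : ℕ))) := by
    intro n
    have := integral_rpow_mul_sub_rpow (s := γ) (t := 1 + γ * n) h0 (by positivity) ht
    rw [show 1 + γ * (n : ℝ) - 1 = γ * n by ring,
      show γ + (1 + γ * (n : ℝ)) - 1 = γ * (n + 1 : ℕ) by push_cast; ring,
      show γ + (1 + γ * (n : ℝ)) = 1 + γ * (n + 1 : ℕ) by push_cast; ring,
      Real.rpow_mul ht.le, Real.rpow_natCast] at this
    exact this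
  have hGpos : ∀ n : ℕ, 0 < Real.Gamma (1 + γ * n) := fun n => Real.Gamma_pos_of_pos (by positivity)
  have hint : ∀ n : ℕ, IntervalIntegrable (fun τ => τ ^ (γ - 1) * (t - τ) ^ (γ * n)) volume 0 t :=
    fun n => intervalIntegrable_rpow_mul h0 ht.le
      (((Real.continuous_rpow_const (by positivity)).comp (by fun_prop)).continuousOn)
  have hFint : ∀ n, Integrable (F n) (volume.restrict (Set.Ioc 0 t)) := fun n =>
    ((intervalIntegrable_iff_integrableOn_Ioc_of_le ht.le).1 (hint n)).const_mul _
  have hFnorm : ∀ n, ∫ τ in Set.Ioc 0 t, ‖F n τ‖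
      = Real.Gamma γ * ((t ^ γ) ^ (n + 1) / Real.Gamma (1 + γ * (n + 1 : ℕ))) := fun n => by
    have : ∀ τ ∈ Set.Ioc 0 t, ‖F n τ‖ = 1 / Real.Gamma (1 + γ * n) * (τ ^ (γ - 1) * (t - τ) ^ (γ * n)) :=
      fun τ hτ => by
        have h2 : 0 ≤ τ ^ (γ - 1) * (t - τ) ^ (γ * (n : ℝ)) :=
          mul_nonneg (Real.rpow_nonneg hτ.1.le _) (Real.rpow_nonneg (sub_nonneg.2 hτ.2) _)
        rw [hF, norm_mul, norm_div, norm_pow, norm_neg, norm_one, one_pow,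
          Real.norm_of_nonneg (hGpos n).le, Real.norm_of_nonneg h2]
    rw [setIntegral_congr_fun measurableSet_Ioc this, integral_const_mul,
      ← intervalIntegral.integral_of_le ht.le, hval]
    have := (hGpos n).ne'
    field_simp
  have hFval : ∀ n, ∫ τ in Set.Ioc 0 t, F n τ
      = Real.Gamma γ * (-((-(t ^ γ)) ^ (n + 1) / Real.Gamma (1 + γ * (n + 1 : ℕ)))) := fun n => by
    rw [hF, integral_const_mul, ← intervalIntegral.integral_of_le ht.le, hval, neg_pow (t ^ γ)]
    have := (hGpos n).ne'
    field_simp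
    ring
  have hz : 0 ≤ t ^ γ := Real.rpow_nonneg ht.le γ
  have hsum := hasSum_integral_of_summable_integral_norm hFint (by
    simp_rw [hFnorm]
    exact ((summable_nat_add_iff 1).2 (summable_pow_div_Gamma h0 h1 hz)).mul_left _)
  simp_rw [hFval] at hsum
  have hser := hasSum_wrightLaplace h0 h1 hz
  have hser2 := ((hasSum_nat_add_iff' 1).2 hser).neg.mul_left (Real.Gamma γ)
  have h3 := hsum.unique hser2
  rw [intervalIntegral.integral_of_le ht.le]
  simp only [Finset.range_one, Finset.sum_singleton, pow_zero, Nat.cast_zero, mul_zero, add_zero,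
    Real.Gamma_one, div_one, neg_sub] at h3
  rw [relax, ← h3]
  refine setIntegral_congr_fun measurableSet_Ioc fun τ hτ => ?_
  have hs := sub_nonneg.2 hτ.2
  have h4 := (hasSum_wrightLaplace h0 h1 (Real.rpow_nonneg hs γ)).mul_left (τ ^ (γ - 1))
  rw [relax, ← h4.tsum_eq]
  refine tsum_congr fun n => ?_
  simp only [hF]
  rw [neg_pow ((t - τ) ^ γ), Real.rpow_mul hs, Real.rpow_natCast]
  ring

/-- For monotone `g`, convolution with the kernel of the relaxation function dominates. -/
lemma integral_rpow_mul_relax_mul_le (h0 : 0 < γ) (h1 : γ < 1) {t : ℝ} (ht : 0 < t) {g : ℝ → ℝ}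
    (hg : ContinuousOn g (Set.Icc 0 t)) (hmono : MonotoneOn g (Set.Icc 0 t)) :
    ∫ τ in (0 : ℝ)..t, τ ^ (γ - 1) * (relax γ (t - τ) * (g τ / Real.Gamma γ))
      ≤ ∫ τ in (0 : ℝ)..t, relaxKernel γ (t - τ) * g τ := by
  have hGγ := Real.Gamma_pos_of_pos h0
  -- On A the kernel -e'(t-τ) lies below τ^{γ-1} e(t-τ)/Γ(γ). Their ratio is nondecreasing in τ:
  -- -e'/e decreases in its argument by `wrightLaplace'_mul_le`, and τ^{γ-1} decreases. Hence A is
  -- an initial segment.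
  set A : Set ℝ := {τ | τ ∈ Set.Ioo 0 t ∧
    relaxKernel γ (t - τ) < τ ^ (γ - 1) * relax γ (t - τ) / Real.Gamma γ} with hA
  -- the kernels cross once
  have hcross : ∀ τ ∈ A, ∀ σ ∈ Set.Ioo 0 t, σ ≤ τ →
      relaxKernel γ (t - σ) ≤ σ ^ (γ - 1) * relax γ (t - σ) / Real.Gamma γ := by
    intro τ hτ σ hσ hστ
    have hs1 : 0 < t - τ := sub_pos.2 hτ.1.2
    have hs2 : 0 < t - σ := sub_pos.2 hσ.2
    have hle : t - τ ≤ t - σ := by linarith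
    have hL := wrightLaplace'_mul_le h0 h1 (Real.rpow_nonneg hs1.le γ)
      (Real.rpow_le_rpow hs1.le hle h0.le)
    have hp1 := relax_pos h0 h1 hs1.le
    have hp2 := relax_pos h0 h1 hs2.le
    have hpow : (t - σ) ^ (γ - 1) ≤ (t - τ) ^ (γ - 1) :=
      Real.rpow_le_rpow_of_nonpos hs1 hle (by linarith)
    have hpow2 : τ ^ (γ - 1) ≤ σ ^ (γ - 1) :=
      Real.rpow_le_rpow_of_nonpos hσ.1 hστ (by linarith)
    have hk : relaxKernel γ (t - σ) * relax γ (t - τ) ≤ relaxKernel γ (t - τ) * relax γ (t - σ) := by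
      rw [relaxKernel, relaxKernel, relax, relax]
      have hn := mul_nonneg (wrightLaplace'_nonneg h0 h1 ((t - τ) ^ γ)) hp2.le
      rw [relax] at hn
      calc _ = (t - σ) ^ (γ - 1) * γ * (wrightLaplace' γ ((t - σ) ^ γ) * wrightLaplace γ ((t - τ) ^ γ)) := by
            ring
        _ ≤ (t - τ) ^ (γ - 1) * γ * (wrightLaplace' γ ((t - τ) ^ γ) * wrightLaplace γ ((t - σ) ^ γ)) := by
            have hn2 := mul_nonneg (wrightLaplace'_nonneg h0 h1 ((t - σ) ^ γ)) hp1.le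
            rw [relax] at hn2
            gcongr
        _ = _ := by ring
    have hτ2 := hτ.2
    rw [lt_div_iff₀ hGγ] at hτ2
    rw [le_div_iff₀ hGγ]
    have h5 : relaxKernel γ (t - σ) * Real.Gamma γ * relax γ (t - τ)
        ≤ σ ^ (γ - 1) * relax γ (t - σ) * relax γ (t - τ) := by
      calc _ = relaxKernel γ (t - σ) * relax γ (t - τ) * Real.Gamma γ := by ring
        _ ≤ relaxKernel γ (t - τ) * relax γ (t - σ) * Real.Gamma γ := by gcongr
        _ = relaxKernel γ (t - τ) * Real.Gamma γ * relax γ (t - σ) := by ring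
        _ ≤ τ ^ (γ - 1) * relax γ (t - τ) * relax γ (t - σ) := by gcongr
        _ ≤ σ ^ (γ - 1) * relax γ (t - τ) * relax γ (t - σ) := by gcongr
        _ = _ := by ring
    exact le_of_mul_le_mul_right h5 hp1
  have hbdd : BddAbove (insert 0 A) := ⟨t, by
    rintro x (rfl | hx)
    · exact ht.le
    · exact hx.1.2.le⟩
  -- c is the crossing point; inserting 0 covers an empty A. The difference of the kernels and g(τ)
  -- - g(c) have the same sign on both sides of c, and both kernels have mass 1 - e(t), so
  -- subtracting the constant g(c) changes both integrals by the same amount.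
  set c := sSup (insert 0 A) with hc
  have hc0 : 0 ≤ c := le_csSup hbdd (Set.mem_insert _ _)
  have hct : c ≤ t := csSup_le ⟨0, Set.mem_insert _ _⟩ (by
    rintro x (rfl | hx)
    · exact ht.le
    · exact hx.1.2.le)
  have hcm : c ∈ Set.Icc 0 t := ⟨hc0, hct⟩
  have he : ContinuousOn (fun τ => relax γ (t - τ)) (Set.Icc 0 t) :=
    continuousOn_comp_sub (continuousOn_relax h0 h1) t
  have hi1 := intervalIntegrable_relaxKernel_mul h0 h1 ht.le (hg.sub (continuousOn_const (c := g c)))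
  have hi2 := intervalIntegrable_rpow_mul h0 ht.le
    (he.mul ((hg.sub (continuousOn_const (c := g c))).div_const (Real.Gamma γ)))
  have key : ∫ τ in (0 : ℝ)..t, τ ^ (γ - 1) * (relax γ (t - τ) * ((g τ - g c) / Real.Gamma γ))
      ≤ ∫ τ in (0 : ℝ)..t, relaxKernel γ (t - τ) * (g τ - g c) := by
    refine intervalIntegral.integral_mono_on_of_le_Ioo ht.le hi2 hi1 fun τ hτ => ?_
    have hτm : τ ∈ Set.Icc 0 t := ⟨hτ.1.le, hτ.2.le⟩
    have e1 : τ ^ (γ - 1) * (relax γ (t - τ) * ((g τ - g c) / Real.Gamma γ))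
        = τ ^ (γ - 1) * relax γ (t - τ) / Real.Gamma γ * (g τ - g c) := by ring
    rw [e1]
    rcases lt_or_ge τ c with h | h
    · obtain ⟨σ, hσ, hτσ⟩ := exists_lt_of_lt_csSup ⟨0, Set.mem_insert _ _⟩ h
      rcases hσ with rfl | hσ
      · exact absurd hτ.1 (not_lt.2 hτσ.le)
      · exact mul_le_mul_of_nonpos_right (hcross σ hσ τ hτ hτσ.le)
          (sub_nonpos.2 (hmono hτm hcm h.le))
    · rcases h.eq_or_lt with h | h
      · rw [← h, sub_self, mul_zero, mul_zero]
      · have hnA : τ ∉ A := fun hh => absurd (le_csSup hbdd (Set.mem_insert_of_mem 0 hh)) (not_le.2 h)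
        have : τ ^ (γ - 1) * relax γ (t - τ) / Real.Gamma γ ≤ relaxKernel γ (t - τ) := by
          by_contra hh
          exact hnA ⟨hτ, not_le.1 hh⟩
        exact mul_le_mul_of_nonneg_right this (sub_nonneg.2 (hmono hcm hτm h.le))
  have hR1 : ∫ τ in (0 : ℝ)..t, relaxKernel γ (t - τ) * (g τ - g c)
      = (∫ τ in (0 : ℝ)..t, relaxKernel γ (t - τ) * g τ) - (1 - relax γ t) * g c := by
    simp_rw [mul_sub]
    rw [intervalIntegral.integral_sub (intervalIntegrable_relaxKernel_mul h0 h1 ht.le hg)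
      (intervalIntegrable_relaxKernel_mul h0 h1 ht.le continuousOn_const),
      intervalIntegral.integral_mul_const, integral_relaxKernel h0 h1 ht.le]
  have hi3 : IntervalIntegrable
      (fun τ => τ ^ (γ - 1) * (relax γ (t - τ) * (g τ / Real.Gamma γ))) volume 0 t :=
    intervalIntegrable_rpow_mul h0 ht.le (he.mul (hg.div_const _))
  have hR2 : ∫ τ in (0 : ℝ)..t, τ ^ (γ - 1) * (relax γ (t - τ) * ((g τ - g c) / Real.Gamma γ))
      = (∫ τ in (0 : ℝ)..t, τ ^ (γ - 1) * (relax γ (t - τ) * (g τ / Real.Gamma γ)))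
        - (1 - relax γ t) * g c := by
    have e1 : ∀ τ : ℝ, τ ^ (γ - 1) * (relax γ (t - τ) * ((g τ - g c) / Real.Gamma γ))
        = τ ^ (γ - 1) * (relax γ (t - τ) * (g τ / Real.Gamma γ))
          - τ ^ (γ - 1) * relax γ (t - τ) * (g c / Real.Gamma γ) := fun τ => by ring
    simp_rw [e1]
    rw [intervalIntegral.integral_sub hi3 ((intervalIntegrable_rpow_mul h0 ht.le he).mul_const _),
      intervalIntegral.integral_mul_const, integral_rpow_mul_relax h0 h1 ht]
    field_simp
  rw [hR1, hR2] at key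
  linarith

end

/-! ### The Gauss kernel -/

section

open Filter Topology MeasureTheory

variable {N : ℕ}

lemma heatKernel_pos {t : ℝ} (ht : 0 < t) (x : Sp N) : 0 < heatKernel N t x := by
  unfold heatKernel; positivity

lemma continuous_heatKernel (t : ℝ) : Continuous (heatKernel N t) := by
  unfold heatKernel; fun_prop

lemma heatKernel_eq (t : ℝ) (x : Sp N) :
    heatKernel N t x = (4 * Real.pi * t) ^ (-((N : ℝ) / 2)) * Real.exp (-(1 / (4 * t)) * ‖x‖ ^ 2) := by
  rw [heatKernel]; congr 2; ring

lemma integral_heatKernel {t : ℝ} (ht : 0 < t) : ∫ x, heatKernel N t x = 1 := by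
  simp_rw [heatKernel_eq]
  rw [integral_const_mul, GaussianFourier.integral_rexp_neg_mul_sq_norm (by positivity),
    finrank_euclideanSpace, Fintype.card_fin, Real.rpow_neg (by positivity),
    show Real.pi / (1 / (4 * t)) = 4 * Real.pi * t by field_simp]
  exact inv_mul_cancel₀ (by positivity)

lemma integrable_heatKernel {t : ℝ} (ht : 0 < t) : Integrable (heatKernel N t) := by
  by_contra h
  have := integral_heatKernel (N := N) ht
  rw [integral_undef h] at this
  exact zero_ne_one this

lemma heatKernel_neg (t : ℝ) (x : Sp N) : heatKernel N t (-x) = heatKernel N t x := by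
  simp [heatKernel]

lemma heatKernel_sqrt_smul {t : ℝ} (ht : 0 < t) (x : Sp N) :
    heatKernel N t (Real.sqrt t • x) = (Real.sqrt t ^ N)⁻¹ * heatKernel N 1 x := by
  rw [heatKernel, heatKernel, norm_smul, mul_pow, Real.norm_of_nonneg (Real.sqrt_nonneg t),
    Real.sq_sqrt ht.le, Real.mul_rpow (by positivity) ht.le, mul_one]
  have e1 : (Real.sqrt t ^ N)⁻¹ = t ^ (-((N : ℝ) / 2)) := by
    rw [Real.sqrt_eq_rpow, ← Real.rpow_natCast, ← Real.rpow_mul ht.le, ← Real.rpow_neg ht.le]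
    congr 1; ring
  have e2 : -(t * ‖x‖ ^ 2) / (4 * t) = -‖x‖ ^ 2 / (4 * 1) := by field_simp
  rw [e1, e2]; ring

/-- Rescaling to the Gaussian at time 1 moves the time into a translation by √t y. That form also
makes sense at t = 0, and its continuity in t follows by dominated convergence. -/
lemma integral_heatKernel_mul_comp {t : ℝ} (ht : 0 < t) (f : Sp N → ℝ) :
    ∫ y, heatKernel N t y * f y = ∫ y, heatKernel N 1 y * f (Real.sqrt t • y) := by
  have h := Measure.integral_comp_smul volume (fun y : Sp N => heatKernel N t y * f y) (Real.sqrt t)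
  rw [finrank_euclideanSpace, Fintype.card_fin, smul_eq_mul, abs_of_pos (by positivity)] at h
  simp_rw [heatKernel_sqrt_smul ht, mul_assoc] at h
  rw [integral_const_mul] at h
  have hne : (Real.sqrt t ^ N)⁻¹ ≠ 0 := by positivity
  exact (mul_left_cancel₀ hne h).symm

/-- Completing the square. -/
lemma heatKernel_mul_heatKernel {s t : ℝ} (hs : 0 < s) (ht : 0 < t) (x y : Sp N) :
    heatKernel N s y * heatKernel N t (x - y)
      = heatKernel N (s + t) x * heatKernel N (s * t / (s + t)) (y - (s / (s + t)) • x) := by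
  have hst : 0 < s + t := by positivity
  simp only [heatKernel]
  have e1 : (4 * Real.pi * s) ^ (-((N : ℝ) / 2)) * (4 * Real.pi * t) ^ (-((N : ℝ) / 2))
      = (4 * Real.pi * (s + t)) ^ (-((N : ℝ) / 2)) * (4 * Real.pi * (s * t / (s + t))) ^ (-((N : ℝ) / 2)) := by
    rw [← Real.mul_rpow (by positivity) (by positivity),
      ← Real.mul_rpow (by positivity) (by positivity)]
    congr 1; field_simp
  have e2 : -(‖y‖ ^ 2) / (4 * s) + -(‖x - y‖ ^ 2) / (4 * t)
      = -(‖x‖ ^ 2) / (4 * (s + t)) + -(‖y - (s / (s + t)) • x‖ ^ 2) / (4 * (s * t / (s + t))) := by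
    rw [norm_sub_sq_real, norm_sub_sq_real, inner_smul_right, norm_smul, mul_pow,
      Real.norm_of_nonneg (by positivity), real_inner_comm]
    field_simp
    ring
  calc _ = ((4 * Real.pi * s) ^ (-((N : ℝ) / 2)) * (4 * Real.pi * t) ^ (-((N : ℝ) / 2))) *
        Real.exp (-(‖y‖ ^ 2) / (4 * s) + -(‖x - y‖ ^ 2) / (4 * t)) := by rw [Real.exp_add]; ring
    _ = _ := by rw [e1, e2, Real.exp_add]; ring

lemma integral_heatKernel_mul_heatKernel {s t : ℝ} (hs : 0 < s) (ht : 0 < t) (x : Sp N) :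
    ∫ y, heatKernel N s y * heatKernel N t (x - y) = heatKernel N (s + t) x := by
  simp_rw [heatKernel_mul_heatKernel hs ht]
  rw [integral_const_mul, integral_sub_right_eq_self (heatKernel N (s * t / (s + t))),
    integral_heatKernel (by positivity), mul_one]

/-- The Gaussian exponential increases with time, so only the quotient of the prefactors is lost. -/
lemma heatKernel_le_mul {s t : ℝ} (hs : 0 < s) (hst : s ≤ t) (x : Sp N) :
    heatKernel N s x ≤ (t / s) ^ ((N : ℝ) / 2) * heatKernel N t x := by
  have ht : 0 < t := hs.trans_le hst
  rw [heatKernel, heatKernel, ← mul_assoc]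
  have e1 : (t / s) ^ ((N : ℝ) / 2) * (4 * Real.pi * t) ^ (-((N : ℝ) / 2))
      = (4 * Real.pi * s) ^ (-((N : ℝ) / 2)) := by
    rw [show 4 * Real.pi * t = (4 * Real.pi * s) * (t / s) by field_simp,
      Real.mul_rpow (by positivity) (by positivity), mul_comm, mul_assoc,
      ← Real.rpow_add (by positivity)]
    simp
  rw [e1]
  refine mul_le_mul_of_nonneg_left (Real.exp_le_exp.2 ?_) (by positivity)
  rw [neg_div, neg_div, neg_le_neg_iff]
  gcongr

/-- Heat kernels at nearby times. -/
lemma heatKernel_mul_time_le {t l : ℝ} (ht : 0 < t) (hl : 1 ≤ l) (hl2 : l ≤ 2) (x : Sp N) :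
    heatKernel N (l * t) x
      ≤ heatKernel N t x + (1 - l⁻¹) * (4 * 4 ^ ((N : ℝ) / 2)) * heatKernel N (4 * t) x := by
  have hl0 : 0 < l := by linarith
  set X := ‖x‖ ^ 2 / (4 * t) with hX
  have hX0 : 0 ≤ X := by positivity
  set δ := 1 - l⁻¹ with hδ
  have hinv1 : l⁻¹ ≤ 1 := inv_le_one_of_one_le₀ hl
  have hinv2 : 1 / 2 ≤ l⁻¹ := by rw [one_div]; exact inv_anti₀ hl0 hl2
  have hδ0 : 0 ≤ δ := by rw [hδ]; linarith
  have hδ1 : δ ≤ 1 / 2 := by rw [hδ]; linarith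
  set c := (4 * Real.pi * t) ^ (-((N : ℝ) / 2)) with hc
  have hc0 : 0 < c := by positivity
  have k1 : heatKernel N (l * t) x ≤ c * Real.exp (-X + δ * X) := by
    rw [heatKernel]
    have : -‖x‖ ^ 2 / (4 * (l * t)) = -X + δ * X := by rw [hX, hδ]; field_simp; ring
    rw [this]
    gcongr
    exact Real.rpow_le_rpow_of_nonpos (by positivity)
      (by nlinarith [mul_pos Real.pi_pos ht]) (by
        have : (0 : ℝ) ≤ (N : ℝ) / 2 := by positivity
        linarith)
  have k2 : heatKernel N t x = c * Real.exp (-X) := by rw [heatKernel, neg_div]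
  have k3 : heatKernel N (4 * t) x = c * 4 ^ (-((N : ℝ) / 2)) * Real.exp (-X / 4) := by
    rw [heatKernel, show 4 * Real.pi * (4 * t) = (4 * Real.pi * t) * 4 by ring,
      Real.mul_rpow (by positivity) (by norm_num)]
    congr 2
    rw [hX]; field_simp
  have k4 : (4 : ℝ) ^ ((N : ℝ) / 2) * 4 ^ (-((N : ℝ) / 2)) = 1 := by
    rw [← Real.rpow_add (by norm_num)]; simp
  -- Use e^{δX} ≤ 1 + δX e^{δX}, then X ≤ 4e^{X/4} and δ ≤ 1/2. The total exponent -X + X/4 + X/2 =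
  -- -X/4 is that of the kernel at time 4t.
  have k5 : Real.exp (-X + δ * X) ≤ Real.exp (-X) + δ * 4 * Real.exp (-X / 4) := by
    have a1 : Real.exp (δ * X) ≤ 1 + δ * X * Real.exp (δ * X) := by
      have h := Real.add_one_le_exp (-(δ * X))
      have h2 := mul_le_mul_of_nonneg_right h (Real.exp_pos (δ * X)).le
      rw [← Real.exp_add, neg_add_cancel, Real.exp_zero] at h2
      nlinarith
    have a2 : X ≤ 4 * Real.exp (X / 4) := by
      have := Real.add_one_le_exp (X / 4); linarith
    have a3 : Real.exp (δ * X) ≤ Real.exp (X / 2) := Real.exp_le_exp.2 (by nlinarith)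
    calc Real.exp (-X + δ * X) = Real.exp (-X) * Real.exp (δ * X) := Real.exp_add _ _
      _ ≤ Real.exp (-X) * (1 + δ * X * Real.exp (δ * X)) := by gcongr
      _ ≤ Real.exp (-X) * (1 + δ * (4 * Real.exp (X / 4)) * Real.exp (X / 2)) := by gcongr
      _ = Real.exp (-X) + δ * 4 * (Real.exp (-X) * Real.exp (X / 4) * Real.exp (X / 2)) := by ring
      _ = _ := by rw [← Real.exp_add, ← Real.exp_add]; ring_nf
  rw [k2, k3]
  calc _ ≤ c * Real.exp (-X + δ * X) := k1
    _ ≤ c * (Real.exp (-X) + δ * 4 * Real.exp (-X / 4)) := by gcongr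
    _ = c * Real.exp (-X) + δ * 4 * (4 ^ ((N : ℝ) / 2) * 4 ^ (-((N : ℝ) / 2))) * (c * Real.exp (-X / 4)) := by
        rw [k4]; ring
    _ = _ := by ring

lemma sq_mul_heatKernel_one_le (x : Sp N) :
    ‖x‖ ^ 2 * heatKernel N 1 x ≤ 8 * 2 ^ ((N : ℝ) / 2) * heatKernel N 2 x := by
  have h : heatKernel N 2 x = (4 * Real.pi) ^ (-((N : ℝ) / 2)) * 2 ^ (-((N : ℝ) / 2)) *
      Real.exp (-‖x‖ ^ 2 / 8) := by
    rw [heatKernel, Real.mul_rpow (by positivity) (by norm_num)]; norm_num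
  have k4 : (2 : ℝ) ^ ((N : ℝ) / 2) * 2 ^ (-((N : ℝ) / 2)) = 1 := by
    rw [← Real.rpow_add (by norm_num)]; simp
  have h2 : heatKernel N 1 x = (4 * Real.pi) ^ (-((N : ℝ) / 2)) * (Real.exp (-‖x‖ ^ 2 / 8) *
      Real.exp (-‖x‖ ^ 2 / 8)) := by
    rw [heatKernel, mul_one, ← Real.exp_add]; congr 2; ring
  have h3 : ‖x‖ ^ 2 * Real.exp (-‖x‖ ^ 2 / 8) ≤ 8 := by
    have := Real.add_one_le_exp (‖x‖ ^ 2 / 8)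
    rw [neg_div, Real.exp_neg, mul_inv_le_iff₀ (Real.exp_pos _)]
    linarith
  have hc : 0 < (4 * Real.pi) ^ (-((N : ℝ) / 2)) := by positivity
  rw [h, h2]
  calc _ = (‖x‖ ^ 2 * Real.exp (-‖x‖ ^ 2 / 8)) *
        ((4 * Real.pi) ^ (-((N : ℝ) / 2)) * Real.exp (-‖x‖ ^ 2 / 8)) := by ring
    _ ≤ 8 * ((4 * Real.pi) ^ (-((N : ℝ) / 2)) * Real.exp (-‖x‖ ^ 2 / 8)) := by gcongr
    _ = 8 * (2 ^ ((N : ℝ) / 2) * 2 ^ (-((N : ℝ) / 2))) *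
        ((4 * Real.pi) ^ (-((N : ℝ) / 2)) * Real.exp (-‖x‖ ^ 2 / 8)) := by rw [k4]; ring
    _ = _ := by ring

lemma integrable_sq_mul_heatKernel : Integrable fun x : Sp N => ‖x‖ ^ 2 * heatKernel N 1 x := by
  refine Integrable.mono' ((integrable_heatKernel (N := N) (t := 2) (by norm_num)).const_mul
    (8 * 2 ^ ((N : ℝ) / 2))) (by
      exact ((continuous_norm.pow 2).mul (continuous_heatKernel 1)).aestronglyMeasurable)
    (Eventually.of_forall fun x => ?_)
  rw [Real.norm_of_nonneg (mul_nonneg (by positivity) (heatKernel_pos one_pos x).le)]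
  exact sq_mul_heatKernel_one_le x

/-- In polar coordinates the mass and the second moment are both Gamma integrals, and their ratio is
4 · N/2. -/
lemma integral_sq_mul_heatKernel (hN : 1 ≤ N) :
    ∫ x : Sp N, ‖x‖ ^ 2 * heatKernel N 1 x = 2 * N := by
  have : Nonempty (Fin N) := ⟨⟨0, hN⟩⟩
  have hN' : (0 : ℝ) < N := by exact_mod_cast hN
  have hdim : Module.finrank ℝ (Sp N) = N := by simp
  set c := (4 * Real.pi * 1) ^ (-((N : ℝ) / 2)) with hc
  have g0 : ∫ y in Set.Ioi (0 : ℝ), y ^ (N - 1) • (c * Real.exp (-(1 / 4) * y ^ 2))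
      = c * ((1 / 4 : ℝ) ^ (-(N : ℝ) / 2) * (1 / 2) * Real.Gamma ((N : ℝ) / 2)) := by
    have h := integral_rpow_mul_exp_neg_mul_rpow (p := 2) (q := (N : ℝ) - 1) (b := 1 / 4)
      (by norm_num) (by linarith) (by norm_num)
    rw [sub_add_cancel] at h
    rw [← h, ← integral_const_mul]
    refine setIntegral_congr_fun measurableSet_Ioi fun y _ => ?_
    simp only [smul_eq_mul]
    rw [← Real.rpow_natCast, Nat.cast_sub hN, ← Real.rpow_natCast y 2]
    push_cast; ring
  have g2 : ∫ y in Set.Ioi (0 : ℝ), y ^ (N - 1) • (y ^ 2 * (c * Real.exp (-(1 / 4) * y ^ 2)))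
      = c * ((1 / 4 : ℝ) ^ (-((N : ℝ) + 2) / 2) * (1 / 2) * Real.Gamma (((N : ℝ) + 2) / 2)) := by
    have h := integral_rpow_mul_exp_neg_mul_rpow (p := 2) (q := (N : ℝ) + 1) (b := 1 / 4)
      (by norm_num) (by linarith) (by norm_num)
    rw [show (N : ℝ) + 1 + 1 = N + 2 by ring] at h
    rw [← h, ← integral_const_mul]
    refine setIntegral_congr_fun measurableSet_Ioi fun y _ => ?_
    simp only [smul_eq_mul]
    rw [← mul_assoc, ← pow_add, show N - 1 + 2 = N + 1 by omega, ← Real.rpow_natCast y (N + 1),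
      ← Real.rpow_natCast y 2]
    push_cast; ring
  have i0 := integral_heatKernel (N := N) (t := 1) one_pos
  have r0 := integral_fun_norm_addHaar (volume : Measure (Sp N))
    (fun r => c * Real.exp (-(1 / 4) * r ^ 2))
  have r2 := integral_fun_norm_addHaar (volume : Measure (Sp N))
    (fun r => r ^ 2 * (c * Real.exp (-(1 / 4) * r ^ 2)))
  rw [hdim] at r0 r2
  rw [g0] at r0
  rw [g2] at r2
  have e0 : ∀ x : Sp N, heatKernel N 1 x = c * Real.exp (-(1 / 4) * ‖x‖ ^ 2) := fun x => by
    rw [heatKernel_eq, mul_one 4]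
  simp_rw [e0] at i0 ⊢
  rw [r2]
  rw [r0] at i0
  have hG : Real.Gamma (((N : ℝ) + 2) / 2) = (N : ℝ) / 2 * Real.Gamma ((N : ℝ) / 2) := by
    rw [← Real.Gamma_add_one (by positivity)]; congr 1; ring
  have hp : (1 / 4 : ℝ) ^ (-((N : ℝ) + 2) / 2) = 4 * (1 / 4 : ℝ) ^ (-(N : ℝ) / 2) := by
    rw [show -((N : ℝ) + 2) / 2 = -1 + -(N : ℝ) / 2 by ring, Real.rpow_add (by norm_num),
      Real.rpow_neg_one]
    norm_num
  rw [hG, hp]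
  simp only [nsmul_eq_mul, smul_eq_mul] at i0 ⊢
  linear_combination (2 * (N : ℝ)) * i0

lemma integral_inner_mul_heatKernel (x : Sp N) :
    ∫ y : Sp N, inner ℝ x y * heatKernel N 1 y = 0 := by
  have h := integral_neg_eq_self (fun y : Sp N => inner ℝ x y * heatKernel N 1 y) volume
  simp_rw [heatKernel_neg, inner_neg_right, neg_mul] at h
  rw [integral_neg] at h
  linarith

lemma integrable_inner_mul_heatKernel (x : Sp N) :
    Integrable fun y : Sp N => inner ℝ x y * heatKernel N 1 y := by
  refine Integrable.mono' (((integrable_heatKernel (N := N) one_pos).add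
    integrable_sq_mul_heatKernel).const_mul ‖x‖)
    (by exact ((continuous_const.inner continuous_id).mul
      (continuous_heatKernel 1)).aestronglyMeasurable) (Eventually.of_forall fun y => ?_)
  have hk := (heatKernel_pos one_pos y).le
  rw [norm_mul, Real.norm_of_nonneg hk]
  calc ‖inner ℝ x y‖ * heatKernel N 1 y ≤ (‖x‖ * ‖y‖) * heatKernel N 1 y := by
        gcongr; exact norm_inner_le_norm x y
    _ ≤ (‖x‖ * (1 + ‖y‖ ^ 2)) * heatKernel N 1 y := by
        gcongr; nlinarith [sq_nonneg (‖y‖ - 1)]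
    _ = _ := by simp only [Pi.add_apply]; ring

end

/-! ### The heat semigroup on C₀ -/

section

open Filter Topology MeasureTheory

variable {N : ℕ}

lemma abs_apply_le_norm (w : C₀(Sp N, ℝ)) (x : Sp N) : |w x| ≤ ‖w‖ :=
  w.toBCF.norm_coe_le_norm x

lemma apply_le_norm (w : C₀(Sp N, ℝ)) (x : Sp N) : w x ≤ ‖w‖ :=
  (le_abs_self _).trans (abs_apply_le_norm w x)

lemma norm_le_of_forall_abs_le {w : C₀(Sp N, ℝ)} {C : ℝ} (hC : 0 ≤ C) (h : ∀ x, |w x| ≤ C) :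
    ‖w‖ ≤ C :=
  (BoundedContinuousFunction.norm_le (f := w.toBCF) hC).2 h

lemma norm_le_of_nonneg_of_le {w : C₀(Sp N, ℝ)} {C : ℝ} (hw : ∀ x, 0 ≤ w x) (h : ∀ x, w x ≤ C) :
    ‖w‖ ≤ C :=
  norm_le_of_forall_abs_le ((hw 0).trans (h 0)) fun x => by rw [abs_of_nonneg (hw x)]; exact h x

/-- Evaluation at a point as a continuous linear functional. -/
def evalAt (x : Sp N) : C₀(Sp N, ℝ) →L[ℝ] ℝ :=
  LinearMap.mkContinuous
    { toFun := fun w => w x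
      map_add' := fun _ _ => rfl
      map_smul' := fun _ _ => rfl } 1
    fun w => by rw [one_mul]; exact abs_apply_le_norm w x

lemma evalAt_apply (x : Sp N) (w : C₀(Sp N, ℝ)) : evalAt x w = w x := rfl

/-- The translate `x ↦ w (x - z)`. -/
def translate (z : Sp N) (w : C₀(Sp N, ℝ)) : C₀(Sp N, ℝ) where
  toFun x := w (x - z)
  continuous_toFun := by fun_prop
  zero_at_infty' := (zero_at_infty w).comp
    (Homeomorph.subRight z).isClosedEmbedding.tendsto_cocompact

lemma norm_translate_le (z : Sp N) (w : C₀(Sp N, ℝ)) : ‖translate z w‖ ≤ ‖w‖ :=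
  norm_le_of_forall_abs_le (norm_nonneg w) fun x => abs_apply_le_norm w (x - z)

/-- Functions in C₀ are uniformly continuous, which gives strong continuity of translations;
contractivity makes it joint. -/
lemma continuous_translate : Continuous fun p : Sp N × C₀(Sp N, ℝ) => translate p.1 p.2 := by
  rw [Metric.continuous_iff]
  rintro ⟨z, w⟩ ε hε
  obtain ⟨δ, hδ, h⟩ := Metric.uniformContinuous_iff.1
    (ZeroAtInftyContinuousMap.uniformContinuous w) (ε / 4) (by positivity)
  refine ⟨min δ (ε / 4), by positivity, fun ⟨z', w'⟩ hd => ?_⟩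
  rw [Prod.dist_eq, max_lt_iff] at hd
  have h1 : ‖w' - w‖ ≤ ε / 4 := by
    rw [← dist_eq_norm]; exact (hd.2.trans_le (min_le_right _ _)).le
  rw [dist_eq_norm]
  refine lt_of_le_of_lt (norm_le_of_forall_abs_le (C := ε / 4 + ε / 4) (by positivity) fun x => ?_)
    (by linarith)
  have h2 : |w (x - z') - w (x - z)| ≤ ε / 4 := by
    rw [← Real.dist_eq]
    refine (h ?_).le
    rw [dist_sub_left]
    exact hd.1.trans_le (min_le_left _ _)
  have h3 : |w' (x - z') - w (x - z')| ≤ ε / 4 := (abs_apply_le_norm (w' - w) (x - z')).trans h1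
  calc |w' (x - z') - w (x - z)|
      = |(w' (x - z') - w (x - z')) + (w (x - z') - w (x - z))| := by ring_nf
    _ ≤ _ := (abs_add_le _ _).trans (add_le_add h3 h2)

lemma integrable_heatKernel_smul_translate (t : ℝ) (w : C₀(Sp N, ℝ)) :
    Integrable fun y : Sp N => heatKernel N 1 y • translate (Real.sqrt t • y) w := by
  refine Integrable.mono' ((integrable_heatKernel (N := N) one_pos).mul_const ‖w‖) ?_
    (Eventually.of_forall fun y => ?_)
  · have : Continuous fun y : Sp N => translate (Real.sqrt t • y) w :=
      continuous_translate.comp (by fun_prop : Continuous fun y : Sp N => (Real.sqrt t • y, w))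
    exact ((continuous_heatKernel 1).smul this).aestronglyMeasurable
  · rw [norm_smul, Real.norm_of_nonneg (heatKernel_pos one_pos y).le]
    exact mul_le_mul_of_nonneg_left (norm_translate_le _ _) (heatKernel_pos one_pos y).le

/-- The heat semigroup on `C₀`. -/
def heat (N : ℕ) (t : ℝ) : C₀(Sp N, ℝ) →L[ℝ] C₀(Sp N, ℝ) :=
  LinearMap.mkContinuous
    { toFun := fun w => ∫ y : Sp N, heatKernel N 1 y • translate (Real.sqrt t • y) w
      map_add' := fun w w' => by
        rw [← integral_add (integrable_heatKernel_smul_translate t w)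
          (integrable_heatKernel_smul_translate t w')]
        refine integral_congr_ae (Eventually.of_forall fun y => ?_)
        exact smul_add (heatKernel N 1 y) (translate (Real.sqrt t • y) w)
          (translate (Real.sqrt t • y) w')
      map_smul' := fun c w => by
        rw [RingHom.id_apply, ← integral_smul]
        refine integral_congr_ae (Eventually.of_forall fun y => ?_)
        simp only [smul_comm c]; rfl } 1
    fun w => by
      rw [one_mul]
      calc ‖∫ y : Sp N, heatKernel N 1 y • translate (Real.sqrt t • y) w‖
          ≤ ∫ y : Sp N, heatKernel N 1 y * ‖w‖ := by
            refine norm_integral_le_of_norm_le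
              ((integrable_heatKernel (N := N) one_pos).mul_const ‖w‖)
              (Eventually.of_forall fun y => ?_)
            rw [norm_smul, Real.norm_of_nonneg (heatKernel_pos one_pos y).le]
            exact mul_le_mul_of_nonneg_left (norm_translate_le _ _) (heatKernel_pos one_pos y).le
        _ = ‖w‖ := by rw [integral_mul_const, integral_heatKernel one_pos, one_mul]

lemma heat_eq (t : ℝ) (w : C₀(Sp N, ℝ)) :
    heat N t w = ∫ y : Sp N, heatKernel N 1 y • translate (Real.sqrt t • y) w := rfl

lemma norm_heat_le (t : ℝ) (w : C₀(Sp N, ℝ)) : ‖heat N t w‖ ≤ ‖w‖ := by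
  have h : ‖heat N t‖ ≤ 1 := LinearMap.mkContinuous_norm_le _ zero_le_one _
  simpa using (heat N t).le_of_opNorm_le h w

lemma heat_apply (t : ℝ) (w : C₀(Sp N, ℝ)) (x : Sp N) :
    heat N t w x = ∫ y : Sp N, heatKernel N 1 y * w (x - Real.sqrt t • y) := by
  rw [heat_eq, ← evalAt_apply, ← (evalAt x).integral_comp_comm
    (integrable_heatKernel_smul_translate t w)]
  rfl

lemma heat_apply_of_pos {t : ℝ} (ht : 0 < t) (w : C₀(Sp N, ℝ)) (x : Sp N) :
    heat N t w x = ∫ y : Sp N, heatKernel N t y * w (x - y) := by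
  rw [heat_apply, integral_heatKernel_mul_comp ht fun y => w (x - y)]

lemma heat_apply_eq_heatSemigroup {t : ℝ} (ht : 0 ≤ t) (w : C₀(Sp N, ℝ)) (x : Sp N) :
    heat N t w x = heatSemigroup N t w x := by
  rcases ht.eq_or_lt with rfl | ht
  · rw [heat_apply, heatSemigroup, if_pos rfl]
    simp [integral_mul_const, integral_heatKernel]
  · rw [heatSemigroup, if_neg ht.ne', heat_apply_of_pos ht,
      ← integral_sub_left_eq_self (fun y => heatKernel N t (x - y) * w y) volume x]
    simp_rw [sub_sub_cancel]

lemma heat_nonneg (t : ℝ) {w : C₀(Sp N, ℝ)} (hw : ∀ x, 0 ≤ w x) (x : Sp N) : 0 ≤ heat N t w x := by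
  rw [heat_apply]
  exact integral_nonneg fun y => mul_nonneg (heatKernel_pos one_pos y).le (hw _)

lemma continuous_heat : Continuous fun p : ℝ × C₀(Sp N, ℝ) => heat N p.1 p.2 := by
  have h : ∀ w : C₀(Sp N, ℝ), Continuous fun t => heat N t w := by
    intro w
    simp_rw [heat_eq]
    refine continuous_of_dominated (bound := fun y => heatKernel N 1 y * ‖w‖)
      (fun t => (integrable_heatKernel_smul_translate t w).aestronglyMeasurable) (fun t => ?_)
      ((integrable_heatKernel (N := N) one_pos).mul_const ‖w‖) ?_
    · refine Eventually.of_forall fun y => ?_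
      rw [norm_smul, Real.norm_of_nonneg (heatKernel_pos one_pos y).le]
      exact mul_le_mul_of_nonneg_left (norm_translate_le _ _) (heatKernel_pos one_pos y).le
    · refine Eventually.of_forall fun y => ?_
      have : Continuous fun t : ℝ => translate (Real.sqrt t • y) w :=
        continuous_translate.comp (by fun_prop : Continuous fun t : ℝ => (Real.sqrt t • y, w))
      exact this.const_smul (heatKernel N 1 y)
  rw [Metric.continuous_iff]
  rintro ⟨t, w⟩ ε hε
  obtain ⟨δ, hδ, hc⟩ := Metric.continuous_iff.1 (h w) t (ε / 2) (by positivity)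
  refine ⟨min δ (ε / 2), by positivity, fun ⟨t', w'⟩ hd => ?_⟩
  rw [Prod.dist_eq, max_lt_iff] at hd
  calc dist (heat N t' w') (heat N t w)
      ≤ dist (heat N t' w') (heat N t' w) + dist (heat N t' w) (heat N t w) := dist_triangle _ _ _
    _ < ε / 2 + ε / 2 := by
        refine add_lt_add ?_ (hc t' (hd.1.trans_le (min_le_left _ _)))
        rw [dist_eq_norm, ← map_sub]
        refine (norm_heat_le _ _).trans_lt ?_
        rw [← dist_eq_norm]
        exact hd.2.trans_le (min_le_right _ _)
    _ = ε := by ring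

lemma integrable_heatKernel_mul {t : ℝ} (ht : 0 < t) (w : C₀(Sp N, ℝ)) (x : Sp N) :
    Integrable fun y : Sp N => heatKernel N t y * w (x - y) :=
  (integrable_heatKernel ht).mul_bdd (c := ‖w‖)
    (by exact (by fun_prop : Continuous fun y => w (x - y)).aestronglyMeasurable)
    (Eventually.of_forall fun y => abs_apply_le_norm w (x - y))

lemma heat_add {s t : ℝ} (hs : 0 < s) (ht : 0 < t) (w : C₀(Sp N, ℝ)) :
    heat N (s + t) w = heat N s (heat N t w) := by
  ext x
  rw [heat_apply_of_pos (add_pos hs ht), heat_apply_of_pos hs]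
  have e1 : ∀ y : Sp N, heatKernel N s y * heat N t w (x - y)
      = ∫ z, heatKernel N s y * heatKernel N t (z - y) * w (x - z) := by
    intro y
    rw [heat_apply_of_pos ht, ← integral_const_mul,
      ← integral_sub_right_eq_self (fun z => heatKernel N s y * (heatKernel N t z * w (x - y - z))) y]
    refine integral_congr_ae (Eventually.of_forall fun z => ?_)
    simp only
    rw [show x - y - (z - y) = x - z by abel]; ring
  simp_rw [e1]
  have hint : Integrable (fun p : Sp N × Sp N => heatKernel N s p.2 * heatKernel N t (p.1 - p.2))
      (volume.prod volume) := by
    have := (integrable_heatKernel (N := N) hs).convolution_integrand (ContinuousLinearMap.mul ℝ ℝ)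
      (integrable_heatKernel (N := N) ht)
    simpa using this
  have hint2 : Integrable (fun p : Sp N × Sp N =>
      heatKernel N s p.2 * heatKernel N t (p.1 - p.2) * w (x - p.1)) (volume.prod volume) :=
    hint.mul_bdd (c := ‖w‖)
      (by exact (by fun_prop : Continuous fun p : Sp N × Sp N => w (x - p.1)).aestronglyMeasurable)
      (Eventually.of_forall fun p => abs_apply_le_norm w (x - p.1))
  rw [integral_integral_swap (f := fun y z => heatKernel N s y * heatKernel N t (z - y) * w (x - z))
    (by exact hint2.swap)]
  refine integral_congr_ae (Eventually.of_forall fun z => ?_)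
  simp only
  rw [integral_mul_const, integral_heatKernel_mul_heatKernel hs ht]

lemma heat_le_mul_heat {s t : ℝ} (hs : 0 < s) (hst : s ≤ t) {w : C₀(Sp N, ℝ)} (hw : ∀ x, 0 ≤ w x)
    (x : Sp N) : heat N s w x ≤ (t / s) ^ ((N : ℝ) / 2) * heat N t w x := by
  rw [heat_apply_of_pos hs, heat_apply_of_pos (hs.trans_le hst), ← integral_const_mul]
  refine integral_mono (integrable_heatKernel_mul hs w x)
    ((integrable_heatKernel_mul (hs.trans_le hst) w x).const_mul _) fun y => ?_
  simp only
  rw [← mul_assoc]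
  exact mul_le_mul_of_nonneg_right (heatKernel_le_mul hs hst y) (hw _)

lemma heat_mul_time_le {t l : ℝ} (ht : 0 < t) (hl : 1 ≤ l) (hl2 : l ≤ 2) {w : C₀(Sp N, ℝ)}
    (hw : ∀ x, 0 ≤ w x) (x : Sp N) :
    heat N (l * t) w x ≤ heat N t w x + (1 - l⁻¹) * (4 * 4 ^ ((N : ℝ) / 2)) * heat N (4 * t) w x := by
  have hl0 : 0 < l := by linarith
  rw [heat_apply_of_pos ht, heat_apply_of_pos (mul_pos hl0 ht), heat_apply_of_pos (by positivity),
    ← integral_const_mul, ← integral_add (integrable_heatKernel_mul ht w x)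
      ((integrable_heatKernel_mul (by positivity) w x).const_mul _)]
  refine integral_mono (integrable_heatKernel_mul (mul_pos hl0 ht) w x)
    ((integrable_heatKernel_mul ht w x).add
      ((integrable_heatKernel_mul (by positivity) w x).const_mul _)) fun y => ?_
  simp only
  have := mul_le_mul_of_nonneg_right (heatKernel_mul_time_le ht hl hl2 y) (hw (x - y))
  linarith

attribute [irreducible] heat

end

/-! ### The weight χ as a subsolution, and Jensen's inequality -/

section

open Filter Topology MeasureTheory

variable {N : ℕ}

lemma integrable_exp_neg_sqrt :
    Integrable fun y : Sp N => Real.exp (-Real.sqrt ((N : ℝ) ^ 2 + ‖y‖ ^ 2)) := by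
  have h := (integrable_one_add_norm (E := Sp N) (μ := volume) (r := (N : ℝ) + 1)
    (by rw [finrank_euclideanSpace, Fintype.card_fin]; linarith)).const_mul
    (Real.exp 1 * ((N + 1).factorial : ℝ))
  refine Integrable.mono' h (by exact (by fun_prop : Continuous fun y : Sp N =>
    Real.exp (-Real.sqrt ((N : ℝ) ^ 2 + ‖y‖ ^ 2))).aestronglyMeasurable)
    (Eventually.of_forall fun y => ?_)
  have hy : 0 < 1 + ‖y‖ := by positivity
  rw [Real.norm_of_nonneg (Real.exp_pos _).le, Real.rpow_neg hy.le,
    show (N : ℝ) + 1 = ((N + 1 : ℕ) : ℝ) by push_cast; rfl, Real.rpow_natCast]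
  have h1 : ‖y‖ ≤ Real.sqrt ((N : ℝ) ^ 2 + ‖y‖ ^ 2) :=
    Real.le_sqrt_of_sq_le (by nlinarith [sq_nonneg (N : ℝ)])
  have h2 := Real.pow_div_factorial_le_exp (1 + ‖y‖) hy.le (N + 1)
  rw [div_le_iff₀ (by positivity), Real.exp_add] at h2
  calc Real.exp (-Real.sqrt ((N : ℝ) ^ 2 + ‖y‖ ^ 2)) ≤ Real.exp (-‖y‖) := Real.exp_le_exp.2 (by linarith)
    _ ≤ _ := by
        rw [← div_eq_mul_inv, le_div_iff₀ (by positivity), Real.exp_neg, inv_mul_le_iff₀ (Real.exp_pos _)]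
        linarith

lemma integral_exp_neg_sqrt_pos :
    0 < ∫ y : Sp N, Real.exp (-Real.sqrt ((N : ℝ) ^ 2 + ‖y‖ ^ 2)) :=
  integral_exp_pos integrable_exp_neg_sqrt

lemma weight_pos (x : Sp N) : 0 < weight N x :=
  mul_pos (inv_pos.2 integral_exp_neg_sqrt_pos) (Real.exp_pos _)

lemma continuous_weight : Continuous (weight N) := by
  unfold weight; fun_prop

lemma integrable_weight : Integrable (weight N) :=
  integrable_exp_neg_sqrt.const_mul _

lemma integral_weight : ∫ x, weight N x = 1 := by
  simp only [weight]
  rw [integral_const_mul]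
  exact inv_mul_cancel₀ integral_exp_neg_sqrt_pos.ne'

lemma weight_le (x : Sp N) :
    weight N x ≤ (∫ y : Sp N, Real.exp (-Real.sqrt ((N : ℝ) ^ 2 + ‖y‖ ^ 2)))⁻¹ := by
  refine mul_le_of_le_one_right (inv_nonneg.2 integral_exp_neg_sqrt_pos.le) ?_
  rw [Real.exp_le_one_iff]
  linarith [Real.sqrt_nonneg ((N : ℝ) ^ 2 + ‖x‖ ^ 2)]

/-- Tangent line of the concave square root at r². -/
lemma sqrt_add_le {r a : ℝ} (hr : 0 < r) (ha : -r ^ 2 ≤ a) :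
    Real.sqrt (r ^ 2 + a) ≤ r + a / (2 * r) := by
  rw [Real.sqrt_le_iff]
  have h : a / (2 * r) * (2 * r) = a := by field_simp
  constructor
  · rw [← sub_nonneg]
    have : r + a / (2 * r) - 0 = (2 * r ^ 2 + a) / (2 * r) := by field_simp; ring
    rw [this]
    exact div_nonneg (by nlinarith) (by positivity)
  · nlinarith [sq_nonneg (a / (2 * r))]

/-- The weight is a subsolution of the damped heat equation. -/
lemma exp_neg_mul_weight_le (hN : 1 ≤ N) {t : ℝ} (ht : 0 ≤ t) (x : Sp N) :
    Real.exp (-t) * weight N x ≤ ∫ y, heatKernel N 1 y * weight N (x + Real.sqrt t • y) := by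
  have hN' : (0 : ℝ) < N := by exact_mod_cast hN
  set r := Real.sqrt ((N : ℝ) ^ 2 + ‖x‖ ^ 2) with hr
  have hr2 : r ^ 2 = (N : ℝ) ^ 2 + ‖x‖ ^ 2 := Real.sq_sqrt (by positivity)
  have hrN : (N : ℝ) ≤ r := Real.le_sqrt_of_sq_le (by nlinarith [sq_nonneg ‖x‖])
  have hr0 : 0 < r := hN'.trans_le hrN
  set C := (∫ y : Sp N, Real.exp (-Real.sqrt ((N : ℝ) ^ 2 + ‖y‖ ^ 2)))⁻¹ with hC
  have hC0 : 0 < C := inv_pos.2 integral_exp_neg_sqrt_pos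
  -- Two tangent lines replace the computation of Δχ: √(r²+a) ≤ r + a/(2r), and the exponential from
  -- below at -(r+t). The base point r+t makes the linear term t - a/(2r); after averaging it
  -- becomes t - tN/r, which is nonnegative because r ≥ N.
  have hpt : ∀ y : Sp N, C * Real.exp (-(r + t)) * (1 + t - (Real.sqrt t / r) * inner ℝ x y -
      t / (2 * r) * ‖y‖ ^ 2) ≤ weight N (x + Real.sqrt t • y) := by
    intro y
    rw [weight, ← hC, mul_assoc]
    refine mul_le_mul_of_nonneg_left ?_ hC0.le
    set a := 2 * Real.sqrt t * inner ℝ x y + t * ‖y‖ ^ 2 with ha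
    have hsq : (N : ℝ) ^ 2 + ‖x + Real.sqrt t • y‖ ^ 2 = r ^ 2 + a := by
      rw [norm_add_sq_real, inner_smul_right, norm_smul, mul_pow,
        Real.norm_of_nonneg (Real.sqrt_nonneg t), Real.sq_sqrt ht, hr2, ha]
      ring
    have ha2 : -r ^ 2 ≤ a := by
      have : 0 ≤ (N : ℝ) ^ 2 + ‖x + Real.sqrt t • y‖ ^ 2 := by positivity
      linarith
    rw [hsq]
    have h1 := sqrt_add_le hr0 ha2
    have h2 := Real.add_one_le_exp (r + t - Real.sqrt (r ^ 2 + a))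
    have e : Real.exp (-Real.sqrt (r ^ 2 + a))
        = Real.exp (-(r + t)) * Real.exp (r + t - Real.sqrt (r ^ 2 + a)) := by
      rw [← Real.exp_add]; ring_nf
    rw [e]
    refine mul_le_mul_of_nonneg_left (le_trans ?_ h2) (Real.exp_pos _).le
    have e2 : a / (2 * r) = (Real.sqrt t / r) * inner ℝ x y + t / (2 * r) * ‖y‖ ^ 2 := by
      rw [ha]; field_simp
    linarith
  have hi0 := integrable_heatKernel (N := N) one_pos
  have hi1 := integrable_inner_mul_heatKernel x
  have hi2 := integrable_sq_mul_heatKernel (N := N)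
  have hlow : ∫ y, heatKernel N 1 y * (C * Real.exp (-(r + t)) * (1 + t - (Real.sqrt t / r) * inner ℝ x y -
      t / (2 * r) * ‖y‖ ^ 2)) = C * Real.exp (-(r + t)) * (1 + t - t * N / r) := by
    have e : ∀ y : Sp N, heatKernel N 1 y * (C * Real.exp (-(r + t)) *
        (1 + t - (Real.sqrt t / r) * inner ℝ x y - t / (2 * r) * ‖y‖ ^ 2))
        = C * Real.exp (-(r + t)) * ((1 + t) * heatKernel N 1 y
          - (Real.sqrt t / r) * (inner ℝ x y * heatKernel N 1 y)
          - t / (2 * r) * (‖y‖ ^ 2 * heatKernel N 1 y)) := fun y => by ring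
    have hi01 : Integrable fun y : Sp N => (1 + t) * heatKernel N 1 y
        - (Real.sqrt t / r) * (inner ℝ x y * heatKernel N 1 y) :=
      (hi0.const_mul _).sub (hi1.const_mul _)
    simp_rw [e]
    rw [integral_const_mul, integral_sub hi01 (hi2.const_mul _),
      integral_sub (hi0.const_mul _) (hi1.const_mul _), integral_const_mul, integral_const_mul,
      integral_const_mul, integral_heatKernel one_pos, integral_inner_mul_heatKernel,
      integral_sq_mul_heatKernel hN]
    congr 1
    field_simp
    ring
  have hfin : Real.exp (-t) * weight N x ≤ C * Real.exp (-(r + t)) * (1 + t - t * N / r) := by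
    rw [weight, ← hC, ← hr]
    have e : Real.exp (-(r + t)) = Real.exp (-t) * Real.exp (-r) := by
      rw [← Real.exp_add]; ring_nf
    have h1 : t * N / r ≤ t := by
      rw [div_le_iff₀ hr0]; exact mul_le_mul_of_nonneg_left hrN ht
    rw [e]
    have h2 : 0 < C * (Real.exp (-t) * Real.exp (-r)) := by positivity
    nlinarith
  refine hfin.trans (hlow ▸ ?_)
  refine integral_mono ?_ ?_ fun y => mul_le_mul_of_nonneg_left (hpt y) (heatKernel_pos one_pos y).le
  · have e : (fun y : Sp N => heatKernel N 1 y * (C * Real.exp (-(r + t)) *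
        (1 + t - (Real.sqrt t / r) * inner ℝ x y - t / (2 * r) * ‖y‖ ^ 2)))
        = fun y => C * Real.exp (-(r + t)) * ((1 + t) * heatKernel N 1 y
          - (Real.sqrt t / r) * (inner ℝ x y * heatKernel N 1 y)
          - t / (2 * r) * (‖y‖ ^ 2 * heatKernel N 1 y)) := by funext y; ring
    rw [e]
    exact (((hi0.const_mul _).sub (hi1.const_mul _)).sub (hi2.const_mul _)).const_mul _
  · refine hi0.mul_bdd (c := C) (by exact (continuous_weight.comp (by fun_prop)).aestronglyMeasurable)
      (Eventually.of_forall fun y => ?_)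
    rw [Real.norm_of_nonneg (weight_pos _).le]
    exact weight_le _

lemma integrable_mul_weight (w : C₀(Sp N, ℝ)) : Integrable fun x => w x * weight N x :=
  integrable_weight.bdd_mul (c := ‖w‖) (by exact (map_continuous w).aestronglyMeasurable)
    (Eventually.of_forall fun x => abs_apply_le_norm w x)

/-- Integration against the weight, as a continuous linear functional. -/
def weightFun (N : ℕ) : C₀(Sp N, ℝ) →L[ℝ] ℝ :=
  LinearMap.mkContinuous
    { toFun := fun w => ∫ x, w x * weight N x
      map_add' := fun w w' => by
        rw [← integral_add (integrable_mul_weight w) (integrable_mul_weight w')]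
        exact integral_congr_ae (Eventually.of_forall fun x => add_mul _ _ _)
      map_smul' := fun c w => by
        rw [RingHom.id_apply, ← integral_smul]
        exact integral_congr_ae (Eventually.of_forall fun x => mul_assoc _ _ _) } 1
    fun w => by
      rw [one_mul]
      calc ‖∫ x, w x * weight N x‖ ≤ ∫ x, ‖w‖ * weight N x := by
            refine norm_integral_le_of_norm_le (integrable_weight.const_mul ‖w‖)
              (Eventually.of_forall fun x => ?_)
            rw [norm_mul, Real.norm_of_nonneg (weight_pos x).le]
            exact mul_le_mul_of_nonneg_right (abs_apply_le_norm w x) (weight_pos x).le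
        _ = ‖w‖ := by rw [integral_const_mul, integral_weight, mul_one]

lemma weightFun_apply (w : C₀(Sp N, ℝ)) : weightFun N w = ∫ x, w x * weight N x := rfl

lemma weightFun_nonneg {w : C₀(Sp N, ℝ)} (hw : ∀ x, 0 ≤ w x) : 0 ≤ weightFun N w :=
  integral_nonneg fun x => mul_nonneg (hw x) (weight_pos x).le

/-- The heat operator is symmetric, so it can be moved onto χ, where `exp_neg_mul_weight_le`
applies. -/
lemma exp_neg_mul_weightFun_le (hN : 1 ≤ N) {t : ℝ} (ht : 0 ≤ t) {w : C₀(Sp N, ℝ)}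
    (hw : ∀ x, 0 ≤ w x) : Real.exp (-t) * weightFun N w ≤ weightFun N (heat N t w) := by
  have hprod : Integrable (fun p : Sp N × Sp N => weight N p.1 * heatKernel N 1 p.2)
      (volume.prod volume) := integrable_weight.mul_prod (integrable_heatKernel one_pos)
  have hint : Integrable (fun p : Sp N × Sp N =>
      weight N p.1 * heatKernel N 1 p.2 * w (p.1 - Real.sqrt t • p.2)) (volume.prod volume) :=
    hprod.mul_bdd (c := ‖w‖)
      (by exact (by fun_prop : Continuous fun p : Sp N × Sp N =>
        w (p.1 - Real.sqrt t • p.2)).aestronglyMeasurable)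
      (Eventually.of_forall fun p => abs_apply_le_norm w _)
  have hint2 : Integrable (fun p : Sp N × Sp N =>
      heatKernel N 1 p.2 * weight N (p.1 + Real.sqrt t • p.2) * w p.1) (volume.prod volume) := by
    -- The shear (x, y) ↦ (x + √t y, y) preserves Lebesgue measure and transfers integrability from
    -- one form of the double integral to the other.
    have hmp : MeasurePreserving (fun p : Sp N × Sp N => (p.1 + Real.sqrt t • p.2, p.2))
        (volume.prod volume) (volume.prod volume) := by
      have h2 : MeasurePreserving (fun p : Sp N × Sp N => (p.1, p.2 + Real.sqrt t • p.1))
          (volume.prod volume) (volume.prod volume) :=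
        (MeasurePreserving.id volume).skew_product (g := fun y x => x + Real.sqrt t • y)
          (by fun_prop) (Eventually.of_forall fun y =>
            (measurePreserving_add_right volume (Real.sqrt t • y)).map_eq)
      exact Measure.measurePreserving_swap.comp (h2.comp Measure.measurePreserving_swap)
    have := hmp.integrable_comp_of_integrable hint
    refine this.congr (Eventually.of_forall fun p => ?_)
    simp only [Function.comp, add_sub_cancel_right]
    ring
  have e1 : weightFun N (heat N t w)
      = ∫ x, (∫ y, heatKernel N 1 y * weight N (x + Real.sqrt t • y)) * w x := by
    rw [weightFun_apply]
    have a1 : ∀ x, heat N t w x * weight N x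
        = ∫ y, weight N x * heatKernel N 1 y * w (x - Real.sqrt t • y) := fun x => by
      rw [heat_apply, mul_comm, ← integral_const_mul]
      exact integral_congr_ae (Eventually.of_forall fun y => (mul_assoc _ _ _).symm)
    have a2 : ∀ x, (∫ y, heatKernel N 1 y * weight N (x + Real.sqrt t • y)) * w x
        = ∫ y, heatKernel N 1 y * weight N (x + Real.sqrt t • y) * w x := fun x => by
      rw [integral_mul_const]
    simp_rw [a1, a2]
    rw [integral_integral_swap (f := fun x y => weight N x * heatKernel N 1 y * w (x - Real.sqrt t • y))
      hint, integral_integral_swap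
      (f := fun x y => heatKernel N 1 y * weight N (x + Real.sqrt t • y) * w x) hint2]
    refine integral_congr_ae (Eventually.of_forall fun y => ?_)
    simp only
    rw [← integral_add_right_eq_self (fun x => weight N x * heatKernel N 1 y * w (x - Real.sqrt t • y))
      (Real.sqrt t • y)]
    refine integral_congr_ae (Eventually.of_forall fun x => ?_)
    simp only [add_sub_cancel_right]
    ring
  rw [e1, weightFun_apply, ← integral_const_mul]
  refine integral_mono ((integrable_mul_weight w).const_mul _) ?_ fun x => ?_
  · have := hint2.integral_prod_left
    simpa only [integral_mul_const] using this
  · simp only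
    rw [← mul_assoc, mul_right_comm]
    exact mul_le_mul_of_nonneg_right (exp_neg_mul_weight_le hN ht x) (hw x)

/-- Tangent line of the convex power at c, from Bernoulli's inequality for r/c. Taking for c the
χ-mean of w and integrating yields Jensen's inequality. -/
lemma rpow_tangent_le {p : ℝ} (hp : 1 < p) {r c : ℝ} (hr : 0 ≤ r) (hc : 0 ≤ c) :
    c ^ p + p * c ^ (p - 1) * (r - c) ≤ r ^ p := by
  rcases hc.eq_or_lt with rfl | hc
  · rw [Real.zero_rpow (by linarith), Real.zero_rpow (by linarith)]
    simpa using Real.rpow_nonneg hr p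
  · have h := one_add_mul_self_le_rpow_one_add (s := r / c - 1)
      (by have := div_nonneg hr hc.le; linarith) hp.le
    rw [add_sub_cancel, Real.div_rpow hr hc.le, le_div_iff₀ (by positivity)] at h
    refine le_trans (le_of_eq ?_) h
    rw [Real.rpow_sub hc, Real.rpow_one]
    field_simp

/-- Jensen's inequality for the weight. -/
lemma rpow_weightFun_le {p : ℝ} (hp : 1 < p) {w F : C₀(Sp N, ℝ)} (hw : ∀ x, 0 ≤ w x)
    (hF : ∀ x, F x = w x ^ p) : weightFun N w ^ p ≤ weightFun N F := by
  set c := weightFun N w with hc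
  have hc0 : 0 ≤ c := weightFun_nonneg hw
  have h1 : ∫ x, ((c ^ p - p * c ^ (p - 1) * c) * weight N x + p * c ^ (p - 1) * (w x * weight N x))
      = c ^ p := by
    rw [integral_add (integrable_weight.const_mul _) ((integrable_mul_weight w).const_mul _),
      integral_const_mul, integral_const_mul, integral_weight, ← weightFun_apply, ← hc]
    ring
  rw [← h1, weightFun_apply]
  refine integral_mono ((integrable_weight.const_mul _).add ((integrable_mul_weight w).const_mul _))
    (integrable_mul_weight F) fun x => ?_
  simp only [hF]
  have := mul_le_mul_of_nonneg_right (rpow_tangent_le hp (hw x) hc0) (weight_pos x).le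
  linarith

lemma Z0_eq (u₀ v₀ : C₀(Sp N, ℝ)) : Z0 N u₀ v₀ = weightFun N u₀ + weightFun N v₀ := by
  rw [← map_add]; rfl

attribute [irreducible] weightFun

end

/-! ### Superpositions of heat operators; the operators P_γ and S_γ -/

section

open Filter Topology MeasureTheory

variable {N : ℕ} {ρ : ℝ → ℝ}

lemma continuous_heat_mul_time (s : ℝ) (w : C₀(Sp N, ℝ)) :
    Continuous fun θ : ℝ => heat N (s * θ) w := by
  have h : Continuous fun θ : ℝ => (s * θ, w) := by fun_prop
  exact continuous_heat.comp h

lemma integrableOn_smul_heat (hρ : IntegrableOn ρ (Set.Ioi 0)) (s : ℝ) (w : C₀(Sp N, ℝ)) :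
    IntegrableOn (fun θ => ρ θ • heat N (s * θ) w) (Set.Ioi 0) := by
  refine Integrable.mono' (hρ.norm.mul_const ‖w‖)
    (hρ.aestronglyMeasurable.smul (continuous_heat_mul_time s w).aestronglyMeasurable)
    (Eventually.of_forall fun θ => ?_)
  rw [norm_smul]
  exact mul_le_mul_of_nonneg_left (norm_heat_le _ _) (norm_nonneg _)

/-- The superposition `w ↦ ∫₀^∞ ρ(θ) T(s θ) w dθ` of heat operators. -/
def mix (N : ℕ) (hρ : IntegrableOn ρ (Set.Ioi 0)) (s : ℝ) : C₀(Sp N, ℝ) →L[ℝ] C₀(Sp N, ℝ) :=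
  LinearMap.mkContinuous
    { toFun := fun w => ∫ θ in Set.Ioi (0 : ℝ), ρ θ • heat N (s * θ) w
      map_add' := fun w w' => by
        rw [← integral_add (integrableOn_smul_heat hρ s w) (integrableOn_smul_heat hρ s w')]
        refine integral_congr_ae (Eventually.of_forall fun θ => ?_)
        simp only [map_add]
        exact smul_add (ρ θ) (heat N (s * θ) w) (heat N (s * θ) w')
      map_smul' := fun c w => by
        rw [RingHom.id_apply, ← integral_smul]
        refine integral_congr_ae (Eventually.of_forall fun θ => ?_)
        simp only [map_smul, smul_comm c] } (∫ θ in Set.Ioi (0 : ℝ), |ρ θ|)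
    fun w => by
      rw [← integral_mul_const]
      refine norm_integral_le_of_norm_le (hρ.norm.mul_const ‖w‖) (Eventually.of_forall fun θ => ?_)
      rw [norm_smul]
      exact mul_le_mul_of_nonneg_left (norm_heat_le _ _) (norm_nonneg _)

lemma mix_eq (hρ : IntegrableOn ρ (Set.Ioi 0)) (s : ℝ) (w : C₀(Sp N, ℝ)) :
    mix N hρ s w = ∫ θ in Set.Ioi (0 : ℝ), ρ θ • heat N (s * θ) w := rfl

lemma norm_mix_le (hρ : IntegrableOn ρ (Set.Ioi 0)) (s : ℝ) (w : C₀(Sp N, ℝ)) :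
    ‖mix N hρ s w‖ ≤ (∫ θ in Set.Ioi (0 : ℝ), |ρ θ|) * ‖w‖ :=
  (mix N hρ s).le_of_opNorm_le (LinearMap.mkContinuous_norm_le _
    (setIntegral_nonneg measurableSet_Ioi fun _ _ => abs_nonneg _) _) w

lemma mix_clm {F : Type*} [NormedAddCommGroup F] [NormedSpace ℝ F] [CompleteSpace F]
    (L : C₀(Sp N, ℝ) →L[ℝ] F) (hρ : IntegrableOn ρ (Set.Ioi 0)) (s : ℝ) (w : C₀(Sp N, ℝ)) :
    L (mix N hρ s w) = ∫ θ in Set.Ioi (0 : ℝ), ρ θ • L (heat N (s * θ) w) := by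
  rw [mix_eq, ← L.integral_comp_comm (integrableOn_smul_heat hρ s w)]
  simp only [map_smul]

lemma mix_apply (hρ : IntegrableOn ρ (Set.Ioi 0)) (s : ℝ) (w : C₀(Sp N, ℝ)) (x : Sp N) :
    mix N hρ s w x = ∫ θ in Set.Ioi (0 : ℝ), ρ θ * heat N (s * θ) w x :=
  mix_clm (evalAt x) hρ s w

lemma integrableOn_mul_clm_heat (L : C₀(Sp N, ℝ) →L[ℝ] ℝ) (hρ : IntegrableOn ρ (Set.Ioi 0)) (s : ℝ)
    (w : C₀(Sp N, ℝ)) : IntegrableOn (fun θ => ρ θ * L (heat N (s * θ) w)) (Set.Ioi 0) := by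
  have := L.integrable_comp (integrableOn_smul_heat hρ s w)
  simp only [map_smul, smul_eq_mul] at this
  exact this

lemma integrableOn_mul_heat_apply (hρ : IntegrableOn ρ (Set.Ioi 0)) (s : ℝ) (w : C₀(Sp N, ℝ))
    (x : Sp N) : IntegrableOn (fun θ => ρ θ * heat N (s * θ) w x) (Set.Ioi 0) :=
  integrableOn_mul_clm_heat (evalAt x) hρ s w

lemma mix_nonneg (hρ : IntegrableOn ρ (Set.Ioi 0)) (hρ0 : ∀ θ, 0 < θ → 0 ≤ ρ θ) (s : ℝ)
    {w : C₀(Sp N, ℝ)} (hw : ∀ x, 0 ≤ w x) (x : Sp N) : 0 ≤ mix N hρ s w x := by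
  rw [mix_apply]
  exact setIntegral_nonneg measurableSet_Ioi fun θ hθ => mul_nonneg (hρ0 θ hθ) (heat_nonneg _ hw x)

lemma continuous_mix (hρ : IntegrableOn ρ (Set.Ioi 0)) :
    Continuous fun p : ℝ × C₀(Sp N, ℝ) => mix N hρ p.1 p.2 := by
  have hM : 0 ≤ ∫ θ in Set.Ioi (0 : ℝ), |ρ θ| :=
    setIntegral_nonneg measurableSet_Ioi fun _ _ => abs_nonneg _
  refine continuous_prod_of_continuous_lipschitzWith' _ ⟨_, hM⟩ (fun s => ?_) (fun w => ?_)
  · refine LipschitzWith.of_dist_le_mul fun w w' => ?_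
    rw [dist_eq_norm, ← map_sub, dist_eq_norm]
    exact norm_mix_le hρ s _
  · simp_rw [mix_eq]
    refine continuous_of_dominated (bound := fun θ => ‖ρ θ‖ * ‖w‖)
      (fun s => (integrableOn_smul_heat hρ s w).aestronglyMeasurable) (fun s => ?_)
      (hρ.norm.mul_const _) ?_
    · refine Eventually.of_forall fun θ => ?_
      rw [norm_smul]
      exact mul_le_mul_of_nonneg_left (norm_heat_le _ _) (norm_nonneg _)
    · refine Eventually.of_forall fun θ => ?_
      have : Continuous fun s : ℝ => heat N (s * θ) w :=
        continuous_heat.comp (by fun_prop : Continuous fun s : ℝ => (s * θ, w))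
      exact this.const_smul (ρ θ)

/-- The bound T(sθ) ≥ e^{-sθ}, in the sense of testing against χ, is integrated in θ. For the two
densities in use this produces `relax` and `relaxKernel`. -/
lemma integral_mul_exp_mul_weightFun_le (hN : 1 ≤ N) (hρ : IntegrableOn ρ (Set.Ioi 0))
    (hρ0 : ∀ θ, 0 < θ → 0 ≤ ρ θ) {s : ℝ} (hs : 0 ≤ s) {w : C₀(Sp N, ℝ)} (hw : ∀ x, 0 ≤ w x) :
    (∫ θ in Set.Ioi (0 : ℝ), ρ θ * Real.exp (-s * θ)) * weightFun N w
      ≤ weightFun N (mix N hρ s w) := by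
  rw [mix_clm, ← integral_mul_const]
  refine setIntegral_mono_on ((integrableOn_mul_exp hρ hs).mul_const _)
    (integrableOn_mul_clm_heat _ hρ s w) measurableSet_Ioi fun θ hθ => ?_
  have h := exp_neg_mul_weightFun_le hN (mul_nonneg hs (le_of_lt hθ)) hw
  rw [smul_eq_mul, mul_assoc, neg_mul]
  exact mul_le_mul_of_nonneg_left h (hρ0 θ hθ)

attribute [irreducible] mix

variable {γ : ℝ}

lemma integrableOn_const_mul_wrightPhi (h0 : 0 < γ) (h1 : γ < 1) :
    IntegrableOn (fun θ => γ * (θ * wrightPhi γ θ)) (Set.Ioi 0) :=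
  (integrableOn_mul_wrightPhi h0 h1).const_mul γ

lemma const_mul_wrightPhi_nonneg (h0 : 0 < γ) (h1 : γ < 1) (θ : ℝ) (hθ : 0 < θ) :
    0 ≤ γ * (θ * wrightPhi γ θ) :=
  mul_nonneg h0.le (mul_nonneg hθ.le (wrightPhi_nonneg h0 h1 hθ.le))

/-- `P_γ(t)` on `C₀`. -/
def semP (N : ℕ) (h0 : 0 < γ) (h1 : γ < 1) (t : ℝ) : C₀(Sp N, ℝ) →L[ℝ] C₀(Sp N, ℝ) :=
  mix N (integrableOn_wrightPhi h0 h1) (t ^ γ)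

/-- `S_γ(t)` on `C₀`. -/
def semS (N : ℕ) (h0 : 0 < γ) (h1 : γ < 1) (t : ℝ) : C₀(Sp N, ℝ) →L[ℝ] C₀(Sp N, ℝ) :=
  mix N (integrableOn_const_mul_wrightPhi h0 h1) (t ^ γ)

lemma semP_apply (h0 : 0 < γ) (h1 : γ < 1) {t : ℝ} (ht : 0 ≤ t) (w : C₀(Sp N, ℝ)) (x : Sp N) :
    semP N h0 h1 t w x = opP N γ t w x := by
  rw [semP, mix_apply, opP]
  refine setIntegral_congr_fun measurableSet_Ioi fun θ hθ => ?_
  simp only [heat_apply_eq_heatSemigroup (mul_nonneg (Real.rpow_nonneg ht γ) (le_of_lt hθ))]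

lemma semS_apply (h0 : 0 < γ) (h1 : γ < 1) {t : ℝ} (ht : 0 ≤ t) (w : C₀(Sp N, ℝ)) (x : Sp N) :
    semS N h0 h1 t w x = opS N γ t w x := by
  rw [semS, mix_apply, opS, ← integral_const_mul]
  refine setIntegral_congr_fun measurableSet_Ioi fun θ hθ => ?_
  simp only [heat_apply_eq_heatSemigroup (mul_nonneg (Real.rpow_nonneg ht γ) (le_of_lt hθ)), mul_assoc]

lemma norm_semP_le (h0 : 0 < γ) (h1 : γ < 1) (t : ℝ) (w : C₀(Sp N, ℝ)) :
    ‖semP N h0 h1 t w‖ ≤ ‖w‖ := by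
  refine (norm_mix_le _ _ _).trans_eq ?_
  rw [setIntegral_congr_fun measurableSet_Ioi fun θ hθ =>
    abs_of_nonneg (wrightPhi_nonneg h0 h1 (le_of_lt hθ)), integral_wrightPhi h0 h1, one_mul]

lemma norm_semS_le (h0 : 0 < γ) (h1 : γ < 1) (t : ℝ) (w : C₀(Sp N, ℝ)) :
    ‖semS N h0 h1 t w‖ ≤ 1 / Real.Gamma γ * ‖w‖ := by
  refine (norm_mix_le _ _ _).trans_eq ?_
  rw [setIntegral_congr_fun measurableSet_Ioi fun θ hθ =>
    abs_of_nonneg (const_mul_wrightPhi_nonneg h0 h1 θ hθ), integral_const_mul,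
    integral_mul_wrightPhi h0 h1]

lemma continuous_semP (h0 : 0 < γ) (h1 : γ < 1) :
    Continuous fun p : ℝ × C₀(Sp N, ℝ) => semP N h0 h1 p.1 p.2 :=
  (continuous_mix (integrableOn_wrightPhi h0 h1)).comp
    (((Real.continuous_rpow_const h0.le).comp continuous_fst).prodMk continuous_snd)

lemma continuous_semS (h0 : 0 < γ) (h1 : γ < 1) :
    Continuous fun p : ℝ × C₀(Sp N, ℝ) => semS N h0 h1 p.1 p.2 :=
  (continuous_mix (integrableOn_const_mul_wrightPhi h0 h1)).comp
    (((Real.continuous_rpow_const h0.le).comp continuous_fst).prodMk continuous_snd)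

lemma semP_nonneg (h0 : 0 < γ) (h1 : γ < 1) (t : ℝ) {w : C₀(Sp N, ℝ)} (hw : ∀ x, 0 ≤ w x)
    (x : Sp N) : 0 ≤ semP N h0 h1 t w x :=
  mix_nonneg _ (fun _ hθ => wrightPhi_nonneg h0 h1 hθ.le) _ hw x

lemma semS_nonneg (h0 : 0 < γ) (h1 : γ < 1) (t : ℝ) {w : C₀(Sp N, ℝ)} (hw : ∀ x, 0 ≤ w x)
    (x : Sp N) : 0 ≤ semS N h0 h1 t w x :=
  mix_nonneg _ (const_mul_wrightPhi_nonneg h0 h1) _ hw x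

lemma relax_mul_weightFun_le (hN : 1 ≤ N) (h0 : 0 < γ) (h1 : γ < 1) {t : ℝ} (ht : 0 ≤ t)
    {w : C₀(Sp N, ℝ)} (hw : ∀ x, 0 ≤ w x) :
    relax γ t * weightFun N w ≤ weightFun N (semP N h0 h1 t w) :=
  integral_mul_exp_mul_weightFun_le hN _ (fun _ hθ => wrightPhi_nonneg h0 h1 hθ.le)
    (Real.rpow_nonneg ht γ) hw

lemma relaxKernel_mul_weightFun_le (hN : 1 ≤ N) (h0 : 0 < γ) (h1 : γ < 1) {t : ℝ} (ht : 0 ≤ t)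
    {w : C₀(Sp N, ℝ)} (hw : ∀ x, 0 ≤ w x) :
    relaxKernel γ t * weightFun N w ≤ t ^ (γ - 1) * weightFun N (semS N h0 h1 t w) := by
  rw [relaxKernel, mul_assoc]
  refine mul_le_mul_of_nonneg_left (le_trans (le_of_eq ?_) (integral_mul_exp_mul_weightFun_le hN
    (integrableOn_const_mul_wrightPhi h0 h1) (const_mul_wrightPhi_nonneg h0 h1)
    (Real.rpow_nonneg ht γ) hw)) (Real.rpow_nonneg ht _)
  simp_rw [wrightLaplace', mul_assoc, integral_const_mul, mul_assoc]

attribute [irreducible] semP semS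

end

/-! ### Weakly singular convolutions and a singular Gronwall inequality -/

section

open Filter Topology MeasureTheory

variable {X : Type*} [NormedAddCommGroup X] [NormedSpace ℝ X] {γ C : ℝ} {S : ℝ → X →L[ℝ] X}

/-- The weakly singular convolution `∫₀ᵗ (t - τ)^(γ-1) S(t - τ) h(τ) dτ`. -/
def duhamel (γ : ℝ) (S : ℝ → X →L[ℝ] X) (h : ℝ → X) (t : ℝ) : X :=
  ∫ τ in (0 : ℝ)..t, (t - τ) ^ (γ - 1) • S (t - τ) (h τ)

lemma intervalIntegrable_sub_rpow_smul (h0 : 0 < γ) (hS : Continuous fun p : ℝ × X => S p.1 p.2)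
    {a s t : ℝ} (hs : a ≤ s) {h : ℝ → X} (hh : ContinuousOn h (Set.Icc a s)) :
    IntervalIntegrable (fun τ => (t - τ) ^ (γ - 1) • S (t - τ) (h τ)) volume a s := by
  have h1 : IntervalIntegrable (fun τ => (t - τ) ^ (γ - 1)) volume a s := by
    have := (intervalIntegral.intervalIntegrable_rpow' (a := t - a) (b := t - s) (r := γ - 1)
      (by linarith)).comp_sub_left t
    simpa using this
  refine h1.smul_continuousOn ?_
  rw [Set.uIcc_of_le hs]
  exact hS.comp_continuousOn (ContinuousOn.prodMk (by fun_prop) hh)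

lemma intervalIntegrable_sub_rpow_mul (h0 : 0 < γ) {t : ℝ} (ht : 0 ≤ t) {b : ℝ → ℝ}
    (hb : ContinuousOn b (Set.Icc 0 t)) :
    IntervalIntegrable (fun τ => (t - τ) ^ (γ - 1) * b τ) volume 0 t :=
  (intervalIntegrable_sub_rpow h0 t).mul_continuousOn (by rwa [Set.uIcc_of_le ht])

lemma norm_duhamel_le (h0 : 0 < γ) (hC : ∀ t x, ‖S t x‖ ≤ C * ‖x‖) (hC0 : 0 ≤ C) {t : ℝ}
    (ht : 0 ≤ t) {h : ℝ → X} {b : ℝ → ℝ} (hb : ContinuousOn b (Set.Icc 0 t))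
    (hhb : ∀ τ ∈ Set.Icc 0 t, ‖h τ‖ ≤ b τ) :
    ‖duhamel γ S h t‖ ≤ C * ∫ τ in (0 : ℝ)..t, (t - τ) ^ (γ - 1) * b τ := by
  rw [duhamel, ← intervalIntegral.integral_const_mul]
  refine intervalIntegral.norm_integral_le_of_norm_le ht (Eventually.of_forall fun τ hτ => ?_)
    ((intervalIntegrable_sub_rpow_mul h0 ht hb).const_mul C)
  have h1 : 0 ≤ (t - τ) ^ (γ - 1) := Real.rpow_nonneg (by linarith [hτ.2]) _
  rw [norm_smul, Real.norm_of_nonneg h1]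
  calc (t - τ) ^ (γ - 1) * ‖S (t - τ) (h τ)‖
      ≤ (t - τ) ^ (γ - 1) * (C * b τ) := mul_le_mul_of_nonneg_left ((hC _ _).trans
        (mul_le_mul_of_nonneg_left (hhb τ ⟨hτ.1.le, hτ.2⟩) hC0)) h1
    _ = _ := by ring

lemma duhamel_sub (h0 : 0 < γ) (hS : Continuous fun p : ℝ × X => S p.1 p.2) {t : ℝ} (ht : 0 ≤ t)
    {h h' : ℝ → X} (hh : ContinuousOn h (Set.Icc 0 t)) (hh' : ContinuousOn h' (Set.Icc 0 t)) :
    duhamel γ S h t - duhamel γ S h' t = duhamel γ S (fun τ => h τ - h' τ) t := by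
  rw [duhamel, duhamel, duhamel, ← intervalIntegral.integral_sub
    (intervalIntegrable_sub_rpow_smul h0 hS ht hh)
    (intervalIntegrable_sub_rpow_smul h0 hS ht hh')]
  simp only [map_sub, smul_sub]

lemma duhamel_congr {t : ℝ} {h h' : ℝ → X} (ht : 0 ≤ t) (hh : ∀ τ ∈ Set.Icc 0 t, h τ = h' τ) :
    duhamel γ S h t = duhamel γ S h' t := by
  refine intervalIntegral.integral_congr fun τ hτ => ?_
  rw [Set.uIcc_of_le ht] at hτ
  simp only [hh τ hτ]

lemma duhamel_zero (h : ℝ → X) : duhamel γ S h 0 = 0 := intervalIntegral.integral_same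

/-- The substitution τ = t - tσ fixes the interval and the singularity, so that dominated
convergence gives continuity in t. -/
lemma duhamel_eq_rpow_smul {t : ℝ} (h0 : 0 < γ) (ht : 0 ≤ t) (h : ℝ → X) :
    duhamel γ S h t
      = t ^ γ • ∫ σ in (0 : ℝ)..1, σ ^ (γ - 1) • S (t * σ) (h (t - t * σ)) := by
  rcases ht.eq_or_lt with rfl | ht
  · rw [duhamel_zero, Real.zero_rpow h0.ne', zero_smul]
  have e1 : duhamel γ S h t = ∫ r in (0 : ℝ)..t, r ^ (γ - 1) • S r (h (t - r)) := by
    have := intervalIntegral.integral_comp_sub_left (a := 0) (b := t)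
      (fun r => r ^ (γ - 1) • S r (h (t - r))) t
    simp only [sub_sub_cancel, sub_self, sub_zero] at this
    exact this
  have e2 := intervalIntegral.smul_integral_comp_mul_left (a := 0) (b := 1)
    (fun r => r ^ (γ - 1) • S r (h (t - r))) t
  rw [mul_zero, mul_one] at e2
  rw [e1, ← e2, ← intervalIntegral.integral_smul, ← intervalIntegral.integral_smul]
  refine intervalIntegral.integral_congr fun σ hσ => ?_
  rw [Set.uIcc_of_le zero_le_one] at hσ
  simp only [smul_smul]
  rw [Real.mul_rpow ht.le hσ.1, ← mul_assoc]
  congr 2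
  nth_rewrite 1 [← Real.rpow_one t]
  rw [← Real.rpow_add ht]
  ring_nf

lemma continuousOn_duhamel (h0 : 0 < γ) (hS : Continuous fun p : ℝ × X => S p.1 p.2)
    (hC : ∀ t x, ‖S t x‖ ≤ C * ‖x‖) (hC0 : 0 ≤ C) {T : ℝ} (hT : 0 ≤ T) {h : ℝ → X}
    (hh : ContinuousOn h (Set.Icc 0 T)) : ContinuousOn (duhamel γ S h) (Set.Icc 0 T) := by
  obtain ⟨M, hM⟩ := isCompact_Icc.exists_bound_of_continuousOn hh
  -- h is extended by its end values, so that the integrand is defined and bounded for all t and not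
  -- only on [0,T].
  set g : ℝ → X := Set.IccExtend hT ((Set.Icc 0 T).domRestrict h) with hg
  have hgc : Continuous g := (continuousOn_iff_continuous_domRestrict.1 hh).Icc_extend'
  have hgM : ∀ t, ‖g t‖ ≤ M := fun t => hM _ (Set.projIcc 0 T hT t).2
  have hgh : ∀ t ∈ Set.Icc 0 T, g t = h t := fun t ht => Set.IccExtend_of_mem hT _ ht
  have hM0 : 0 ≤ M := (norm_nonneg _).trans (hgM 0)
  have hc : Continuous fun t : ℝ => ∫ σ in (0 : ℝ)..1, σ ^ (γ - 1) • S (t * σ) (g (t - t * σ)) := by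
    refine intervalIntegral.continuous_of_dominated_interval
      (bound := fun σ => σ ^ (γ - 1) * (C * M)) (fun t => ?_) (fun t => ?_) ?_ ?_
    · refine AEStronglyMeasurable.smul
        (by exact (measurable_id.pow_const (γ - 1)).aestronglyMeasurable) ?_
      have : Continuous fun σ : ℝ => S (t * σ) (g (t - t * σ)) :=
        hS.comp (Continuous.prodMk (by fun_prop) (hgc.comp (by fun_prop)))
      exact this.aestronglyMeasurable
    · refine Eventually.of_forall fun σ hσ => ?_
      rw [Set.uIoc_of_le zero_le_one] at hσ
      rw [norm_smul, Real.norm_of_nonneg (Real.rpow_nonneg hσ.1.le _)]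
      exact mul_le_mul_of_nonneg_left ((hC _ _).trans (mul_le_mul_of_nonneg_left (hgM _) hC0))
        (Real.rpow_nonneg hσ.1.le _)
    · exact (intervalIntegral.intervalIntegrable_rpow' (by linarith)).mul_const _
    · refine Eventually.of_forall fun σ hσ => ?_
      have : Continuous fun t : ℝ => S (t * σ) (g (t - t * σ)) :=
        hS.comp (Continuous.prodMk (by fun_prop) (hgc.comp (by fun_prop)))
      exact this.const_smul (σ ^ (γ - 1))
  refine (((Real.continuous_rpow_const h0.le).smul hc).continuousOn (s := Set.Icc 0 T)).congr
    fun t ht => ?_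
  refine Eq.trans ?_ (duhamel_eq_rpow_smul h0 ht.1 g)
  exact duhamel_congr ht.1 fun τ hτ => (hgh τ ⟨hτ.1, hτ.2.trans ht.2⟩).symm

/-- In the weight e^{lt} the singular convolution has norm at most Γ(γ) l^{-γ}, which is small for
large l. Both the uniqueness and the contraction argument use this. -/
lemma integral_sub_rpow_mul_exp_le (h0 : 0 < γ) {l t : ℝ} (hl : 0 < l) (ht : 0 ≤ t) :
    ∫ τ in (0 : ℝ)..t, (t - τ) ^ (γ - 1) * Real.exp (l * τ)
      ≤ Real.exp (l * t) * ((1 / l) ^ γ * Real.Gamma γ) := by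
  have e : ∫ τ in (0 : ℝ)..t, (t - τ) ^ (γ - 1) * Real.exp (l * τ)
      = Real.exp (l * t) * ∫ r in (0 : ℝ)..t, r ^ (γ - 1) * Real.exp (-(l * r)) := by
    have := intervalIntegral.integral_comp_sub_left (a := 0) (b := t)
      (fun r => r ^ (γ - 1) * Real.exp (-(l * r))) t
    simp only [sub_self, sub_zero] at this
    rw [← this, ← intervalIntegral.integral_const_mul]
    refine intervalIntegral.integral_congr fun τ _ => ?_
    have : Real.exp (l * τ) = Real.exp (l * t) * Real.exp (-(l * (t - τ))) := by
      rw [← Real.exp_add]; ring_nf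
    simp only [this]; ring
  rw [e, ← Real.integral_rpow_mul_exp_neg_mul_Ioi h0 hl]
  refine mul_le_mul_of_nonneg_left ?_ (Real.exp_pos _).le
  rw [intervalIntegral.integral_of_le ht]
  have hi : IntegrableOn (fun r : ℝ => r ^ (γ - 1) * Real.exp (-(l * r))) (Set.Ioi 0) := by
    have := integrableOn_rpow_mul_exp_neg_mul_rpow (s := γ - 1) (p := 1) (b := l) (by linarith)
      one_pos hl
    simpa using this
  refine setIntegral_mono_set hi ?_ (Set.Ioc_subset_Ioi_self.eventuallyLE)
  filter_upwards [ae_restrict_mem measurableSet_Ioi] with r hr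
  exact mul_nonneg (Real.rpow_nonneg (le_of_lt hr) _) (Real.exp_pos _).le

lemma exists_exp_rate (h0 : 0 < γ) (K : ℝ) :
    ∃ l : ℝ, 0 < l ∧ K * ((1 / l) ^ γ * Real.Gamma γ) ≤ 1 / 2 := by
  have h : Tendsto (fun l : ℝ => K * ((1 / l) ^ γ * Real.Gamma γ)) atTop (𝓝 0) := by
    have := ((tendsto_rpow_neg_atTop h0).mul_const (Real.Gamma γ)).const_mul K
    simp only [zero_mul, mul_zero] at this
    refine this.congr' ?_
    filter_upwards [eventually_ge_atTop 0] with l hl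
    rw [one_div, Real.inv_rpow hl, Real.rpow_neg hl]
  obtain ⟨l, hl, hl0⟩ := ((h.eventually (gt_mem_nhds (by norm_num : (0 : ℝ) < 1 / 2))).and
    (eventually_gt_atTop 0)).exists
  exact ⟨l, hl0, hl.le⟩

/-- A Gronwall inequality with weakly singular kernel. -/
lemma eq_zero_of_le_integral_sub_rpow_mul (h0 : 0 < γ) {T K : ℝ} (hK : 0 ≤ K) {d : ℝ → ℝ}
    (hd : ContinuousOn d (Set.Icc 0 T)) (hd0 : ∀ t ∈ Set.Icc 0 T, 0 ≤ d t)
    (h : ∀ t ∈ Set.Icc 0 T, d t ≤ K * ∫ τ in (0 : ℝ)..t, (t - τ) ^ (γ - 1) * d τ) :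
    ∀ t ∈ Set.Icc 0 T, d t = 0 := by
  intro t ht
  -- With this rate the maximum m of e^{-lt} d(t) satisfies m ≤ m/2.
  obtain ⟨l, hl, hlK⟩ := exists_exp_rate h0 K
  have hc : ContinuousOn (fun s => Real.exp (-(l * s)) * d s) (Set.Icc 0 T) :=
    ContinuousOn.mul (by fun_prop) hd
  obtain ⟨s, hs, hmax⟩ := isCompact_Icc.exists_isMaxOn ⟨t, ht⟩ hc
  set m := Real.exp (-(l * s)) * d s with hm
  have hle : ∀ τ ∈ Set.Icc 0 T, d τ ≤ m * Real.exp (l * τ) := fun τ hτ => by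
    have h1 : Real.exp (-(l * τ)) * d τ ≤ m := hmax hτ
    calc d τ = Real.exp (-(l * τ)) * d τ * Real.exp (l * τ) := by
          rw [mul_right_comm, ← Real.exp_add]; simp
      _ ≤ _ := mul_le_mul_of_nonneg_right h1 (Real.exp_pos _).le
  have hm0 : 0 ≤ m := mul_nonneg (Real.exp_pos _).le (hd0 s hs)
  have h1 : d s ≤ m * Real.exp (l * s) * (1 / 2) := by
    calc d s ≤ K * ∫ τ in (0 : ℝ)..s, (s - τ) ^ (γ - 1) * d τ := h s hs
      _ ≤ K * ∫ τ in (0 : ℝ)..s, m * ((s - τ) ^ (γ - 1) * Real.exp (l * τ)) := by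
          refine mul_le_mul_of_nonneg_left (intervalIntegral.integral_mono_on hs.1
            (intervalIntegrable_sub_rpow_mul h0 hs.1 (hd.mono (Set.Icc_subset_Icc_right hs.2)))
            ((intervalIntegrable_sub_rpow_mul h0 hs.1 (by fun_prop)).const_mul m) fun τ hτ => ?_) hK
          have := mul_le_mul_of_nonneg_left (hle τ ⟨hτ.1, hτ.2.trans hs.2⟩)
            (Real.rpow_nonneg (by linarith [hτ.2] : 0 ≤ s - τ) (γ - 1))
          linarith
      _ ≤ K * (m * (Real.exp (l * s) * ((1 / l) ^ γ * Real.Gamma γ))) := by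
          rw [intervalIntegral.integral_const_mul]
          exact mul_le_mul_of_nonneg_left (mul_le_mul_of_nonneg_left
            (integral_sub_rpow_mul_exp_le h0 hl hs.1) hm0) hK
      _ = m * Real.exp (l * s) * (K * ((1 / l) ^ γ * Real.Gamma γ)) := by ring
      _ ≤ _ := mul_le_mul_of_nonneg_left hlK (mul_nonneg hm0 (Real.exp_pos _).le)
  have h2 : m ≤ m * (1 / 2) := by
    calc m ≤ Real.exp (-(l * s)) * (m * Real.exp (l * s) * (1 / 2)) :=
          mul_le_mul_of_nonneg_left h1 (Real.exp_pos _).le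
      _ = m * (1 / 2) * (Real.exp (-(l * s)) * Real.exp (l * s)) := by ring
      _ = m * (1 / 2) := by rw [← Real.exp_add]; simp
  have h3 : m = 0 := by linarith
  exact le_antisymm (by simpa [h3] using hle t ht) (hd0 t ht)

/-- `u` solves the Volterra equation `u = G + duhamel (F ∘ u)` on `[0, T]`. -/
structure IsVolterraSol (γ : ℝ) (S : ℝ → X →L[ℝ] X) (G : ℝ → X) (F : X → X) (T : ℝ) (u : ℝ → X) :
    Prop where
  cont : ContinuousOn u (Set.Icc 0 T)
  eq : ∀ t ∈ Set.Icc 0 T, u t = G t + duhamel γ S (fun τ => F (u τ)) t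

lemma IsVolterraSol.mono {G : ℝ → X} {F : X → X} {T T' : ℝ} {u : ℝ → X}
    (hu : IsVolterraSol γ S G F T u) (h : T' ≤ T) : IsVolterraSol γ S G F T' u :=
  ⟨hu.cont.mono (Set.Icc_subset_Icc_right h), fun t ht => hu.eq t ⟨ht.1, ht.2.trans h⟩⟩

lemma IsVolterraSol.congr {G : ℝ → X} {F F' : X → X} {T : ℝ} {u u' : ℝ → X}
    (hu : IsVolterraSol γ S G F T u) (h : ∀ t ∈ Set.Icc 0 T, u' t = u t)
    (hF : ∀ t ∈ Set.Icc 0 T, F' (u t) = F (u t)) : IsVolterraSol γ S G F' T u' := by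
  refine ⟨hu.cont.congr h, fun t ht => ?_⟩
  rw [h t ht, hu.eq t ht]
  congr 1
  refine duhamel_congr ht.1 fun τ hτ => ?_
  have hτ' : τ ∈ Set.Icc 0 T := ⟨hτ.1, hτ.2.trans ht.2⟩
  rw [h τ hτ', hF τ hτ']

lemma IsVolterraSol.eqOn_of_lipschitz (h0 : 0 < γ) (hS : Continuous fun p : ℝ × X => S p.1 p.2)
    (hC : ∀ t x, ‖S t x‖ ≤ C * ‖x‖) (hC0 : 0 ≤ C) {G : ℝ → X} {F : X → X} {L : NNReal}
    (hF : LipschitzWith L F) {T : ℝ} {u u' : ℝ → X} (hu : IsVolterraSol γ S G F T u)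
    (hu' : IsVolterraSol γ S G F T u') : ∀ t ∈ Set.Icc 0 T, u t = u' t := by
  have hcd : ContinuousOn (fun t => ‖u t - u' t‖) (Set.Icc 0 T) := (hu.cont.sub hu'.cont).norm
  have key := eq_zero_of_le_integral_sub_rpow_mul h0 (K := C * L) (mul_nonneg hC0 L.2) hcd
    (fun _ _ => norm_nonneg _) fun t ht => ?_
  · exact fun t ht => sub_eq_zero.1 (norm_eq_zero.1 (key t ht))
  · have hsub : Set.Icc 0 t ⊆ Set.Icc 0 T := Set.Icc_subset_Icc_right ht.2
    rw [hu.eq t ht, hu'.eq t ht, add_sub_add_left_eq_sub,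
      duhamel_sub h0 hS ht.1 (h := fun τ => F (u τ)) (h' := fun τ => F (u' τ))
        (hF.continuous.comp_continuousOn (hu.cont.mono hsub))
        (hF.continuous.comp_continuousOn (hu'.cont.mono hsub))]
    refine (norm_duhamel_le h0 hC hC0 ht.1 (b := fun τ => L * ‖u τ - u' τ‖)
      (continuousOn_const.mul (hcd.mono hsub)) fun τ _ => ?_).trans_eq ?_
    · rw [← dist_eq_norm, ← dist_eq_norm]
      exact hF.dist_le_mul _ _
    · rw [mul_assoc, ← intervalIntegral.integral_const_mul (L : ℝ)]
      congr 2
      ext τ; ring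

end

/-! ### Existence, continuation and maximal solutions of Volterra equations -/

section

open Filter Topology MeasureTheory

variable {X : Type*} [NormedAddCommGroup X] [NormedSpace ℝ X] {γ C : ℝ} {S : ℝ → X →L[ℝ] X}
  {G : ℝ → X} {F : X → X}

/-- Banach's fixed point theorem in an exponentially weighted sup norm, which gives a contraction on
an interval of any length. The solution is returned continuous on all of ℝ, as the continuation
argument needs. -/
lemma exists_isVolterraSol_of_lipschitz [CompleteSpace X] (h0 : 0 < γ)
    (hS : Continuous fun p : ℝ × X => S p.1 p.2)
    (hC : ∀ t x, ‖S t x‖ ≤ C * ‖x‖) (hC0 : 0 ≤ C) (hG : Continuous G) {L : NNReal}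
    (hF : LipschitzWith L F) {T : ℝ} (hT : 0 ≤ T) :
    ∃ u : ℝ → X, Continuous u ∧ IsVolterraSol γ S G F T u := by
  obtain ⟨l, hl, hlK⟩ := exists_exp_rate h0 (C * L)
  -- The weight is put into the unknown, u(t) = e^{lt} U(t), so that the ordinary sup metric on
  -- C([0,T], X) can be used.
  let E : C(Set.Icc 0 T, X) → ℝ → X := fun U t => Real.exp (l * t) • Set.IccExtend hT U t
  have hE : ∀ U, Continuous (E U) := fun U =>
    (by fun_prop : Continuous fun t : ℝ => Real.exp (l * t)).smul U.continuous.Icc_extend'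
  have hFE : ∀ U, Continuous fun τ => F (E U τ) := fun U => hF.continuous.comp (hE U)
  have hcont : ∀ U : C(Set.Icc 0 T, X), ContinuousOn
      (fun t => Real.exp (-(l * t)) • (G t + duhamel γ S (fun τ => F (E U τ)) t)) (Set.Icc 0 T) :=
    fun U => ContinuousOn.smul (by fun_prop)
      (hG.continuousOn.add (continuousOn_duhamel h0 hS hC hC0 hT (hFE U).continuousOn))
  let Ψ : C(Set.Icc 0 T, X) → C(Set.Icc 0 T, X) := fun U =>
    ⟨_, continuousOn_iff_continuous_domRestrict.1 (hcont U)⟩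
  have hΨ : ∀ U (t : Set.Icc 0 T), Ψ U t
      = Real.exp (-(l * (t : ℝ))) • (G t + duhamel γ S (fun τ => F (E U τ)) t) := fun U t => rfl
  have hlip : LipschitzWith (1 / 2) Ψ := by
    refine LipschitzWith.of_dist_le_mul fun U V => ?_
    rw [ContinuousMap.dist_le (by positivity)]
    intro t
    have ht := t.2
    have hb : ∀ τ ∈ Set.Icc 0 (t : ℝ), ‖F (E U τ) - F (E V τ)‖
        ≤ L * (dist U V * Real.exp (l * τ)) := fun τ _ => by
      rw [← dist_eq_norm]
      refine (hF.dist_le_mul _ _).trans (mul_le_mul_of_nonneg_left ?_ L.2)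
      rw [dist_eq_norm, ← smul_sub, norm_smul, Real.norm_of_nonneg (Real.exp_pos _).le, mul_comm,
        ← dist_eq_norm]
      exact mul_le_mul_of_nonneg_right (ContinuousMap.dist_apply_le_dist _) (Real.exp_pos _).le
    rw [hΨ, hΨ, dist_eq_norm, ← smul_sub, add_sub_add_left_eq_sub,
      duhamel_sub h0 hS ht.1 (hFE U).continuousOn (hFE V).continuousOn, norm_smul,
      Real.norm_of_nonneg (Real.exp_pos _).le]
    have h1 := norm_duhamel_le h0 hC hC0 ht.1 (h := fun τ => F (E U τ) - F (E V τ))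
      (b := fun τ => L * (dist U V * Real.exp (l * τ))) (by fun_prop) hb
    have h2 : ∫ τ in (0 : ℝ)..t, ((t : ℝ) - τ) ^ (γ - 1) * (L * (dist U V * Real.exp (l * τ)))
        = L * dist U V * ∫ τ in (0 : ℝ)..t, ((t : ℝ) - τ) ^ (γ - 1) * Real.exp (l * τ) := by
      rw [← intervalIntegral.integral_const_mul]
      congr 1
      ext τ; ring
    rw [h2] at h1
    have h3 := integral_sub_rpow_mul_exp_le h0 hl ht.1
    have hd : (0 : ℝ) ≤ dist U V := dist_nonneg
    calc Real.exp (-(l * (t : ℝ))) * ‖duhamel γ S (fun τ => F (E U τ) - F (E V τ)) t‖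
        ≤ Real.exp (-(l * (t : ℝ))) * (C * (L * dist U V *
          (Real.exp (l * t) * ((1 / l) ^ γ * Real.Gamma γ)))) := by
          refine mul_le_mul_of_nonneg_left (h1.trans ?_) (Real.exp_pos _).le
          exact mul_le_mul_of_nonneg_left (mul_le_mul_of_nonneg_left h3
            (mul_nonneg L.2 hd)) hC0
      _ = C * L * ((1 / l) ^ γ * Real.Gamma γ) * dist U V
          * (Real.exp (-(l * (t : ℝ))) * Real.exp (l * t)) := by ring
      _ = C * L * ((1 / l) ^ γ * Real.Gamma γ) * dist U V := by rw [← Real.exp_add]; simp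
      _ ≤ 1 / 2 * dist U V := mul_le_mul_of_nonneg_right hlK hd
      _ = _ := by norm_num
  have hcw : ContractingWith (1 / 2) Ψ := ⟨by norm_num, hlip⟩
  obtain ⟨W, hW⟩ : ∃ W, Ψ W = W := ⟨_, hcw.fixedPoint_isFixedPt⟩
  refine ⟨E W, hE _, (hE _).continuousOn, fun t ht => ?_⟩
  have hfix : Ψ W ⟨t, ht⟩ = W ⟨t, ht⟩ := by rw [hW]
  rw [hΨ] at hfix
  have e : E W t = Real.exp (l * t) • W ⟨t, ht⟩ := by
    simp only [E, Set.IccExtend_of_mem hT _ ht]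
  rw [e, ← hfix, smul_smul, ← Real.exp_add, add_neg_cancel, Real.exp_zero, one_smul]

/-- On every ball `F` agrees with a globally Lipschitz map. -/
def HasLipschitzTruncations {Y : Type*} [NormedAddCommGroup Y] (F : Y → Y) : Prop :=
  ∀ R : ℝ, ∃ (L : NNReal) (F' : Y → Y), LipschitzWith L F' ∧ ∀ x, ‖x‖ ≤ R → F' x = F x

lemma HasLipschitzTruncations.continuous {Y : Type*} [NormedAddCommGroup Y] {F : Y → Y}
    (hF : HasLipschitzTruncations F) : Continuous F := by
  rw [continuous_iff_continuousAt]
  intro x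
  obtain ⟨L, F', hL, hF'⟩ := hF (‖x‖ + 1)
  refine hL.continuous.continuousAt.congr ?_
  filter_upwards [Metric.ball_mem_nhds x one_pos] with y hy
  refine hF' y ?_
  have := norm_sub_norm_le y x
  rw [mem_ball_iff_norm] at hy
  linarith

/-- Both solutions are bounded on the compact interval, so they solve one common truncated, globally
Lipschitz equation. -/
lemma IsVolterraSol.eqOn (h0 : 0 < γ) (hS : Continuous fun p : ℝ × X => S p.1 p.2)
    (hC : ∀ t x, ‖S t x‖ ≤ C * ‖x‖) (hC0 : 0 ≤ C) (hF : HasLipschitzTruncations F) {T : ℝ}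
    {u u' : ℝ → X} (hu : IsVolterraSol γ S G F T u) (hu' : IsVolterraSol γ S G F T u') :
    ∀ t ∈ Set.Icc 0 T, u t = u' t := by
  obtain ⟨R, hR⟩ := isCompact_Icc.exists_bound_of_continuousOn hu.cont
  obtain ⟨R', hR'⟩ := isCompact_Icc.exists_bound_of_continuousOn hu'.cont
  obtain ⟨L, F', hL, hF'⟩ := hF (max R R')
  exact (hu.congr (fun _ _ => rfl) fun t ht => hF' _ ((hR t ht).trans (le_max_left _ _))).eqOn_of_lipschitz
    h0 hS hC hC0 hL
    (hu'.congr (fun _ _ => rfl) fun t ht => hF' _ ((hR' t ht).trans (le_max_right _ _)))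

/-- Continuation of a solution that stays bounded. -/
lemma exists_isVolterraSol_extension [CompleteSpace X] (h0 : 0 < γ)
    (hS : Continuous fun p : ℝ × X => S p.1 p.2)
    (hC : ∀ t x, ‖S t x‖ ≤ C * ‖x‖) (hC0 : 0 ≤ C) (hG : Continuous G)
    (hF : HasLipschitzTruncations F) {T R : ℝ} (hT : 0 ≤ T) {u : ℝ → X}
    (hu : ∀ T', 0 ≤ T' → T' < T → IsVolterraSol γ S G F T' u)
    (hR : ∀ t, 0 ≤ t → t < T → ‖u t‖ ≤ R) :
    ∃ T' u', T < T' ∧ IsVolterraSol γ S G F T' u' := by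
  -- Solve the truncated equation on [0,T+1]. Its solution agrees with u before T, so its norm at T
  -- is at most max R ‖G 0‖, and the spare 1 in the radius keeps the truncation inactive slightly
  -- beyond T. The term ‖G 0‖ covers T = 0.
  obtain ⟨L, F', hL, hF'⟩ := hF (max R ‖G 0‖ + 1)
  obtain ⟨w, hwc, hw⟩ := exists_isVolterraSol_of_lipschitz h0 hS hC hC0 hG hL
    (by linarith : (0 : ℝ) ≤ T + 1)
  have hwu : ∀ t, 0 ≤ t → t < T → w t = u t := fun t ht0 htT =>
    (hw.mono (by linarith)).eqOn_of_lipschitz h0 hS hC hC0 hL ((hu t ht0 htT).congr (fun _ _ => rfl)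
      fun s hs => hF' _ (by
        have := hR s hs.1 (hs.2.trans_lt htT)
        linarith [le_max_left R ‖G 0‖])) t ⟨ht0, le_rfl⟩
  have hwT : ‖w T‖ ≤ max R ‖G 0‖ := by
    rcases hT.eq_or_lt with rfl | hT
    · have := hw.eq 0 ⟨le_rfl, by linarith⟩
      rw [this, duhamel_zero, add_zero]
      exact le_max_right _ _
    · refine le_of_tendsto (hwc.norm.continuousAt.tendsto.mono_left
        (nhdsWithin_le_nhds (s := Set.Iio T))) ?_
      filter_upwards [Ioo_mem_nhdsLT hT] with t ht
      rw [hwu t ht.1.le ht.2]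
      exact (hR t ht.1.le ht.2).trans (le_max_left _ _)
  have hev : ∀ᶠ t in 𝓝 T, ‖w t‖ < max R ‖G 0‖ + 1 :=
    hwc.norm.continuousAt.eventually (gt_mem_nhds (by linarith))
  obtain ⟨ε, hε, hball⟩ := Metric.eventually_nhds_iff.1 hev
  refine ⟨T + min 1 (ε / 2), w, by have : 0 < min 1 (ε / 2) := by positivity
                                   linarith, ?_⟩
  refine (hw.mono (by linarith [min_le_left 1 (ε / 2)])).congr (fun _ _ => rfl) fun t ht =>
    (hF' _ ?_).symm
  rcases lt_or_ge t T with h | h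
  · rw [hwu t ht.1 h]
    linarith [hR t ht.1 h, le_max_left R ‖G 0‖]
  · refine (hball ?_).le
    rw [Real.dist_eq, abs_of_nonneg (by linarith)]
    linarith [ht.2, min_le_right 1 (ε / 2)]

/-- If the existence times are bounded then there is a maximal solution. -/
lemma exists_maximal_isVolterraSol [CompleteSpace X] (h0 : 0 < γ)
    (hS : Continuous fun p : ℝ × X => S p.1 p.2)
    (hC : ∀ t x, ‖S t x‖ ≤ C * ‖x‖) (hC0 : 0 ≤ C) (hG : Continuous G)
    (hF : HasLipschitzTruncations F) {B : ℝ}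
    (hB : ∀ T u, 0 < T → IsVolterraSol γ S G F T u → T ≤ B) :
    ∃ T u, 0 < T ∧ T ≤ B ∧ (∀ T', T' < T → IsVolterraSol γ S G F T' u) ∧
      ∀ T' u', 0 < T' → IsVolterraSol γ S G F T' u' → T' < T ∧ ∀ t ∈ Set.Icc 0 T', u' t = u t := by
  set A : Set ℝ := {T | 0 < T ∧ ∃ u, IsVolterraSol γ S G F T u} with hA
  have hbdd : BddAbove A := ⟨B, fun T hT => hB T _ hT.1 hT.2.choose_spec⟩
  -- Continuation from T = 0, where the hypotheses are vacuous, is local existence.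
  obtain ⟨T₁, u₁, hT₁, hu₁⟩ := exists_isVolterraSol_extension h0 hS hC hC0 hG hF (T := 0) (R := 0)
    (u := G) le_rfl (fun T' h h' => absurd h (not_le.2 h')) (fun T' h h' => absurd h (not_le.2 h'))
  have hne : A.Nonempty := ⟨T₁, hT₁, u₁, hu₁⟩
  set T := sSup A with hTdef
  have hTpos : 0 < T := hT₁.trans_le (le_csSup hbdd ⟨hT₁, u₁, hu₁⟩)
  have hex : ∀ T' < T, ∃ u, IsVolterraSol γ S G F T' u := fun T' h => by
    obtain ⟨T'', ⟨_, u, hu⟩, h''⟩ := exists_lt_of_lt_csSup hne h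
    exact ⟨u, hu.mono h''.le⟩
  choose! sol hsol using hex
  -- The glued solution takes at time t the value of the solution chosen for the interval ending at
  -- (t+T)/2, a time strictly between t and T. By uniqueness the choice does not matter.
  have hmid : ∀ t < T, t < (t + T) / 2 ∧ (t + T) / 2 < T := fun t ht => ⟨by linarith, by linarith⟩
  have huni : ∀ T' u', IsVolterraSol γ S G F T' u' → T' < T → ∀ t ∈ Set.Icc 0 T',
      u' t = sol ((t + T) / 2) t := fun T' u' hu' hT' t ht =>
    (hu'.mono ht.2).eqOn h0 hS hC hC0 hF ((hsol _ (hmid t (ht.2.trans_lt hT')).2).mono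
      (hmid t (ht.2.trans_lt hT')).1.le) t ⟨ht.1, le_rfl⟩
  have hmild : ∀ T' < T, IsVolterraSol γ S G F T' fun t => sol ((t + T) / 2) t := fun T' hT' =>
    (hsol T' hT').congr (fun t ht => (huni T' _ (hsol T' hT') hT' t ht).symm) fun _ _ => rfl
  refine ⟨T, fun t => sol ((t + T) / 2) t, hTpos, csSup_le hne fun T hT => hB T _ hT.1 hT.2.choose_spec,
    hmild, fun T' u' hT' hu' => ?_⟩
  have hlt : T' < T := by
    obtain ⟨R, hR⟩ := isCompact_Icc.exists_bound_of_continuousOn hu'.cont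
    obtain ⟨T'', u'', hT'', hu''⟩ := exists_isVolterraSol_extension h0 hS hC hC0 hG hF hT'.le
      (fun t _ ht => hu'.mono ht.le) fun t ht ht' => hR t ⟨ht, ht'.le⟩
    exact hT''.trans_le (le_csSup hbdd ⟨hT'.trans hT'', u'', hu''⟩)
  exact ⟨hlt, huni T' u' hu' hlt⟩

end

/-! ### Power nonlinearities on C₀ and mild solutions as Volterra solutions -/

section

open Filter Topology MeasureTheory

variable {N : ℕ}

/-- The superposition operator `w ↦ f ∘ w` on `C₀`. -/
def superpose {f : ℝ → ℝ} (hf : Continuous f) (hf0 : f 0 = 0) (w : C₀(Sp N, ℝ)) : C₀(Sp N, ℝ) where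
  toFun x := f (w x)
  continuous_toFun := hf.comp w.continuous
  zero_at_infty' := by
    have h := (hf.tendsto 0).comp (zero_at_infty w)
    rwa [hf0] at h

lemma superpose_apply {f : ℝ → ℝ} (hf : Continuous f) (hf0 : f 0 = 0) (w : C₀(Sp N, ℝ)) (x : Sp N) :
    superpose hf hf0 w x = f (w x) := rfl

lemma lipschitzWith_superpose {f : ℝ → ℝ} (hf : Continuous f) (hf0 : f 0 = 0) {L : NNReal}
    (hL : LipschitzWith L f) : LipschitzWith L (superpose (N := N) hf hf0) := by
  refine LipschitzWith.of_dist_le_mul fun w w' => ?_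
  rw [dist_eq_norm, dist_eq_norm]
  refine norm_le_of_forall_abs_le (by positivity) fun x => ?_
  have h := hL.dist_le_mul (w x) (w' x)
  rw [Real.dist_eq, Real.dist_eq] at h
  exact h.trans (mul_le_mul_of_nonneg_left (abs_apply_le_norm (w - w') x) L.2)

lemma continuous_abs_rpow {r : ℝ} (hr : 0 < r) : Continuous fun s : ℝ => |s| ^ r :=
  continuous_abs.rpow_const fun _ => Or.inr hr.le

lemma abs_rpow_zero {r : ℝ} (hr : 0 < r) : |(0 : ℝ)| ^ r = 0 := by
  rw [abs_zero, Real.zero_rpow hr.ne']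

/-- The map `w ↦ |w| ^ r` on `C₀`. -/
def absRpow (N : ℕ) {r : ℝ} (hr : 0 < r) : C₀(Sp N, ℝ) → C₀(Sp N, ℝ) :=
  superpose (continuous_abs_rpow hr) (abs_rpow_zero hr)

lemma absRpow_apply {r : ℝ} (hr : 0 < r) (w : C₀(Sp N, ℝ)) (x : Sp N) :
    absRpow N hr w x = |w x| ^ r := rfl

lemma absRpow_nonneg {r : ℝ} (hr : 0 < r) (w : C₀(Sp N, ℝ)) (x : Sp N) : 0 ≤ absRpow N hr w x :=
  Real.rpow_nonneg (abs_nonneg _) _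

/-- Capping |s| at R keeps the derivative r s^{r-1} at most r R^{r-1}, and changes nothing for |s| ≤
R. -/
lemma lipschitzWith_min_abs_rpow {r : ℝ} (hr : 1 ≤ r) {R : ℝ} (hR : 0 ≤ R) :
    LipschitzWith (r * R ^ (r - 1)).toNNReal fun s : ℝ => (min |s| R) ^ r := by
  have hc : 0 ≤ r * R ^ (r - 1) := mul_nonneg (by linarith) (Real.rpow_nonneg hR _)
  have h1 : LipschitzOnWith (r * R ^ (r - 1)).toNNReal (fun s : ℝ => s ^ r) (Set.Icc 0 R) := by
    refine (convex_Icc 0 R).lipschitzOnWith_of_nnnorm_hasDerivWithin_le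
      (f' := fun s => r * s ^ (r - 1))
      (fun s _ => (Real.hasDerivAt_rpow_const (Or.inr hr)).hasDerivWithinAt) fun s hs => ?_
    rw [← NNReal.coe_le_coe, coe_nnnorm, Real.coe_toNNReal _ hc,
      Real.norm_of_nonneg (mul_nonneg (by linarith) (Real.rpow_nonneg hs.1 _))]
    exact mul_le_mul_of_nonneg_left (Real.rpow_le_rpow hs.1 hs.2 (by linarith)) (by linarith)
  have h2 : LipschitzWith 1 fun s : ℝ => min |s| R :=
    LipschitzWith.min_const (lipschitzWith_one_norm (E := ℝ)) R
  have h3 := h1.comp (h2.lipschitzOnWith (s := Set.univ)) fun s _ =>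
    ⟨le_min (abs_nonneg s) hR, min_le_right _ _⟩
  rw [mul_one] at h3
  exact lipschitzOnWith_univ.1 h3

lemma exists_lipschitzWith_eq_absRpow {r : ℝ} (hr : 1 < r) (R : ℝ) :
    ∃ (L : NNReal) (f : C₀(Sp N, ℝ) → C₀(Sp N, ℝ)), LipschitzWith L f ∧
      ∀ w, ‖w‖ ≤ R → f w = absRpow N (one_pos.trans hr) w := by
  have hL := lipschitzWith_min_abs_rpow hr.le (le_max_right R 0)
  have h0 : (min |(0 : ℝ)| (max R 0)) ^ r = 0 := by
    rw [abs_zero, min_eq_left (le_max_right R 0), Real.zero_rpow (by linarith)]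
  refine ⟨_, superpose hL.continuous h0, lipschitzWith_superpose _ _ hL, fun w hw => ?_⟩
  ext x
  rw [superpose_apply, absRpow_apply,
    min_eq_left ((abs_apply_le_norm w x).trans (hw.trans (le_max_left _ _)))]

/-- The nonlinearity `(u, v) ↦ (|v| ^ p, |u| ^ q)`. -/
def crossPower (N : ℕ) {p q : ℝ} (hp : 0 < p) (hq : 0 < q) (U : C₀(Sp N, ℝ) × C₀(Sp N, ℝ)) :
    C₀(Sp N, ℝ) × C₀(Sp N, ℝ) :=
  (absRpow N hp U.2, absRpow N hq U.1)

lemma hasLipschitzTruncations_crossPower {p q : ℝ} (hp : 1 < p) (hq : 1 < q) :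
    HasLipschitzTruncations (crossPower N (one_pos.trans hp) (one_pos.trans hq)) := by
  intro R
  obtain ⟨L, f, hL, hf⟩ := exists_lipschitzWith_eq_absRpow (N := N) hp R
  obtain ⟨M, g, hM, hg⟩ := exists_lipschitzWith_eq_absRpow (N := N) hq R
  refine ⟨_, fun U => (f U.2, g U.1),
    (hL.comp LipschitzWith.prod_snd).prodMk (hM.comp LipschitzWith.prod_fst), fun U hU => ?_⟩
  exact Prod.ext (hf _ ((norm_snd_le U).trans hU)) (hg _ ((norm_fst_le U).trans hU))

variable {γ : ℝ}

/-- `S_γ(t)` acting componentwise. -/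
def semS₂ (N : ℕ) (h0 : 0 < γ) (h1 : γ < 1) (t : ℝ) :
    C₀(Sp N, ℝ) × C₀(Sp N, ℝ) →L[ℝ] C₀(Sp N, ℝ) × C₀(Sp N, ℝ) :=
  (semS N h0 h1 t).prodMap (semS N h0 h1 t)

lemma semS₂_apply (h0 : 0 < γ) (h1 : γ < 1) (t : ℝ) (U : C₀(Sp N, ℝ) × C₀(Sp N, ℝ)) :
    semS₂ N h0 h1 t U = (semS N h0 h1 t U.1, semS N h0 h1 t U.2) := rfl

lemma continuous_semS₂ (h0 : 0 < γ) (h1 : γ < 1) :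
    Continuous fun P : ℝ × (C₀(Sp N, ℝ) × C₀(Sp N, ℝ)) => semS₂ N h0 h1 P.1 P.2 := by
  have ha : Continuous fun P : ℝ × (C₀(Sp N, ℝ) × C₀(Sp N, ℝ)) => (P.1, P.2.1) := by fun_prop
  have hb : Continuous fun P : ℝ × (C₀(Sp N, ℝ) × C₀(Sp N, ℝ)) => (P.1, P.2.2) := by fun_prop
  exact ((continuous_semS h0 h1).comp ha).prodMk ((continuous_semS h0 h1).comp hb)

lemma norm_semS₂_le (h0 : 0 < γ) (h1 : γ < 1) (t : ℝ) (U : C₀(Sp N, ℝ) × C₀(Sp N, ℝ)) :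
    ‖semS₂ N h0 h1 t U‖ ≤ 1 / Real.Gamma γ * ‖U‖ := by
  have hΓ := Real.Gamma_pos_of_pos h0
  rw [semS₂_apply, Prod.norm_mk]
  exact max_le ((norm_semS_le h0 h1 t _).trans (mul_le_mul_of_nonneg_left (norm_fst_le U)
    (by positivity))) ((norm_semS_le h0 h1 t _).trans (mul_le_mul_of_nonneg_left (norm_snd_le U)
    (by positivity)))

lemma duhamel_semS₂ (h0 : 0 < γ) (h1 : γ < 1) {t : ℝ} (ht : 0 ≤ t)
    {h : ℝ → C₀(Sp N, ℝ) × C₀(Sp N, ℝ)} (hh : ContinuousOn h (Set.Icc 0 t)) :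
    duhamel γ (semS₂ N h0 h1) h t = (duhamel γ (semS N h0 h1) (fun τ => (h τ).1) t,
      duhamel γ (semS N h0 h1) (fun τ => (h τ).2) t) := by
  have hi := intervalIntegrable_sub_rpow_smul (t := t) h0 (continuous_semS₂ (N := N) h0 h1) ht hh
  refine Prod.ext ?_ ?_
  · exact ((ContinuousLinearMap.fst ℝ C₀(Sp N, ℝ) C₀(Sp N, ℝ)).intervalIntegral_comp_comm hi).symm
  · exact ((ContinuousLinearMap.snd ℝ C₀(Sp N, ℝ) C₀(Sp N, ℝ)).intervalIntegral_comp_comm hi).symm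

lemma duhamel_clm {F : Type*} [NormedAddCommGroup F] [NormedSpace ℝ F] [CompleteSpace F]
    (L : C₀(Sp N, ℝ) →L[ℝ] F) (h0 : 0 < γ) (h1 : γ < 1) {t : ℝ} (ht : 0 ≤ t)
    {h : ℝ → C₀(Sp N, ℝ)} (hh : ContinuousOn h (Set.Icc 0 t)) :
    L (duhamel γ (semS N h0 h1) h t)
      = ∫ τ in (0 : ℝ)..t, (t - τ) ^ (γ - 1) • L (semS N h0 h1 (t - τ) (h τ)) := by
  rw [duhamel, ← L.intervalIntegral_comp_comm
    (intervalIntegrable_sub_rpow_smul h0 (continuous_semS h0 h1) ht hh)]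
  simp only [map_smul]

lemma duhamel_apply (h0 : 0 < γ) (h1 : γ < 1) {t : ℝ} (ht : 0 ≤ t)
    {h : ℝ → C₀(Sp N, ℝ)} (hh : ContinuousOn h (Set.Icc 0 t)) (x : Sp N) :
    duhamel γ (semS N h0 h1) h t x
      = ∫ τ in (0 : ℝ)..t, (t - τ) ^ (γ - 1) * opS N γ (t - τ) (h τ) x := by
  refine (duhamel_clm (evalAt x) h0 h1 ht hh).trans (intervalIntegral.integral_congr fun τ hτ => ?_)
  rw [Set.uIcc_of_le ht] at hτ
  simp only [evalAt_apply, smul_eq_mul]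
  rw [semS_apply h0 h1 (by linarith [hτ.2])]

/-- The free evolution `t ↦ (P_γ(t) u₀, P_γ(t) v₀)`. -/
def freeEvolution (h0 : 0 < γ) (h1 : γ < 1) (u₀ v₀ : C₀(Sp N, ℝ)) (t : ℝ) :
    C₀(Sp N, ℝ) × C₀(Sp N, ℝ) :=
  (semP N h0 h1 t u₀, semP N h0 h1 t v₀)

lemma continuous_freeEvolution (h0 : 0 < γ) (h1 : γ < 1) (u₀ v₀ : C₀(Sp N, ℝ)) :
    Continuous (freeEvolution h0 h1 u₀ v₀) := by
  have ha : ∀ w : C₀(Sp N, ℝ), Continuous fun t : ℝ => (t, w) := fun w => by fun_prop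
  exact ((continuous_semP h0 h1).comp (ha u₀)).prodMk ((continuous_semP h0 h1).comp (ha v₀))

/-- Bochner integrals in C₀ commute with evaluation at a point, so the vector equation is the family
of pointwise equations. -/
lemma isMildSolution_iff (h0 : 0 < γ) (h1 : γ < 1) {p q : ℝ} (hp : 1 < p) (hq : 1 < q)
    {u₀ v₀ : C₀(Sp N, ℝ)} {T : ℝ} {u v : ℝ → C₀(Sp N, ℝ)} :
    IsMildSolution N γ γ (fun s => |s| ^ p) (fun s => |s| ^ q) u₀ v₀ T u v ↔
      IsVolterraSol γ (semS₂ N h0 h1) (freeEvolution h0 h1 u₀ v₀)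
        (crossPower N (one_pos.trans hp) (one_pos.trans hq)) T fun t => (u t, v t) := by
  have hF := (hasLipschitzTruncations_crossPower (N := N) hp hq).continuous
  have key : ContinuousOn u (Set.Icc 0 T) → ContinuousOn v (Set.Icc 0 T) → ∀ t ∈ Set.Icc 0 T,
      ((u t, v t) = freeEvolution h0 h1 u₀ v₀ t + duhamel γ (semS₂ N h0 h1)
        (fun τ => crossPower N (one_pos.trans hp) (one_pos.trans hq) (u τ, v τ)) t ↔
      (∀ x, u t x = opP N γ t u₀ x + ∫ τ in (0 : ℝ)..t,
        (t - τ) ^ (γ - 1) * opS N γ (t - τ) (fun y => |v τ y| ^ p) x) ∧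
      ∀ x, v t x = opP N γ t v₀ x + ∫ τ in (0 : ℝ)..t,
        (t - τ) ^ (γ - 1) * opS N γ (t - τ) (fun y => |u τ y| ^ q) x) := by
    intro hu hv t ht
    have hsub : Set.Icc 0 t ⊆ Set.Icc 0 T := Set.Icc_subset_Icc_right ht.2
    have hc : ContinuousOn (fun τ => crossPower N (one_pos.trans hp) (one_pos.trans hq) (u τ, v τ))
        (Set.Icc 0 t) := hF.comp_continuousOn ((hu.mono hsub).prodMk (hv.mono hsub))
    rw [duhamel_semS₂ h0 h1 ht.1 hc, freeEvolution, Prod.mk_add_mk, Prod.mk.injEq,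
      DFunLike.ext_iff, DFunLike.ext_iff]
    refine and_congr (forall_congr' fun x => ?_) (forall_congr' fun x => ?_)
    · rw [ZeroAtInftyContinuousMap.add_apply, semP_apply h0 h1 ht.1, duhamel_apply h0 h1 ht.1 hc.fst]
      rfl
    · rw [ZeroAtInftyContinuousMap.add_apply, semP_apply h0 h1 ht.1, duhamel_apply h0 h1 ht.1 hc.snd]
      rfl
  constructor
  · intro h
    exact ⟨h.continuousOn_u.prodMk h.continuousOn_v, fun t ht =>
      (key h.continuousOn_u h.continuousOn_v t ht).2 ⟨h.eq_u t ht, h.eq_v t ht⟩⟩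
  · intro h
    have hu : ContinuousOn u (Set.Icc 0 T) := h.cont.fst
    have hv : ContinuousOn v (Set.Icc 0 T) := h.cont.snd
    exact ⟨hu, hv, fun t ht => ((key hu hv t ht).1 (h.eq t ht)).1,
      fun t ht => ((key hu hv t ht).1 (h.eq t ht)).2⟩

end

/-! ### Scalar comparison with the Bernoulli equation -/

section

open Filter Topology MeasureTheory

variable {γ p z : ℝ}

/-- One-sided Lipschitz bound in which only the larger argument y must be bounded: if y ≤ x, the
left side is nonpositive. -/
lemma rpow_sub_rpow_le (hp : 1 < p) {x y Y : ℝ} (hx : 0 ≤ x) (hy : 0 ≤ y) (hyY : y ≤ Y) :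
    y ^ p - x ^ p ≤ p * Y ^ (p - 1) * max (y - x) 0 := by
  have hY : 0 ≤ Y := hy.trans hyY
  have hc : 0 ≤ p * Y ^ (p - 1) := mul_nonneg (by linarith) (Real.rpow_nonneg hY _)
  rcases le_total y x with h | h
  · exact (sub_nonpos.2 (Real.rpow_le_rpow hy h (by linarith))).trans
      (mul_nonneg hc (le_max_right _ _))
  · have := (lipschitzWith_min_abs_rpow hp.le hY).dist_le_mul y x
    rw [Real.dist_eq, Real.dist_eq, abs_of_nonneg hy, abs_of_nonneg hx, min_eq_left hyY,
      min_eq_left (h.trans hyY), Real.coe_toNNReal _ hc, abs_of_nonneg (sub_nonneg.2 h)] at this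
    rw [max_eq_left (sub_nonneg.2 h)]
    exact (le_abs_self _).trans this

/-- Comparison for `Z = relax * z + relaxKernel ⋆ (a Z ^ p - 1)`. -/
lemma le_of_sub_super_solution (h0 : 0 < γ) (h1 : γ < 1) (hp : 1 < p) {a T : ℝ} (ha : 0 ≤ a)
    {y Z : ℝ → ℝ} (hyc : ContinuousOn y (Set.Icc 0 T)) (hZc : ContinuousOn Z (Set.Icc 0 T))
    (hy0 : ∀ t ∈ Set.Icc 0 T, 0 ≤ y t) (hZ0 : ∀ t ∈ Set.Icc 0 T, 0 ≤ Z t)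
    (hy : ∀ t ∈ Set.Icc 0 T, y t ≤ relax γ t * z
      + ∫ τ in (0 : ℝ)..t, relaxKernel γ (t - τ) * (a * y τ ^ p - 1))
    (hZ : ∀ t ∈ Set.Icc 0 T, relax γ t * z
      + ∫ τ in (0 : ℝ)..t, relaxKernel γ (t - τ) * (a * Z τ ^ p - 1) ≤ Z t) :
    ∀ t ∈ Set.Icc 0 T, y t ≤ Z t := by
  obtain ⟨Y, hY⟩ := isCompact_Icc.exists_bound_of_continuousOn hyc
  set M := a * (p * Y ^ (p - 1)) with hM
  set K := 1 / Real.Gamma γ * M with hKdef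
  have hΓ := Real.Gamma_pos_of_pos h0
  have hdc : ContinuousOn (fun t => max (y t - Z t) 0) (Set.Icc 0 T) :=
    (hyc.sub hZc).sup continuousOn_const
  -- If T < 0 the interval is empty, and Y need not be nonnegative.
  have hM0 : T < 0 ∨ 0 ≤ M := by
    rcases lt_or_ge T 0 with h | h
    · exact Or.inl h
    · exact Or.inr (mul_nonneg ha (mul_nonneg (by linarith)
        (Real.rpow_nonneg ((norm_nonneg _).trans (hY 0 ⟨le_rfl, h⟩)) _)))
  rcases hM0 with hT | hM0
  · exact fun t ht => absurd (ht.1.trans ht.2) (not_le.2 hT)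
  have key := eq_zero_of_le_integral_sub_rpow_mul h0 (K := K) (by positivity) hdc
    (fun _ _ => le_max_right _ _) fun t ht => ?_
  · intro t ht
    have := (le_max_left (y t - Z t) 0).trans (key t ht).le
    linarith
  · have hsub : Set.Icc 0 t ⊆ Set.Icc 0 T := Set.Icc_subset_Icc_right ht.2
    have hcp : ∀ f : ℝ → ℝ, ContinuousOn f (Set.Icc 0 T) →
        ContinuousOn (fun τ => a * f τ ^ p - 1) (Set.Icc 0 t) := fun f hf =>
      ((((hf.mono hsub).rpow_const fun _ _ => Or.inr (by linarith)).const_smul a).sub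
        continuousOn_const)
    have hid : IntervalIntegrable (fun τ => K * ((t - τ) ^ (γ - 1) * max (y τ - Z τ) 0)) volume 0 t :=
      (intervalIntegrable_sub_rpow_mul h0 ht.1 (hdc.mono hsub)).const_mul K
    have hiy := intervalIntegrable_relaxKernel_mul h0 h1 ht.1 (hcp y hyc)
    have hiZ := intervalIntegrable_relaxKernel_mul h0 h1 ht.1 (hcp Z hZc)
    have hle : (∫ τ in (0 : ℝ)..t, relaxKernel γ (t - τ) * (a * y τ ^ p - 1))
        - ∫ τ in (0 : ℝ)..t, relaxKernel γ (t - τ) * (a * Z τ ^ p - 1)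
        ≤ ∫ τ in (0 : ℝ)..t, K * ((t - τ) ^ (γ - 1) * max (y τ - Z τ) 0) := by
      rw [← intervalIntegral.integral_sub hiy hiZ]
      refine intervalIntegral.integral_mono_on ht.1 (hiy.sub hiZ) hid fun τ hτ => ?_
      have hτT := hsub hτ
      have hst : 0 ≤ t - τ := by linarith [hτ.2]
      have e1 := rpow_sub_rpow_le hp (hZ0 τ hτT) (hy0 τ hτT) ((le_abs_self _).trans (hY τ hτT))
      have hm : 0 ≤ M * max (y τ - Z τ) 0 := mul_nonneg hM0 (le_max_right _ _)
      calc relaxKernel γ (t - τ) * (a * y τ ^ p - 1) - relaxKernel γ (t - τ) * (a * Z τ ^ p - 1)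
          = relaxKernel γ (t - τ) * (a * (y τ ^ p - Z τ ^ p)) := by ring
        _ ≤ relaxKernel γ (t - τ) * (a * (p * Y ^ (p - 1) * max (y τ - Z τ) 0)) :=
            mul_le_mul_of_nonneg_left (mul_le_mul_of_nonneg_left e1 ha)
              (relaxKernel_nonneg h0 h1 hst)
        _ = relaxKernel γ (t - τ) * (M * max (y τ - Z τ) 0) := by rw [hM]; ring
        _ ≤ ((t - τ) ^ (γ - 1) * (1 / Real.Gamma γ)) * (M * max (y τ - Z τ) 0) :=
            mul_le_mul_of_nonneg_right (relaxKernel_le h0 h1 hst) hm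
        _ = K * ((t - τ) ^ (γ - 1) * max (y τ - Z τ) 0) := by rw [hKdef]; ring
    rw [intervalIntegral.integral_const_mul] at hle
    refine max_le ?_ ?_
    · linarith [hy t ht, hZ t ht]
    · refine mul_nonneg (by positivity) (intervalIntegral.integral_nonneg ht.1 fun τ hτ =>
        mul_nonneg (Real.rpow_nonneg (by linarith [hτ.2]) _) (le_max_right _ _))

/-- The function `W` with `W ^ (-1/(p-1))` solving `y' = 2 ^ (1-p) y ^ p - 2 y`, `y(0) = z`. -/
def bernoulli (p z s : ℝ) : ℝ :=
  2 ^ (-p) - (2 ^ (-p) - z ^ (1 - p)) * Real.exp (2 * (p - 1) * s)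

/-- The blow-up time of the Bernoulli equation. -/
def bernoulliTime (p z : ℝ) : ℝ := Real.log (1 - 2 ^ p * z ^ (1 - p)) / (2 * (1 - p))

lemma two_lt_rpow (hp : 1 < p) (hz : 2 ^ (p / (p - 1)) < z) : 2 < z := by
  refine lt_of_le_of_lt ?_ hz
  nth_rewrite 1 [← Real.rpow_one 2]
  refine Real.rpow_le_rpow_of_exponent_le (by norm_num) ?_
  rw [le_div_iff₀ (by linarith)]; linarith

lemma two_rpow_lt_rpow (hp : 1 < p) (hz : 2 ^ (p / (p - 1)) < z) {y : ℝ} (hy : z ≤ y) :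
    (2 : ℝ) ^ p < y ^ (p - 1) := by
  have h := Real.rpow_lt_rpow (by positivity) (hz.trans_le hy) (by linarith : 0 < p - 1)
  rwa [← Real.rpow_mul (by norm_num), div_mul_cancel₀ _ (by linarith)] at h

lemma rpow_one_sub_lt (hp : 1 < p) (hz : 2 ^ (p / (p - 1)) < z) : z ^ (1 - p) < 2 ^ (-p) := by
  have hz2 := two_lt_rpow hp hz
  rw [show 1 - p = -(p - 1) by ring, Real.rpow_neg (by linarith), Real.rpow_neg (by norm_num)]
  exact inv_strictAnti₀ (by positivity) (two_rpow_lt_rpow hp hz le_rfl)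

lemma bernoulli_zero (p z : ℝ) : bernoulli p z 0 = z ^ (1 - p) := by simp [bernoulli]

lemma continuous_bernoulli (p z : ℝ) : Continuous (bernoulli p z) := by
  unfold bernoulli; fun_prop

lemma strictAnti_bernoulli (hp : 1 < p) (hz : 2 ^ (p / (p - 1)) < z) :
    StrictAnti (bernoulli p z) := by
  intro s s' hs
  have h := mul_lt_mul_of_pos_left (Real.exp_lt_exp.2 (mul_lt_mul_of_pos_left hs
    (by linarith : 0 < 2 * (p - 1)))) (sub_pos.2 (rpow_one_sub_lt hp hz))
  simp only [bernoulli]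
  linarith

lemma bernoulli_bernoulliTime (hp : 1 < p) (hz : 2 ^ (p / (p - 1)) < z) :
    bernoulli p z (bernoulliTime p z) = 0 := by
  have h := rpow_one_sub_lt hp hz
  have h2 : (2 : ℝ) ^ (-p) = ((2 : ℝ) ^ p)⁻¹ := Real.rpow_neg (by norm_num) _
  have h2p : (0 : ℝ) < 2 ^ p := by positivity
  have hpos : 0 < 1 - 2 ^ p * z ^ (1 - p) := by
    have := mul_lt_mul_of_pos_left h h2p
    rw [h2, mul_inv_cancel₀ h2p.ne'] at this
    linarith
  have e : 2 * (p - 1) * bernoulliTime p z = -Real.log (1 - 2 ^ p * z ^ (1 - p)) := by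
    have : 1 - p ≠ 0 := by linarith
    rw [bernoulliTime]
    field_simp
    ring
  rw [bernoulli, e, Real.exp_neg, Real.exp_log hpos, h2, sub_eq_zero]
  field_simp

lemma bernoulli_pos (hp : 1 < p) (hz : 2 ^ (p / (p - 1)) < z) {s : ℝ} (hs : s < bernoulliTime p z) :
    0 < bernoulli p z s := by
  rw [← bernoulli_bernoulliTime hp hz]
  exact strictAnti_bernoulli hp hz hs

lemma bernoulliTime_pos (hp : 1 < p) (hz : 2 ^ (p / (p - 1)) < z) : 0 < bernoulliTime p z := by
  rw [← (strictAnti_bernoulli hp hz).lt_iff_gt, bernoulli_bernoulliTime hp hz, bernoulli_zero]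
  exact Real.rpow_pos_of_pos (by linarith [two_lt_rpow hp hz]) _

/-- The solution of `y' = 2 ^ (1-p) y ^ p - 2 y`, `y(0) = z`. -/
def bernoulliSol (p z s : ℝ) : ℝ := bernoulli p z s ^ (-(1 / (p - 1)))

lemma bernoulliSol_zero (hp : 1 < p) (hz : 0 ≤ z) : bernoulliSol p z 0 = z := by
  have : p - 1 ≠ 0 := by linarith
  rw [bernoulliSol, bernoulli_zero, ← Real.rpow_mul hz,
    show (1 - p) * -(1 / (p - 1)) = 1 by field_simp; ring, Real.rpow_one]

lemma hasDerivAt_bernoulliSol (hp : 1 < p) (hz : 2 ^ (p / (p - 1)) < z) {s : ℝ}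
    (hs : s < bernoulliTime p z) : HasDerivAt (bernoulliSol p z)
      (2 ^ (1 - p) * bernoulliSol p z s ^ p - 2 * bernoulliSol p z s) s := by
  have hW := bernoulli_pos hp hz hs
  have hp1 : p - 1 ≠ 0 := by linarith
  have hd : HasDerivAt (bernoulli p z) (2 * (p - 1) * (bernoulli p z s - 2 ^ (-p))) s := by
    have h1 : HasDerivAt (fun s => 2 * (p - 1) * s) (2 * (p - 1)) s := by
      simpa using (hasDerivAt_id s).const_mul (2 * (p - 1))
    refine ((h1.exp.const_mul (2 ^ (-p) - z ^ (1 - p))).const_sub (2 ^ (-p))).congr_deriv ?_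
    rw [bernoulli]; ring
  refine (hd.rpow_const (p := -(1 / (p - 1))) (Or.inl hW.ne')).congr_deriv ?_
  rw [bernoulliSol, ← Real.rpow_mul hW.le]
  have e1 : -(1 / (p - 1)) * p = -(1 / (p - 1)) - 1 := by field_simp; ring
  have e2 : bernoulli p z s ^ (-(1 / (p - 1)))
      = bernoulli p z s * bernoulli p z s ^ (-(1 / (p - 1)) - 1) := by
    nth_rewrite 2 [← Real.rpow_one (bernoulli p z s)]
    rw [← Real.rpow_add hW]; ring_nf
  have e3 : (2 : ℝ) ^ (1 - p) = 2 * 2 ^ (-p) := by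
    nth_rewrite 2 [← Real.rpow_one 2]
    rw [← Real.rpow_add (by norm_num)]; ring_nf
  rw [e1, e2, e3]
  field_simp
  ring

lemma bernoulliSol_mono (hp : 1 < p) (hz : 2 ^ (p / (p - 1)) < z) {s s' : ℝ} (h : s ≤ s')
    (hs : s' < bernoulliTime p z) : bernoulliSol p z s ≤ bernoulliSol p z s' :=
  Real.rpow_le_rpow_of_nonpos (bernoulli_pos hp hz hs) ((strictAnti_bernoulli hp hz).antitone h)
    (neg_nonpos.2 (one_div_nonneg.2 (by linarith)))

lemma le_bernoulliSol (hp : 1 < p) (hz : 2 ^ (p / (p - 1)) < z) {s : ℝ} (h : 0 ≤ s)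
    (hs : s < bernoulliTime p z) : z ≤ bernoulliSol p z s := by
  have := bernoulliSol_mono hp hz h hs
  rwa [bernoulliSol_zero hp (by linarith [two_lt_rpow hp hz])] at this

/-- The solution is a negative power of `bernoulli`, which is continuous and vanishes at
`bernoulliTime`. -/
lemma exists_lt_bernoulliSol (hp : 1 < p) (hz : 2 ^ (p / (p - 1)) < z) (M : ℝ) :
    ∃ s, 0 ≤ s ∧ s < bernoulliTime p z ∧ M < bernoulliSol p z s := by
  by_contra! hcon
  have hB := bernoulliTime_pos hp hz
  have hp1 : 0 < p - 1 := by linarith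
  have hMz : z ≤ M := (bernoulliSol_zero hp (by linarith [two_lt_rpow hp hz])).symm.le.trans
    (hcon 0 le_rfl hB)
  have hM : 0 < M := by linarith [two_lt_rpow hp hz]
  have hlow : ∀ s ∈ Set.Ioo 0 (bernoulliTime p z), M ^ (-(p - 1)) ≤ bernoulli p z s := fun s hs => by
    have hW := bernoulli_pos hp hz hs.2
    have h := Real.rpow_le_rpow_of_nonpos (Real.rpow_pos_of_pos hW _) (hcon s hs.1.le hs.2)
      (by linarith : -(p - 1) ≤ 0)
    rwa [← Real.rpow_mul hW.le, show -(1 / (p - 1)) * -(p - 1) = 1 by field_simp, Real.rpow_one] at h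
  have := ge_of_tendsto (((continuous_bernoulli p z).continuousAt (x := bernoulliTime p z)).tendsto.mono_left
    (nhdsWithin_le_nhds (s := Set.Iio (bernoulliTime p z))))
    (by filter_upwards [Ioo_mem_nhdsLT hB] with s hs using hlow s hs)
  rw [bernoulli_bernoulliTime hp hz] at this
  exact absurd (Real.rpow_pos_of_pos hM _) (not_lt.2 this)

/-- The expression is y (2^{1-p} y^{p-1} - 2), a product of nonnegative nondecreasing factors once y
≥ z > 2^{p/(p-1)}. Monotonicity is what the rearrangement inequality requires. -/
lemma monotoneOn_bernoulli_rhs (hp : 1 < p) (hz : 2 ^ (p / (p - 1)) < z) :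
    MonotoneOn (fun y : ℝ => 2 ^ (1 - p) * y ^ p - 2 * y) (Set.Ici z) := by
  have hz2 := two_lt_rpow hp hz
  have e : ∀ y ∈ Set.Ici z, (2 : ℝ) ^ (1 - p) * y ^ p - 2 * y
      = y * (2 ^ (1 - p) * y ^ (p - 1) - 2) := fun y hy => by
    have hy0 : 0 < y := by linarith [Set.mem_Ici.1 hy]
    have : y ^ p = y * y ^ (p - 1) := by
      nth_rewrite 2 [← Real.rpow_one y]
      rw [← Real.rpow_add hy0]; ring_nf
    rw [this]; ring
  have hnn : ∀ y ∈ Set.Ici z, 0 ≤ (2 : ℝ) ^ (1 - p) * y ^ (p - 1) - 2 := fun y hy => by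
    have h := mul_lt_mul_of_pos_left (two_rpow_lt_rpow hp hz (Set.mem_Ici.1 hy))
      (by positivity : (0 : ℝ) < 2 ^ (1 - p))
    rw [← Real.rpow_add (by norm_num), sub_add_cancel, Real.rpow_one] at h
    linarith
  intro y hy y' hy' hyy
  have hy0 : 0 < y := by linarith [Set.mem_Ici.1 hy]
  simp only
  rw [e y hy, e y' hy']
  refine mul_le_mul hyy ?_ (hnn y hy) (by linarith)
  have := mul_le_mul_of_nonneg_left (Real.rpow_le_rpow hy0.le hyy (by linarith : 0 ≤ p - 1))
    (by positivity : (0 : ℝ) ≤ 2 ^ (1 - p))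
  linarith

/-- The time-changed Bernoulli solution. -/
def fracSub (γ p z t : ℝ) : ℝ := bernoulliSol p z (t ^ γ / Real.Gamma (γ + 1))

/-- With y = `fracSub γ p z`, y' = τ^{γ-1} g/Γ(γ), where g = 2^{1-p} y^p - 2y is nondecreasing in
time. Integration by parts gives y(t) = e(t) z + ∫(-e')(t-τ) y + ∫ τ^{γ-1} e(t-τ) g/Γ(γ), and the
rearrangement inequality bounds the last integral by ∫(-e')(t-τ) g. -/
lemma fracSub_le (h0 : 0 < γ) (h1 : γ < 1) (hp : 1 < p) (hz : 2 ^ (p / (p - 1)) < z) {t : ℝ}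
    (ht : 0 ≤ t) (htB : t ^ γ / Real.Gamma (γ + 1) < bernoulliTime p z) :
    fracSub γ p z t ≤ relax γ t * z
      + ∫ τ in (0 : ℝ)..t, relaxKernel γ (t - τ) * (2 ^ (1 - p) * fracSub γ p z τ ^ p - 1) := by
  have hz2 := two_lt_rpow hp hz
  have hΓ := Real.Gamma_pos_of_pos h0
  have hΓ1 := Real.Gamma_pos_of_pos (by linarith : 0 < γ + 1)
  have hy00 : fracSub γ p z 0 = z := by
    rw [fracSub, Real.zero_rpow h0.ne', zero_div, bernoulliSol_zero hp (by linarith)]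
  rcases ht.eq_or_lt with rfl | ht'
  · rw [intervalIntegral.integral_same, relax_zero h0 h1, hy00]; simp
  have hmono : ∀ τ τ' : ℝ, 0 ≤ τ → τ ≤ τ' →
      τ ^ γ / Real.Gamma (γ + 1) ≤ τ' ^ γ / Real.Gamma (γ + 1) := fun τ τ' h h' =>
    div_le_div_of_nonneg_right (Real.rpow_le_rpow h h' h0.le) hΓ1.le
  have hlt : ∀ τ ∈ Set.Icc 0 t, τ ^ γ / Real.Gamma (γ + 1) < bernoulliTime p z := fun τ hτ =>
    (hmono τ t hτ.1 hτ.2).trans_lt htB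
  have hge : ∀ τ ∈ Set.Icc 0 t, z ≤ fracSub γ p z τ := fun τ hτ =>
    le_bernoulliSol hp hz (div_nonneg (Real.rpow_nonneg hτ.1 _) hΓ1.le) (hlt τ hτ)
  have hc : ContinuousOn (fracSub γ p z) (Set.Icc 0 t) := fun τ hτ =>
    (ContinuousAt.comp (f := fun τ : ℝ => τ ^ γ / Real.Gamma (γ + 1))
      (hasDerivAt_bernoulliSol hp hz (hlt τ hτ)).continuousAt
      ((Real.continuous_rpow_const h0.le).div_const _).continuousAt).continuousWithinAt
  have hcp : ContinuousOn (fun τ => 2 ^ (1 - p) * fracSub γ p z τ ^ p) (Set.Icc 0 t) :=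
    continuousOn_const.mul (hc.rpow_const fun _ _ => Or.inr (by linarith))
  set g : ℝ → ℝ := fun τ => 2 ^ (1 - p) * fracSub γ p z τ ^ p - 2 * fracSub γ p z τ with hg
  have hgc : ContinuousOn g (Set.Icc 0 t) := hcp.sub (continuousOn_const.mul hc)
  have hgm : MonotoneOn g (Set.Icc 0 t) := fun τ hτ τ' hτ' h =>
    monotoneOn_bernoulli_rhs hp hz (hge τ hτ) (hge τ' hτ')
      (bernoulliSol_mono hp hz (hmono τ τ' hτ.1 h) (hlt τ' hτ'))
  have hder : ∀ τ ∈ Set.Ioo 0 t,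
      HasDerivAt (fracSub γ p z) (τ ^ (γ - 1) * (g τ / Real.Gamma γ)) τ := fun τ hτ => by
    have h := (hasDerivAt_bernoulliSol hp hz (hlt τ ⟨hτ.1.le, hτ.2.le⟩)).comp τ
      ((Real.hasDerivAt_rpow_const (p := γ) (Or.inl hτ.1.ne')).div_const (Real.Gamma (γ + 1)))
    refine h.congr_deriv ?_
    rw [Real.Gamma_add_one h0.ne', hg]
    simp only [fracSub, Real.Gamma_add_one h0.ne']
    field_simp
  have hibp := integral_relaxKernel_mul h0 h1 ht hc (hgc.div_const _) hder
  have hle := integral_rpow_mul_relax_mul_le h0 h1 ht' hgc hgm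
  have hadd : (∫ τ in (0 : ℝ)..t, relaxKernel γ (t - τ) * fracSub γ p z τ)
      + ∫ τ in (0 : ℝ)..t, relaxKernel γ (t - τ) * g τ
      ≤ ∫ τ in (0 : ℝ)..t, relaxKernel γ (t - τ) * (2 ^ (1 - p) * fracSub γ p z τ ^ p - 1) := by
    have hi1 := intervalIntegrable_relaxKernel_mul h0 h1 ht hc
    have hi2 := intervalIntegrable_relaxKernel_mul h0 h1 ht hgc
    rw [← intervalIntegral.integral_add hi1 hi2]
    refine intervalIntegral.integral_mono_on ht (hi1.add hi2)
      (intervalIntegrable_relaxKernel_mul h0 h1 ht (hcp.sub continuousOn_const)) fun τ hτ => ?_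
    rw [← mul_add]
    refine mul_le_mul_of_nonneg_left ?_ (relaxKernel_nonneg h0 h1 (by linarith [hτ.2]))
    -- Here y + g = 2^{1-p} y^p - y, and y ≥ z > 2, so replacing -y by -1 increases the integrand.
    -- The coefficient 2 in the Bernoulli equation leaves exactly this -y.
    have := hge τ hτ
    simp only [hg]
    linarith
  rw [hy00] at hibp
  linarith

/-- A supersolution of the scalar Volterra inequality cannot live past the Bernoulli time. -/
lemma lt_of_super_solution (h0 : 0 < γ) (h1 : γ < 1) (hp : 1 < p) (hz : 2 ^ (p / (p - 1)) < z)
    {T : ℝ} {Z : ℝ → ℝ} (hZc : ContinuousOn Z (Set.Icc 0 T))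
    (hZ0 : ∀ t ∈ Set.Icc 0 T, 0 ≤ Z t)
    (hZ : ∀ t ∈ Set.Icc 0 T, relax γ t * z
      + ∫ τ in (0 : ℝ)..t, relaxKernel γ (t - τ) * (2 ^ (1 - p) * Z τ ^ p - 1) ≤ Z t) :
    T < (bernoulliTime p z * Real.Gamma (γ + 1)) ^ (1 / γ) := by
  by_contra! hcon
  have hΓ1 := Real.Gamma_pos_of_pos (by linarith : 0 < γ + 1)
  have hB := bernoulliTime_pos hp hz
  obtain ⟨M, hM⟩ := isCompact_Icc.exists_bound_of_continuousOn hZc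
  obtain ⟨s, hs0, hsB, hsM⟩ := exists_lt_bernoulliSol hp hz M
  -- Chosen so that t^γ/Γ(γ+1) = s; there the subsolution already exceeds the bound M of Z.
  set t := (s * Real.Gamma (γ + 1)) ^ (1 / γ) with ht
  have ht0 : 0 ≤ t := Real.rpow_nonneg (by positivity) _
  have hts : t ^ γ / Real.Gamma (γ + 1) = s := by
    rw [ht, ← Real.rpow_mul (by positivity), one_div_mul_cancel h0.ne', Real.rpow_one,
      mul_div_cancel_right₀ _ hΓ1.ne']
  have htT : t ≤ T := le_trans (Real.rpow_le_rpow (by positivity)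
    (mul_le_mul_of_nonneg_right hsB.le hΓ1.le) (by positivity)) hcon
  have hlt : ∀ τ ∈ Set.Icc 0 t, τ ^ γ / Real.Gamma (γ + 1) < bernoulliTime p z := fun τ hτ => by
    refine lt_of_le_of_lt ?_ (hts.symm ▸ hsB)
    exact div_le_div_of_nonneg_right (Real.rpow_le_rpow hτ.1 hτ.2 h0.le) hΓ1.le
  have hsub : Set.Icc 0 t ⊆ Set.Icc 0 T := Set.Icc_subset_Icc_right htT
  have hc : ContinuousOn (fracSub γ p z) (Set.Icc 0 t) := fun τ hτ =>
    (ContinuousAt.comp (f := fun τ : ℝ => τ ^ γ / Real.Gamma (γ + 1))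
      (hasDerivAt_bernoulliSol hp hz (hlt τ hτ)).continuousAt
      ((Real.continuous_rpow_const h0.le).div_const _).continuousAt).continuousWithinAt
  have hcmp := le_of_sub_super_solution h0 h1 hp (by positivity : (0 : ℝ) ≤ 2 ^ (1 - p)) hc
    (hZc.mono hsub) (fun τ hτ => Real.rpow_nonneg (bernoulli_pos hp hz (hlt τ hτ)).le _)
    (fun τ hτ => hZ0 τ (hsub hτ)) (fun τ hτ => fracSub_le h0 h1 hp hz hτ.1 (hlt τ hτ))
    (fun τ hτ => hZ τ (hsub hτ)) t ⟨ht0, le_rfl⟩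
  rw [fracSub, hts] at hcmp
  have := hM t ⟨ht0, htT⟩
  rw [Real.norm_of_nonneg (hZ0 t ⟨ht0, htT⟩)] at this
  linarith

end

/-! ### Positivity of solutions and the bound on the existence time -/

section

open Filter Topology MeasureTheory

variable {N : ℕ} {γ p q : ℝ}

lemma duhamel_semS_nonneg (h0 : 0 < γ) (h1 : γ < 1) {t : ℝ} (ht : 0 ≤ t) {h : ℝ → C₀(Sp N, ℝ)}
    (hh : ContinuousOn h (Set.Icc 0 t)) (hn : ∀ τ ∈ Set.Icc 0 t, ∀ x, 0 ≤ h τ x) (x : Sp N) :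
    0 ≤ duhamel γ (semS N h0 h1) h t x := by
  rw [← evalAt_apply, duhamel_clm (evalAt x) h0 h1 ht hh]
  refine intervalIntegral.integral_nonneg ht fun τ hτ => ?_
  exact mul_nonneg (Real.rpow_nonneg (by linarith [hτ.2]) _) (semS_nonneg h0 h1 _ (hn τ hτ) x)

lemma integral_relaxKernel_mul_weightFun_le (hN : 1 ≤ N) (h0 : 0 < γ) (h1 : γ < 1) {t : ℝ}
    (ht : 0 ≤ t) {h : ℝ → C₀(Sp N, ℝ)} (hh : ContinuousOn h (Set.Icc 0 t))
    (hn : ∀ τ ∈ Set.Icc 0 t, ∀ x, 0 ≤ h τ x) :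
    ∫ τ in (0 : ℝ)..t, relaxKernel γ (t - τ) * weightFun N (h τ)
      ≤ weightFun N (duhamel γ (semS N h0 h1) h t) := by
  rw [duhamel_clm (weightFun N) h0 h1 ht hh]
  have hi := intervalIntegrable_sub_rpow_smul (t := t) h0 (continuous_semS h0 h1) ht hh
  replace hi : IntervalIntegrable (fun τ => weightFun N ((t - τ) ^ (γ - 1) •
      semS N h0 h1 (t - τ) (h τ))) volume 0 t :=
    ⟨(weightFun N).integrable_comp hi.1, (weightFun N).integrable_comp hi.2⟩
  simp only [map_smul] at hi
  refine intervalIntegral.integral_mono_on ht (intervalIntegrable_relaxKernel_mul h0 h1 ht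
    ((weightFun N).continuous.comp_continuousOn hh)) hi fun τ hτ => ?_
  exact relaxKernel_mul_weightFun_le hN h0 h1 (by linarith [hτ.2]) (hn τ hτ)

variable {u₀ v₀ : C₀(Sp N, ℝ)} {T : ℝ} {U : ℝ → C₀(Sp N, ℝ) × C₀(Sp N, ℝ)}

lemma IsVolterraSol.continuousOn_crossPower (h0 : 0 < γ) (h1 : γ < 1) (hp : 1 < p) (hq : 1 < q)
    (hU : IsVolterraSol γ (semS₂ N h0 h1) (freeEvolution h0 h1 u₀ v₀)
      (crossPower N (one_pos.trans hp) (one_pos.trans hq)) T U) :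
    ContinuousOn (fun τ => crossPower N (one_pos.trans hp) (one_pos.trans hq) (U τ))
      (Set.Icc 0 T) :=
  (hasLipschitzTruncations_crossPower hp hq).continuous.comp_continuousOn hU.cont

lemma IsVolterraSol.fst_eq (h0 : 0 < γ) (h1 : γ < 1) (hp : 1 < p) (hq : 1 < q)
    (hU : IsVolterraSol γ (semS₂ N h0 h1) (freeEvolution h0 h1 u₀ v₀)
      (crossPower N (one_pos.trans hp) (one_pos.trans hq)) T U) {t : ℝ} (ht : t ∈ Set.Icc 0 T) :
    (U t).1 = semP N h0 h1 t u₀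
      + duhamel γ (semS N h0 h1) (fun τ => absRpow N (one_pos.trans hp) (U τ).2) t := by
  have h := congrArg Prod.fst (hU.eq t ht)
  rw [duhamel_semS₂ h0 h1 ht.1 ((hU.continuousOn_crossPower h0 h1 hp hq).mono
    (Set.Icc_subset_Icc_right ht.2))] at h
  exact h

lemma IsVolterraSol.snd_eq (h0 : 0 < γ) (h1 : γ < 1) (hp : 1 < p) (hq : 1 < q)
    (hU : IsVolterraSol γ (semS₂ N h0 h1) (freeEvolution h0 h1 u₀ v₀)
      (crossPower N (one_pos.trans hp) (one_pos.trans hq)) T U) {t : ℝ} (ht : t ∈ Set.Icc 0 T) :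
    (U t).2 = semP N h0 h1 t v₀
      + duhamel γ (semS N h0 h1) (fun τ => absRpow N (one_pos.trans hq) (U τ).1) t := by
  have h := congrArg Prod.snd (hU.eq t ht)
  rw [duhamel_semS₂ h0 h1 ht.1 ((hU.continuousOn_crossPower h0 h1 hp hq).mono
    (Set.Icc_subset_Icc_right ht.2))] at h
  exact h

/-- The sources |v|^p and |u|^q are nonnegative whatever the signs of u and v, so positivity is read
off the equation at once. -/
lemma IsVolterraSol.nonneg (h0 : 0 < γ) (h1 : γ < 1) (hp : 1 < p) (hq : 1 < q)
    (hu₀ : ∀ x, 0 ≤ u₀ x) (hv₀ : ∀ x, 0 ≤ v₀ x)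
    (hU : IsVolterraSol γ (semS₂ N h0 h1) (freeEvolution h0 h1 u₀ v₀)
      (crossPower N (one_pos.trans hp) (one_pos.trans hq)) T U) {t : ℝ} (ht : t ∈ Set.Icc 0 T) :
    (∀ x, 0 ≤ (U t).1 x) ∧ ∀ x, 0 ≤ (U t).2 x := by
  have hc := (hU.continuousOn_crossPower h0 h1 hp hq).mono (Set.Icc_subset_Icc_right ht.2)
  refine ⟨fun x => ?_, fun x => ?_⟩
  · rw [hU.fst_eq h0 h1 hp hq ht]
    exact add_nonneg (semP_nonneg h0 h1 t hu₀ x) (duhamel_semS_nonneg h0 h1 ht.1 hc.fst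
      (fun τ _ x => Real.rpow_nonneg (abs_nonneg _) _) x)
  · rw [hU.snd_eq h0 h1 hp hq ht]
    exact add_nonneg (semP_nonneg h0 h1 t hv₀ x) (duhamel_semS_nonneg h0 h1 ht.1 hc.snd
      (fun τ _ x => Real.rpow_nonneg (abs_nonneg _) _) x)

lemma two_rpow_mul_add_rpow_le (hp : 1 < p) {a b : ℝ} (ha : 0 ≤ a) (hb : 0 ≤ b) :
    2 ^ (1 - p) * (a + b) ^ p ≤ a ^ p + b ^ p := by
  have h : (a + b) ^ p ≤ 2 ^ (p - 1) * (a ^ p + b ^ p) := by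
    exact_mod_cast NNReal.rpow_add_le_mul_rpow_add_rpow ⟨a, ha⟩ ⟨b, hb⟩ hp.le
  rw [show 1 - p = -(p - 1) by ring, Real.rpow_neg (by norm_num), inv_mul_le_iff₀ (by positivity)]
  exact h

/-- Lets both equations be estimated with the single exponent p; this is the origin of the -1 in the
scalar inequality. -/
lemma rpow_sub_one_le_rpow (hp : 1 < p) (hpq : p ≤ q) {a : ℝ} (ha : 0 ≤ a) : a ^ p - 1 ≤ a ^ q := by
  rcases le_total 1 a with h | h
  · linarith [Real.rpow_le_rpow_of_exponent_le h hpq]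
  · linarith [Real.rpow_le_one ha h (by linarith : 0 ≤ p), Real.rpow_nonneg ha q]

/-- The existence time of any solution is bounded by the explicit blow-up time. -/
lemma IsVolterraSol.lt_bernoulliTime (hN : 1 ≤ N) (h0 : 0 < γ) (h1 : γ < 1) (hp : 1 < p) (hq : 1 < q)
    (hpq : p ≤ q) (hu₀ : ∀ x, 0 ≤ u₀ x) (hv₀ : ∀ x, 0 ≤ v₀ x)
    (hZ₀ : (2 : ℝ) ^ (p / (p - 1)) < Z0 N u₀ v₀)
    (hU : IsVolterraSol γ (semS₂ N h0 h1) (freeEvolution h0 h1 u₀ v₀)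
      (crossPower N (one_pos.trans hp) (one_pos.trans hq)) T U) :
    T < (bernoulliTime p (Z0 N u₀ v₀) * Real.Gamma (γ + 1)) ^ (1 / γ) := by
  have hn : ∀ t ∈ Set.Icc 0 T, (∀ x, 0 ≤ (U t).1 x) ∧ ∀ x, 0 ≤ (U t).2 x := fun t ht =>
    hU.nonneg h0 h1 hp hq hu₀ hv₀ ht
  have hcu : ContinuousOn (fun t => weightFun N (U t).1) (Set.Icc 0 T) :=
    (weightFun N).continuous.comp_continuousOn hU.cont.fst
  have hcv : ContinuousOn (fun t => weightFun N (U t).2) (Set.Icc 0 T) :=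
    (weightFun N).continuous.comp_continuousOn hU.cont.snd
  refine lt_of_super_solution h0 h1 hp hZ₀ (Z := fun t => weightFun N (U t).1 + weightFun N (U t).2)
    (hcu.add hcv) (fun t ht => add_nonneg (weightFun_nonneg (hn t ht).1)
      (weightFun_nonneg (hn t ht).2)) fun t ht => ?_
  have hsub : Set.Icc 0 t ⊆ Set.Icc 0 T := Set.Icc_subset_Icc_right ht.2
  have hc := (hU.continuousOn_crossPower h0 h1 hp hq).mono hsub
  have hcv' : ContinuousOn (fun τ => absRpow N (one_pos.trans hp) (U τ).2) (Set.Icc 0 t) := hc.fst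
  have hcu' : ContinuousOn (fun τ => absRpow N (one_pos.trans hq) (U τ).1) (Set.Icc 0 t) := hc.snd
  have e1 := congrArg (weightFun N) (hU.fst_eq h0 h1 hp hq ht)
  have e2 := congrArg (weightFun N) (hU.snd_eq h0 h1 hp hq ht)
  rw [map_add] at e1 e2
  have l1 := relax_mul_weightFun_le hN h0 h1 ht.1 hu₀
  have l2 := relax_mul_weightFun_le hN h0 h1 ht.1 hv₀
  have l3 := integral_relaxKernel_mul_weightFun_le hN h0 h1 ht.1 hcv'
    fun τ _ x => absRpow_nonneg _ _ x
  have l4 := integral_relaxKernel_mul_weightFun_le hN h0 h1 ht.1 hcu'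
    fun τ _ x => absRpow_nonneg _ _ x
  have hi3 : IntervalIntegrable (fun τ => relaxKernel γ (t - τ)
      * weightFun N (absRpow N (one_pos.trans hp) (U τ).2)) volume 0 t :=
    intervalIntegrable_relaxKernel_mul h0 h1 ht.1 ((weightFun N).continuous.comp_continuousOn hcv')
  have hi4 : IntervalIntegrable (fun τ => relaxKernel γ (t - τ)
      * weightFun N (absRpow N (one_pos.trans hq) (U τ).1)) volume 0 t :=
    intervalIntegrable_relaxKernel_mul h0 h1 ht.1 ((weightFun N).continuous.comp_continuousOn hcu')
  have hcZ : ContinuousOn (fun τ => 2 ^ (1 - p) * (weightFun N (U τ).1 + weightFun N (U τ).2) ^ p - 1)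
      (Set.Icc 0 t) :=
    (continuousOn_const.mul (((hcu.mono hsub).add (hcv.mono hsub)).rpow_const
      fun _ _ => Or.inr (by linarith))).sub continuousOn_const
  have l5 : ∫ τ in (0 : ℝ)..t, relaxKernel γ (t - τ)
        * (2 ^ (1 - p) * (weightFun N (U τ).1 + weightFun N (U τ).2) ^ p - 1)
      ≤ (∫ τ in (0 : ℝ)..t, relaxKernel γ (t - τ)
          * weightFun N (absRpow N (one_pos.trans hp) (U τ).2))
        + ∫ τ in (0 : ℝ)..t, relaxKernel γ (t - τ)
          * weightFun N (absRpow N (one_pos.trans hq) (U τ).1) := by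
    rw [← intervalIntegral.integral_add hi3 hi4]
    refine intervalIntegral.integral_mono_on ht.1 (intervalIntegrable_relaxKernel_mul h0 h1 ht.1 hcZ)
      (hi3.add hi4) fun τ hτ => ?_
    have hnτ := hn τ (hsub hτ)
    rw [← mul_add]
    refine mul_le_mul_of_nonneg_left ?_ (relaxKernel_nonneg h0 h1 (by linarith [hτ.2]))
    -- With a, b the χ-means of u, v: 2^{1-p}(a+b)^p - 1 ≤ (a^p - 1) + b^p ≤ a^q + b^p, and Jensen's
    -- inequality bounds a^q and b^p by the χ-means of u^q and v^p.
    have j1 := two_rpow_mul_add_rpow_le hp (weightFun_nonneg hnτ.1) (weightFun_nonneg hnτ.2)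
    have j2 := rpow_sub_one_le_rpow hp hpq (weightFun_nonneg hnτ.1)
    have j3 := rpow_weightFun_le hp hnτ.2 (F := absRpow N (one_pos.trans hp) (U τ).2)
      fun x => by rw [absRpow_apply, abs_of_nonneg (hnτ.2 x)]
    have j4 := rpow_weightFun_le hq hnτ.1 (F := absRpow N (one_pos.trans hq) (U τ).1)
      fun x => by rw [absRpow_apply, abs_of_nonneg (hnτ.1 x)]
    linarith
  rw [e1, e2, Z0_eq, mul_add]
  linarith

end

/-! ### Heat operators dominated by superpositions -/

section

open Filter Topology MeasureTheory

variable {N : ℕ} {γ : ℝ}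

/-- A density with heavy tail. -/
def tailDensity (ω : ℝ) : ℝ := (1 + ‖ω‖) ^ (-2 : ℝ)

lemma tailDensity_nonneg (ω : ℝ) : 0 ≤ tailDensity ω := Real.rpow_nonneg (by positivity) _

lemma integrableOn_tailDensity : IntegrableOn tailDensity (Set.Ioi 0) :=
  (integrable_one_add_norm (E := ℝ) (μ := volume) (r := 2) (by simp)).integrableOn

lemma le_tailDensity {b ω : ℝ} (hω : 0 ≤ ω) (h : ω ≤ 2 * b) : ((1 + 2 * b) ^ 2)⁻¹ ≤ tailDensity ω := by
  rw [tailDensity, Real.rpow_neg (by positivity), Real.norm_of_nonneg hω]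
  norm_num
  exact inv_anti₀ (by positivity) (pow_le_pow_left₀ (by positivity) (by linarith) 2)

lemma clm_semigroup_mix {ρ : ℝ → ℝ} (hρ : IntegrableOn ρ (Set.Ioi 0)) {a s : ℝ} (ha : 0 < a)
    (hs : 0 < s) (w : C₀(Sp N, ℝ)) (x : Sp N) :
    heat N a (mix N hρ s w) x = ∫ θ in Set.Ioi (0 : ℝ), ρ θ * heat N (a + s * θ) w x := by
  have h := mix_clm ((evalAt x).comp (heat N a)) hρ s w
  refine h.trans (setIntegral_congr_fun measurableSet_Ioi fun θ hθ => ?_)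
  simp only [heat_add ha (mul_pos hs hθ), smul_eq_mul]
  rfl

lemma integrableOn_mul_heat_add {ρ : ℝ → ℝ} (hρ : IntegrableOn ρ (Set.Ioi 0)) {a s : ℝ} (ha : 0 < a)
    (hs : 0 < s) (w : C₀(Sp N, ℝ)) (x : Sp N) :
    IntegrableOn (fun θ => ρ θ * heat N (a + s * θ) w x) (Set.Ioi 0) := by
  have h := integrableOn_mul_clm_heat ((evalAt x).comp (heat N a)) hρ s w
  refine h.congr_fun (fun θ hθ => ?_) measurableSet_Ioi
  simp only [heat_add ha (mul_pos hs hθ)]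
  rfl

/-- Smearing in time: `T(η)` is dominated by `T(a)` composed with a superposition. -/
lemma heat_le_heat_mix {ρ : ℝ → ℝ} (hρ : IntegrableOn ρ (Set.Ioi 0)) (hρ0 : ∀ θ, 0 < θ → 0 ≤ ρ θ)
    {a s η z₀ : ℝ} (hs : 0 < s) (hη : 0 < η) (hz : s * z₀ ≤ η) (ha : η ≤ a) (ha2 : a ≤ 2 * η)
    {w : C₀(Sp N, ℝ)} (hw : ∀ x, 0 ≤ w x) (x : Sp N) :
    (∫ θ in Set.Ioc 0 z₀, ρ θ) * heat N η w x
      ≤ 3 ^ ((N : ℝ) / 2) * heat N a (mix N hρ s w) x := by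
  have ha0 := hη.trans_le ha
  rw [clm_semigroup_mix hρ ha0 hs, ← integral_const_mul, ← integral_mul_const]
  have hi := (integrableOn_mul_heat_add hρ ha0 hs w x).const_mul (3 ^ ((N : ℝ) / 2))
  refine le_trans (setIntegral_mono_on ((hρ.mono_set Set.Ioc_subset_Ioi_self).mul_const _)
    (IntegrableOn.mono_set hi Set.Ioc_subset_Ioi_self) measurableSet_Ioc fun θ hθ => ?_)
    (setIntegral_mono_set hi ?_ (Set.Ioc_subset_Ioi_self.eventuallyLE))
  · have h1 : 0 < s * θ := mul_pos hs hθ.1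
    have h2 : s * θ ≤ η := (mul_le_mul_of_nonneg_left hθ.2 hs.le).trans hz
    -- The time a + sθ lies in [η, 3η], hence the factor 3^{N/2}.
    have h3 := heat_le_mul_heat hη (by linarith : η ≤ a + s * θ) hw x
    have h4 : ((a + s * θ) / η) ^ ((N : ℝ) / 2) ≤ 3 ^ ((N : ℝ) / 2) :=
      Real.rpow_le_rpow (by positivity) (by rw [div_le_iff₀ hη]; linarith) (by positivity)
    have h5 := h3.trans (mul_le_mul_of_nonneg_right h4 (heat_nonneg _ hw x))
    calc ρ θ * heat N η w x ≤ ρ θ * (3 ^ ((N : ℝ) / 2) * heat N (a + s * θ) w x) :=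
          mul_le_mul_of_nonneg_left h5 (hρ0 θ hθ.1)
      _ = _ := by ring
  · filter_upwards [ae_restrict_mem measurableSet_Ioi] with θ hθ
    exact mul_nonneg (by positivity) (mul_nonneg (hρ0 θ hθ) (heat_nonneg _ hw x))

/-- `heat_le_heat_mix` is averaged over a = eω with ω in (b, 2b]. The polynomial tail of the density
costs only a polynomial factor in b and 1/b, which the moments of the Wright function can absorb. -/
lemma heat_le_mix_mix {ρ : ℝ → ℝ} (hρ : IntegrableOn ρ (Set.Ioi 0)) (hρ0 : ∀ θ, 0 < θ → 0 ≤ ρ θ)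
    {s e b z₀ : ℝ} (hs : 0 < s) (he : 0 < e) (hb : 0 < b) (hz : s * z₀ ≤ e * b)
    {w : C₀(Sp N, ℝ)} (hw : ∀ x, 0 ≤ w x) (x : Sp N) :
    (∫ θ in Set.Ioc 0 z₀, ρ θ) * heat N (e * b) w x
      ≤ 3 ^ ((N : ℝ) / 2) * ((4 + 4 * b + 1 / b) *
        mix N integrableOn_tailDensity e (mix N hρ s w) x) := by
  set J := (∫ θ in Set.Ioc 0 z₀, ρ θ) * heat N (e * b) w x with hJ
  have hSw := mix_nonneg hρ hρ0 s hw
  have hJ0 : 0 ≤ J := mul_nonneg (setIntegral_nonneg measurableSet_Ioc fun θ hθ => hρ0 θ hθ.1)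
    (heat_nonneg _ hw x)
  have hi := (integrableOn_mul_heat_apply integrableOn_tailDensity e (mix N hρ s w) x).const_mul
    (3 ^ ((N : ℝ) / 2))
  have hsub : Set.Ioc b (2 * b) ⊆ Set.Ioi 0 := fun θ hθ => hb.trans hθ.1
  have key : b * (((1 + 2 * b) ^ 2)⁻¹ * J)
      ≤ 3 ^ ((N : ℝ) / 2) * mix N integrableOn_tailDensity e (mix N hρ s w) x := by
    rw [mix_apply, ← integral_const_mul]
    have e1 : b * (((1 + 2 * b) ^ 2)⁻¹ * J) = ∫ _ω in Set.Ioc b (2 * b), ((1 + 2 * b) ^ 2)⁻¹ * J := by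
      rw [setIntegral_const, measureReal_def, Real.volume_Ioc, ENNReal.toReal_ofReal (by linarith),
        smul_eq_mul]
      ring
    rw [e1]
    refine le_trans (setIntegral_mono_on (integrableOn_const (by simp)) (IntegrableOn.mono_set hi hsub)
      measurableSet_Ioc fun ω hω => ?_) (setIntegral_mono_set hi ?_ hsub.eventuallyLE)
    · have h1 := heat_le_heat_mix hρ hρ0 hs (mul_pos he hb) hz
        (mul_le_mul_of_nonneg_left hω.1.le he.le) (by nlinarith [hω.2] : e * ω ≤ 2 * (e * b)) hw x
      have h2 := le_tailDensity (hsub hω).le hω.2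
      calc ((1 + 2 * b) ^ 2)⁻¹ * J ≤ tailDensity ω * (3 ^ ((N : ℝ) / 2)
            * heat N (e * ω) (mix N hρ s w) x) :=
            mul_le_mul h2 h1 hJ0 (tailDensity_nonneg ω)
        _ = _ := by ring
    · filter_upwards [ae_restrict_mem measurableSet_Ioi] with θ hθ
      exact mul_nonneg (by positivity) (mul_nonneg (tailDensity_nonneg θ) (heat_nonneg _ hSw x))
  -- The constant is (1+2b)²/b.
  have e2 : J = (4 + 4 * b + 1 / b) * (b * (((1 + 2 * b) ^ 2)⁻¹ * J)) := by
    field_simp; ring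
  rw [e2]
  calc (4 + 4 * b + 1 / b) * (b * (((1 + 2 * b) ^ 2)⁻¹ * J))
      ≤ (4 + 4 * b + 1 / b) * (3 ^ ((N : ℝ) / 2) *
        mix N integrableOn_tailDensity e (mix N hρ s w) x) :=
        mul_le_mul_of_nonneg_left key (by positivity)
    _ = _ := by ring

end

/-! ### Domination of a delayed kernel by the undelayed one -/

section

open Filter Topology MeasureTheory

variable {N : ℕ} {γ : ℝ}

lemma continuous_mul_wrightPhi_mul_heat (h0 : 0 < γ) (h1 : γ < 1) (s : ℝ) (w : C₀(Sp N, ℝ))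
    (x : Sp N) : Continuous fun z : ℝ => γ * (z * wrightPhi γ z) * heat N (s * z) w x := by
  have hφ := continuous_wrightPhi h0 h1
  have hh : Continuous fun z : ℝ => heat N (s * z) w x :=
    (evalAt x).continuous.comp (continuous_heat_mul_time s w)
  exact (continuous_const.mul (continuous_id.mul hφ)).mul hh

/-- Near the origin φ(z) ≤ (Φ/c) φ(Lz) and z ≤ Lz; the substitution Lz in place of z contributes the
Jacobian 1/L ≤ 1. -/
lemma setIntegral_near_zero_le (h0 : 0 < γ) (h1 : γ < 1) {z₀ c Φ : ℝ} (hz₀ : 0 < z₀) (hc : 0 < c)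
    (hcφ : ∀ z ∈ Set.Icc 0 z₀, c ≤ wrightPhi γ z) (hΦ : ∀ z ∈ Set.Icc 0 z₀, wrightPhi γ z ≤ Φ)
    {L s : ℝ} (hL : 1 ≤ L) {w : C₀(Sp N, ℝ)} (hw : ∀ x, 0 ≤ w x) (x : Sp N) :
    ∫ z in Set.Ioc 0 (z₀ / L), γ * (z * wrightPhi γ z) * heat N (L * s * z) w x
      ≤ Φ / c * mix N (integrableOn_const_mul_wrightPhi h0 h1) s w x := by
  have hL0 : 0 < L := by linarith
  have hΦ0 : 0 ≤ Φ := hc.le.trans ((hcφ 0 ⟨le_rfl, hz₀.le⟩).trans (hΦ 0 ⟨le_rfl, hz₀.le⟩))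
  set q : ℝ → ℝ := fun z => γ * (z * wrightPhi γ z) * heat N (s * z) w x with hq
  have hqc : Continuous q := continuous_mul_wrightPhi_mul_heat h0 h1 s w x
  have hqi : IntegrableOn q (Set.Ioi 0) :=
    integrableOn_mul_heat_apply (integrableOn_const_mul_wrightPhi h0 h1) s w x
  have hq0 : ∀ z, 0 < z → 0 ≤ q z := fun z hz =>
    mul_nonneg (const_mul_wrightPhi_nonneg h0 h1 z hz) (heat_nonneg _ hw x)
  have hdiv : 0 ≤ z₀ / L := by positivity
  have hle : ∫ z in (0 : ℝ)..z₀ / L, γ * (z * wrightPhi γ z) * heat N (L * s * z) w x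
      ≤ ∫ z in (0 : ℝ)..z₀ / L, Φ / c * q (L * z) := by
    refine intervalIntegral.integral_mono_on hdiv
      ((continuous_mul_wrightPhi_mul_heat h0 h1 (L * s) w x).intervalIntegrable _ _)
      ((continuous_const.mul (hqc.comp (continuous_const.mul continuous_id))).intervalIntegrable _ _)
      fun z hz => ?_
    have hLz : L * z ≤ z₀ := by
      have := hz.2
      rw [le_div_iff₀ hL0] at this
      linarith
    have hzL : z ≤ L * z := le_mul_of_one_le_left hz.1 hL
    have e1 := hΦ z ⟨hz.1, hzL.trans hLz⟩
    have e2 := hcφ (L * z) ⟨hz.1.trans hzL, hLz⟩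
    have e3 : heat N (L * s * z) w x = heat N (s * (L * z)) w x := by ring_nf
    simp only [hq]
    rw [e3, ← mul_assoc (Φ / c)]
    refine mul_le_mul_of_nonneg_right ?_ (heat_nonneg _ hw x)
    calc γ * (z * wrightPhi γ z) ≤ γ * (z * Φ) :=
          mul_le_mul_of_nonneg_left (mul_le_mul_of_nonneg_left e1 hz.1) h0.le
      _ = Φ / c * (γ * (z * c)) := by field_simp
      _ ≤ Φ / c * (γ * (L * z * wrightPhi γ (L * z))) := by
          refine mul_le_mul_of_nonneg_left (mul_le_mul_of_nonneg_left ?_ h0.le) (by positivity)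
          exact mul_le_mul hzL e2 hc.le (hz.1.trans hzL)
  rw [← intervalIntegral.integral_of_le hdiv]
  refine hle.trans ?_
  rw [intervalIntegral.integral_const_mul, intervalIntegral.integral_comp_mul_left q hL0.ne', mul_zero,
    mul_div_cancel₀ _ hL0.ne', smul_eq_mul, mix_apply]
  refine mul_le_mul_of_nonneg_left ?_ (by positivity)
  have hnn : 0 ≤ ∫ z in (0 : ℝ)..z₀, q z := by
    rw [intervalIntegral.integral_of_le hz₀.le]
    exact setIntegral_nonneg measurableSet_Ioc fun z hz => hq0 z hz.1
  refine (mul_le_of_le_one_left hnn (inv_le_one_of_one_le₀ hL)).trans ?_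
  rw [intervalIntegral.integral_of_le hz₀.le]
  refine setIntegral_mono_set hqi ?_ (Set.Ioc_subset_Ioi_self.eventuallyLE)
  filter_upwards [ae_restrict_mem measurableSet_Ioi] with z hz using hq0 z hz

lemma integrableOn_wrightPhi_weight (h0 : 0 < γ) (h1 : γ < 1) :
    IntegrableOn (fun z => γ * (z * wrightPhi γ z) * (4 + 16 * z + 1 / z)) (Set.Ioi 0) := by
  have h := (((integrableOn_moment h0 h1 0).const_mul γ).add
    ((integrableOn_moment h0 h1 1).const_mul (4 * γ))).add
    ((integrableOn_moment h0 h1 2).const_mul (16 * γ))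
  refine IntegrableOn.congr_fun h (fun z hz => ?_) measurableSet_Ioi
  have hz' : z ≠ 0 := ne_of_gt hz
  simp only [Pi.add_apply]
  field_simp
  ring

/-- The integral is split at z₀/L: below it `setIntegral_near_zero_le` applies, above it
`heat_le_mix_mix` with b = Lsz/e. The condition on κ makes the resulting weight integrable against z
φ(z) uniformly in the parameters. -/
lemma exists_mul_mix_le (N : ℕ) (h0 : 0 < γ) (h1 : γ < 1) :
    ∃ C : ℝ, 0 ≤ C ∧ ∀ (L s e κ : ℝ), 1 ≤ L → 0 < s → 0 < e → 0 ≤ κ → κ ≤ 1 →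
      (∀ z, 0 < z → κ * (4 + 4 * (L * s * z / e) + 1 / (L * s * z / e)) ≤ 4 + 16 * z + 1 / z) →
      ∀ w : C₀(Sp N, ℝ), (∀ x, 0 ≤ w x) → ∀ x,
        κ * mix N (integrableOn_const_mul_wrightPhi h0 h1) (L * s) w x
          ≤ C * (mix N (integrableOn_const_mul_wrightPhi h0 h1) s w x
            + mix N integrableOn_tailDensity e
              (mix N (integrableOn_const_mul_wrightPhi h0 h1) s w) x) := by
  obtain ⟨z₀, c, hz₀, hc, hcφ⟩ := exists_le_wrightPhi h0 h1
  obtain ⟨Φ, hΦ⟩ := isCompact_Icc.exists_bound_of_continuousOn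
    (s := Set.Icc 0 z₀) (continuous_wrightPhi h0 h1).continuousOn
  have hΦ' : ∀ z ∈ Set.Icc 0 z₀, wrightPhi γ z ≤ Φ := fun z hz => (le_abs_self _).trans (hΦ z hz)
  have hΦ0 : 0 ≤ Φ := (norm_nonneg _).trans (hΦ 0 ⟨le_rfl, hz₀.le⟩)
  set hζ := integrableOn_const_mul_wrightPhi h0 h1
  have hζ0 := const_mul_wrightPhi_nonneg h0 h1
  set c₀ := ∫ θ in Set.Ioc 0 z₀, γ * (θ * wrightPhi γ θ) with hc₀
  have hc₀pos : 0 < c₀ := by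
    rw [hc₀, ← intervalIntegral.integral_of_le hz₀.le]
    refine intervalIntegral.intervalIntegral_pos_of_pos_on
      ((continuous_const.mul (continuous_id.mul (continuous_wrightPhi h0 h1))).intervalIntegrable _ _)
      (fun z hz => ?_) hz₀
    have := hc.trans_le (hcφ z ⟨hz.1.le, hz.2.le⟩)
    exact mul_pos h0 (mul_pos hz.1 this)
  set I := ∫ z in Set.Ioi (0 : ℝ), γ * (z * wrightPhi γ z) * (4 + 16 * z + 1 / z) with hI
  have hI0 : 0 ≤ I := setIntegral_nonneg measurableSet_Ioi fun z hz => by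
    have hz' : 0 < z := hz
    exact mul_nonneg (hζ0 z hz') (by positivity)
  refine ⟨Φ / c + 3 ^ ((N : ℝ) / 2) / c₀ * I, by positivity, ?_⟩
  intro L s e κ hL hs he hκ hκ1 hb w hw x
  have hL0 : 0 < L := by linarith
  set D := mix N hζ s w with hD
  have hD0 : ∀ x, 0 ≤ D x := mix_nonneg hζ hζ0 s hw
  set A := mix N integrableOn_tailDensity e D x with hA
  have hA0 : 0 ≤ A := mix_nonneg _ (fun ω _ => tailDensity_nonneg ω) e hD0 x
  have hdiv : 0 ≤ z₀ / L := by positivity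
  have hqi : IntegrableOn (fun z => γ * (z * wrightPhi γ z) * heat N (L * s * z) w x) (Set.Ioi 0) :=
    integrableOn_mul_heat_apply hζ (L * s) w x
  have hsub : Set.Ioi (z₀ / L) ⊆ Set.Ioi 0 := Set.Ioi_subset_Ioi hdiv
  have hsplit : mix N hζ (L * s) w x
      = (∫ z in Set.Ioc 0 (z₀ / L), γ * (z * wrightPhi γ z) * heat N (L * s * z) w x)
        + ∫ z in Set.Ioi (z₀ / L), γ * (z * wrightPhi γ z) * heat N (L * s * z) w x := by
    rw [mix_apply, ← Set.Ioc_union_Ioi_eq_Ioi hdiv]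
    exact setIntegral_union (Set.Ioc_disjoint_Ioi le_rfl) measurableSet_Ioi
      (hqi.mono_set Set.Ioc_subset_Ioi_self) (hqi.mono_set hsub)
  have hfirst := setIntegral_near_zero_le h0 h1 hz₀ hc hcφ hΦ' (s := s) hL hw x
  have hfirst0 : 0 ≤ ∫ z in Set.Ioc 0 (z₀ / L), γ * (z * wrightPhi γ z) * heat N (L * s * z) w x :=
    setIntegral_nonneg measurableSet_Ioc fun z hz => mul_nonneg (hζ0 z hz.1) (heat_nonneg _ hw x)
  have hsecond : κ * ∫ z in Set.Ioi (z₀ / L), γ * (z * wrightPhi γ z) * heat N (L * s * z) w x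
      ≤ 3 ^ ((N : ℝ) / 2) / c₀ * I * A := by
    have hW := (integrableOn_wrightPhi_weight h0 h1).mul_const (3 ^ ((N : ℝ) / 2) / c₀ * A)
    have e1 : 3 ^ ((N : ℝ) / 2) / c₀ * I * A = ∫ z in Set.Ioi (0 : ℝ),
        γ * (z * wrightPhi γ z) * (4 + 16 * z + 1 / z) * (3 ^ ((N : ℝ) / 2) / c₀ * A) := by
      rw [integral_mul_const]; ring
    rw [e1, ← integral_const_mul]
    refine le_trans (setIntegral_mono_on ((hqi.mono_set hsub).const_mul κ)
      (IntegrableOn.mono_set hW hsub) measurableSet_Ioi fun z hz => ?_)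
      (setIntegral_mono_set hW ?_ hsub.eventuallyLE)
    · have hz0 : 0 < z := hsub hz
      have hbpos : 0 < L * s * z / e := by positivity
      have heb : e * (L * s * z / e) = L * s * z := mul_div_cancel₀ _ he.ne'
      have hz0L : z₀ < z * L := (div_lt_iff₀ hL0).1 hz
      have h2 := heat_le_mix_mix hζ hζ0 hs he hbpos (z₀ := z₀) (by rw [heb]; nlinarith) hw x
      rw [heb] at h2
      have h3 : heat N (L * s * z) w x ≤ 3 ^ ((N : ℝ) / 2) / c₀ *
          ((4 + 4 * (L * s * z / e) + 1 / (L * s * z / e)) * A) := by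
        rw [div_mul_eq_mul_div, le_div_iff₀ hc₀pos]
        linarith
      have hcA : 0 ≤ 3 ^ ((N : ℝ) / 2) / c₀ * A := by positivity
      calc κ * (γ * (z * wrightPhi γ z) * heat N (L * s * z) w x)
          ≤ κ * (γ * (z * wrightPhi γ z) * (3 ^ ((N : ℝ) / 2) / c₀ *
            ((4 + 4 * (L * s * z / e) + 1 / (L * s * z / e)) * A))) :=
            mul_le_mul_of_nonneg_left (mul_le_mul_of_nonneg_left h3 (hζ0 z hz0)) hκ
        _ = γ * (z * wrightPhi γ z) * (κ * (4 + 4 * (L * s * z / e) + 1 / (L * s * z / e)))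
            * (3 ^ ((N : ℝ) / 2) / c₀ * A) := by ring
        _ ≤ _ := mul_le_mul_of_nonneg_right
            (mul_le_mul_of_nonneg_left (hb z hz0) (hζ0 z hz0)) hcA
    · filter_upwards [ae_restrict_mem measurableSet_Ioi] with z hz
      have hz0 : 0 < z := hz
      exact mul_nonneg (mul_nonneg (hζ0 z hz0) (by positivity)) (by positivity)
  rw [hsplit, mul_add]
  have h1' := (mul_le_of_le_one_left hfirst0 hκ1).trans hfirst
  have h2' : 0 ≤ Φ / c * A := by positivity
  have h3' : 0 ≤ 3 ^ ((N : ℝ) / 2) / c₀ * I * D x := mul_nonneg (by positivity) (hD0 x)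
  linarith

/-- A delayed kernel is dominated by the kernel and a superposition of heat operators applied to it. -/
lemma exists_semS_add_le (N : ℕ) (h0 : 0 < γ) (h1 : γ < 1) :
    ∃ C : ℝ, 0 ≤ C ∧ ∀ r ε : ℝ, 0 < r → 0 < ε → ∀ w : C₀(Sp N, ℝ), (∀ x, 0 ≤ w x) → ∀ x,
      (r + ε) ^ (γ - 1) * semS N h0 h1 (r + ε) w x ≤ r ^ (γ - 1) * (C * (semS N h0 h1 r w x
        + mix N integrableOn_tailDensity (ε ^ γ) (semS N h0 h1 r w) x)) := by
  obtain ⟨C, hC0, hC⟩ := exists_mul_mix_le N h0 h1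
  set K : ℝ := 4 * 4 ^ ((N : ℝ) / 2) with hK
  have hK0 : 0 ≤ K := by positivity
  refine ⟨1 + (1 + K) * C, by positivity, ?_⟩
  intro r ε hr hε w hw x
  have hζ0 := const_mul_wrightPhi_nonneg h0 h1
  have hS0 : ∀ x, 0 ≤ semS N h0 h1 r w x := semS_nonneg h0 h1 r hw
  have hM0 : 0 ≤ mix N integrableOn_tailDensity (ε ^ γ) (semS N h0 h1 r w) x :=
    mix_nonneg _ (fun ω _ => tailDensity_nonneg ω) _ hS0 x
  have hSr0 := semS_nonneg h0 h1 (r + ε) hw x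
  have hrγ : 0 < r ^ γ := Real.rpow_pos_of_pos hr γ
  have hεγ : 0 < ε ^ γ := Real.rpow_pos_of_pos hε γ
  have hpow : (r + ε) ^ (γ - 1) ≤ r ^ (γ - 1) :=
    Real.rpow_le_rpow_of_nonpos hr (by linarith) (by linarith)
  have hl1 : 1 ≤ (r + ε) / r := by rw [le_div_iff₀ hr]; linarith
  set l := ((r + ε) / r) ^ γ with hl
  have hl1' : 1 ≤ l := Real.one_le_rpow hl1 h0.le
  have hls : l * r ^ γ = (r + ε) ^ γ := by
    rw [hl, ← Real.mul_rpow (by positivity) hr.le, div_mul_cancel₀ _ hr.ne']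
  suffices h : semS N h0 h1 (r + ε) w x ≤ (1 + (1 + K) * C) * (semS N h0 h1 r w x
      + mix N integrableOn_tailDensity (ε ^ γ) (semS N h0 h1 r w) x) from
    mul_le_mul hpow h hSr0 (Real.rpow_nonneg hr.le _)
  set B := semS N h0 h1 r w x + mix N integrableOn_tailDensity (ε ^ γ) (semS N h0 h1 r w) x with hB
  have hB0 : 0 ≤ B := add_nonneg (hS0 x) hM0
  have hSB : semS N h0 h1 r w x ≤ B := le_add_of_nonneg_right hM0
  -- If r ≤ ε, take κ = 1: then b = μz with 1 ≤ μ ≤ 2. If ε ≤ r, the ratio (r/ε)^γ is unbounded, but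
  -- T((r+ε)^γ z) differs from T(r^γ z) by at most a multiple of κ T(4 r^γ z) with κ = ε/r. As κ
  -- (r/ε)^γ ≤ 1, this small factor compensates, and L = 4 gives the coefficient 16.
  rcases le_total r ε with hrε | hrε
  · have hμ1 : 1 ≤ (r + ε) ^ γ / ε ^ γ := by
      rw [le_div_iff₀ hεγ, one_mul]
      exact Real.rpow_le_rpow hε.le (by linarith) h0.le
    have hμ2 : (r + ε) ^ γ / ε ^ γ ≤ 2 := by
      rw [← Real.div_rpow (by positivity) hε.le]
      calc ((r + ε) / ε) ^ γ ≤ 2 ^ γ :=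
            Real.rpow_le_rpow (by positivity) (by rw [div_le_iff₀ hε]; linarith) h0.le
        _ ≤ 2 ^ (1 : ℝ) := Real.rpow_le_rpow_of_exponent_le (by norm_num) h1.le
        _ = 2 := Real.rpow_one 2
    have h := hC l (r ^ γ) (ε ^ γ) 1 hl1' hrγ hεγ zero_le_one le_rfl (fun z hz => ?_) w hw x
    · rw [hls, one_mul] at h
      have e1 : semS N h0 h1 (r + ε) w x ≤ C * B := by
        simp only [hB, semS]; exact h
      nlinarith [mul_nonneg hC0 hB0, mul_nonneg hK0 (mul_nonneg hC0 hB0)]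
    · rw [hls, one_mul, mul_div_right_comm]
      set μ := (r + ε) ^ γ / ε ^ γ
      have e1 : z ≤ μ * z := le_mul_of_one_le_left hz.le hμ1
      have e2 : μ * z ≤ 2 * z := mul_le_mul_of_nonneg_right hμ2 hz.le
      have e3 : 1 / (μ * z) ≤ 1 / z := one_div_le_one_div_of_le hz e1
      linarith
  · set κ := ε / r with hκ
    have hκ0 : 0 < κ := by positivity
    have hκ1 : κ ≤ 1 := by rw [hκ, div_le_one hr]; exact hrε
    have hle : l ≤ 1 + κ := by
      calc l ≤ ((r + ε) / r) ^ (1 : ℝ) := Real.rpow_le_rpow_of_exponent_le hl1 h1.le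
        _ = 1 + κ := by rw [Real.rpow_one, hκ]; field_simp
    have hl0 : 0 < l := by linarith
    have hlinv : 1 - l⁻¹ ≤ κ := by
      have : 1 - l⁻¹ = (l - 1) / l := by field_simp
      rw [this, div_le_iff₀ hl0]
      nlinarith
    have hζ := integrableOn_const_mul_wrightPhi h0 h1
    have hstep : semS N h0 h1 (r + ε) w x
        ≤ semS N h0 h1 r w x + K * (κ * mix N hζ (4 * r ^ γ) w x) := by
      have hi1 := integrableOn_mul_heat_apply hζ (r ^ γ) w x
      have hi2 := (integrableOn_mul_heat_apply hζ (4 * r ^ γ) w x).const_mul (K * κ)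
      rw [semS, semS, mix_apply, mix_apply, mix_apply, ← mul_assoc, ← integral_const_mul,
        ← integral_add hi1 hi2]
      refine setIntegral_mono_on (integrableOn_mul_heat_apply hζ _ w x) (hi1.add hi2)
        measurableSet_Ioi fun z hz => ?_
      have hz0 : 0 < z := hz
      have h := heat_mul_time_le (mul_pos hrγ hz0) hl1' (by linarith) hw x
      rw [← mul_assoc l, hls, ← mul_assoc 4 (r ^ γ), ← hK] at h
      have h4 := heat_nonneg (4 * r ^ γ * z) hw x
      have h' : heat N ((r + ε) ^ γ * z) w x ≤ heat N (r ^ γ * z) w x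
          + κ * K * heat N (4 * r ^ γ * z) w x :=
        h.trans (add_le_add le_rfl (mul_le_mul_of_nonneg_right
          (mul_le_mul_of_nonneg_right hlinv hK0) h4))
      calc γ * (z * wrightPhi γ z) * heat N ((r + ε) ^ γ * z) w x
          ≤ γ * (z * wrightPhi γ z) * (heat N (r ^ γ * z) w x
            + κ * K * heat N (4 * r ^ γ * z) w x) := mul_le_mul_of_nonneg_left h' (hζ0 z hz0)
        _ = _ := by ring
    have h := hC 4 (r ^ γ) (ε ^ γ) κ (by norm_num) hrγ hεγ hκ0.le hκ1 (fun z hz => ?_) w hw x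
    · have e1 : κ * mix N hζ (4 * r ^ γ) w x ≤ C * B := by
        simp only [hB, semS]; exact h
      have e2 := mul_le_mul_of_nonneg_left e1 hK0
      nlinarith [mul_nonneg hC0 hB0]
    · have hν1 : 1 ≤ r ^ γ / ε ^ γ := by
        rw [le_div_iff₀ hεγ, one_mul]
        exact Real.rpow_le_rpow hε.le hrε h0.le
      have hν2 : κ * (r ^ γ / ε ^ γ) ≤ 1 := by
        rw [← Real.div_rpow hr.le hε.le]
        calc κ * (r / ε) ^ γ ≤ κ * (r / ε) ^ (1 : ℝ) := by
              refine mul_le_mul_of_nonneg_left (Real.rpow_le_rpow_of_exponent_le ?_ h1.le) hκ0.le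
              rw [le_div_iff₀ hε]; linarith
          _ = 1 := by rw [Real.rpow_one, hκ]; field_simp
      have e0 : 4 * r ^ γ * z / ε ^ γ = 4 * (r ^ γ / ε ^ γ) * z := by ring
      rw [e0]
      set ν := r ^ γ / ε ^ γ
      have e1 : z ≤ 4 * ν * z := by nlinarith
      have e3 : 1 / (4 * ν * z) ≤ 1 / z := one_div_le_one_div_of_le hz e1
      have e4 : κ * (1 / (4 * ν * z)) ≤ 1 / z :=
        (mul_le_of_le_one_left (by positivity) hκ1).trans e3
      have e5 : κ * ν * z ≤ 1 * z := mul_le_mul_of_nonneg_right hν2 hz.le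
      nlinarith

end

/-! ### Control of the memory and divergence of the norm -/

section

open Filter Topology MeasureTheory

variable {N : ℕ} {γ p q : ℝ}

/-- The contribution of the past is controlled by the present value of the convolution. -/
lemma exists_norm_history_le (N : ℕ) (h0 : 0 < γ) (h1 : γ < 1) :
    ∃ C : ℝ, 0 ≤ C ∧ ∀ s t : ℝ, 0 ≤ s → s < t → ∀ h : ℝ → C₀(Sp N, ℝ),
      ContinuousOn h (Set.Icc 0 s) → (∀ τ ∈ Set.Icc 0 s, ∀ x, 0 ≤ h τ x) →
        ‖∫ τ in (0 : ℝ)..s, (t - τ) ^ (γ - 1) • semS N h0 h1 (t - τ) (h τ)‖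
          ≤ C * ‖duhamel γ (semS N h0 h1) h s‖ := by
  obtain ⟨C, hC0, hC⟩ := exists_semS_add_le N h0 h1
  set I := ∫ θ in Set.Ioi (0 : ℝ), |tailDensity θ| with hI
  have hI0 : 0 ≤ I := setIntegral_nonneg measurableSet_Ioi fun _ _ => abs_nonneg _
  refine ⟨C * (1 + I), by positivity, ?_⟩
  intro s t hs hst h hh hn
  have hi := intervalIntegrable_sub_rpow_smul (t := t) h0 (continuous_semS h0 h1) hs hh
  have hcomp : ∀ (L : C₀(Sp N, ℝ) →L[ℝ] ℝ) (f : ℝ → C₀(Sp N, ℝ)), IntervalIntegrable f volume 0 s →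
      IntervalIntegrable (fun τ => L (f τ)) volume 0 s :=
    fun L f hf => ⟨L.integrable_comp hf.1, L.integrable_comp hf.2⟩
  have hev : ∀ x, (∫ τ in (0 : ℝ)..s, (t - τ) ^ (γ - 1) • semS N h0 h1 (t - τ) (h τ)) x
      = ∫ τ in (0 : ℝ)..s, (t - τ) ^ (γ - 1) * semS N h0 h1 (t - τ) (h τ) x := fun x =>
    ((evalAt x).intervalIntegral_comp_comm hi).symm
  refine norm_le_of_nonneg_of_le (fun x => ?_) (fun x => ?_)
  · rw [hev]
    exact intervalIntegral.integral_nonneg hs fun τ hτ =>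
      mul_nonneg (Real.rpow_nonneg (by linarith [hτ.2]) _) (semS_nonneg h0 h1 _ (hn τ hτ) x)
  · set M := mix N integrableOn_tailDensity ((t - s) ^ γ) with hM
    set D := duhamel γ (semS N h0 h1) h s with hD
    -- The superposition M depends on t - s but not on τ, so L passes through the integral and acts
    -- on the whole Duhamel term at time s.
    set L : C₀(Sp N, ℝ) →L[ℝ] ℝ := C • (evalAt x + (evalAt x).comp M) with hL
    have hLD : L D ≤ C * (1 + I) * ‖D‖ := by
      have e : L D = C * (D x + M D x) := rfl
      have e1 := apply_le_norm D x
      have e2 := (apply_le_norm (M D) x).trans (norm_mix_le integrableOn_tailDensity _ D)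
      rw [e, mul_assoc]
      refine mul_le_mul_of_nonneg_left ?_ hC0
      linarith
    refine le_trans ?_ hLD
    rw [hev, hD, duhamel_clm L h0 h1 hs hh]
    have hi1 := hcomp (evalAt x) _ hi
    have hi2 := hcomp L _ (intervalIntegrable_sub_rpow_smul (t := s) h0 (continuous_semS h0 h1) hs hh)
    simp only [map_smul] at hi1 hi2
    refine intervalIntegral.integral_mono_on_of_le_Ioo hs hi1 hi2 fun τ hτ => ?_
    have hpt := hC (s - τ) (t - s) (by linarith [hτ.2]) (by linarith) (h τ) (hn τ ⟨hτ.1.le, hτ.2.le⟩) x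
    rw [show s - τ + (t - s) = t - τ by ring] at hpt
    exact hpt

lemma norm_integral_recent_le (h0 : 0 < γ) (h1 : γ < 1) {s t M : ℝ} (hst : s ≤ t)
    {h : ℝ → C₀(Sp N, ℝ)} (hM : ∀ τ ∈ Set.Ico s t, ‖h τ‖ ≤ M) :
    ‖∫ τ in s..t, (t - τ) ^ (γ - 1) • semS N h0 h1 (t - τ) (h τ)‖
      ≤ 1 / Real.Gamma γ * M * ((t - s) ^ γ / γ) := by
  have hΓ := Real.Gamma_pos_of_pos h0
  have hi : IntervalIntegrable (fun τ => (t - τ) ^ (γ - 1)) volume s t := by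
    have := (intervalIntegral.intervalIntegrable_rpow' (a := t - s) (b := t - t) (r := γ - 1)
      (by linarith)).comp_sub_left t
    simpa using this
  have e : ∫ τ in s..t, (t - τ) ^ (γ - 1) * (1 / Real.Gamma γ * M)
      = 1 / Real.Gamma γ * M * ((t - s) ^ γ / γ) := by
    rw [intervalIntegral.integral_mul_const,
      intervalIntegral.integral_comp_sub_left (fun r => r ^ (γ - 1)) t, sub_self,
      integral_rpow (Or.inl (by linarith)), sub_add_cancel, Real.zero_rpow h0.ne', sub_zero]
    ring
  rw [← e]
  refine intervalIntegral.norm_integral_le_of_norm_le hst (Eventually.of_forall fun τ hτ => ?_)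
    (hi.mul_const _)
  -- At τ = t the integrand is zero by the convention 0^{γ-1} = 0, so no bound on h(t) is required.
  -- This matters because the norm is only controlled before the first exit time.
  rcases hτ.2.eq_or_lt with rfl | hlt
  · rw [sub_self, Real.zero_rpow (by linarith), zero_smul, zero_mul, norm_zero]
  · have hnn : 0 ≤ (t - τ) ^ (γ - 1) := Real.rpow_nonneg (by linarith) _
    rw [norm_smul, Real.norm_of_nonneg hnn]
    refine mul_le_mul_of_nonneg_left ((norm_semS_le h0 h1 _ _).trans ?_) hnn
    exact mul_le_mul_of_nonneg_left (hM τ ⟨hτ.1.le, hlt⟩) (by positivity)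

lemma duhamel_split (h0 : 0 < γ) (h1 : γ < 1) {s t : ℝ} (hs : 0 ≤ s) (hst : s ≤ t)
    {h : ℝ → C₀(Sp N, ℝ)} (hh : ContinuousOn h (Set.Icc 0 t)) :
    duhamel γ (semS N h0 h1) h t
      = (∫ τ in (0 : ℝ)..s, (t - τ) ^ (γ - 1) • semS N h0 h1 (t - τ) (h τ))
        + ∫ τ in s..t, (t - τ) ^ (γ - 1) • semS N h0 h1 (t - τ) (h τ) :=
  (intervalIntegral.integral_add_adjacent_intervals
    (intervalIntegrable_sub_rpow_smul h0 (continuous_semS h0 h1) hs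
      (hh.mono (Set.Icc_subset_Icc_right hst)))
    (intervalIntegrable_sub_rpow_smul h0 (continuous_semS h0 h1) hst
      (hh.mono (Set.Icc_subset_Icc_left hs)))).symm

lemma norm_absRpow_le {r : ℝ} (hr : 0 < r) (w : C₀(Sp N, ℝ)) : ‖absRpow N hr w‖ ≤ ‖w‖ ^ r :=
  norm_le_of_nonneg_of_le (absRpow_nonneg hr w) fun x =>
    Real.rpow_le_rpow (abs_nonneg _) (abs_apply_le_norm w x) hr.le

lemma norm_le_norm_of_le {w w' : C₀(Sp N, ℝ)} (h : ∀ x, 0 ≤ w x) (h' : ∀ x, w x ≤ w' x) :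
    ‖w‖ ≤ ‖w'‖ :=
  norm_le_of_nonneg_of_le h fun x => (h' x).trans (apply_le_norm w' x)

/-- One component of the bootstrap: the past is controlled by the present size. -/
lemma norm_component_le (h0 : 0 < γ) (h1 : γ < 1) {C : ℝ} (hC0 : 0 ≤ C)
    (hC : ∀ s t : ℝ, 0 ≤ s → s < t → ∀ h : ℝ → C₀(Sp N, ℝ),
      ContinuousOn h (Set.Icc 0 s) → (∀ τ ∈ Set.Icc 0 s, ∀ x, 0 ≤ h τ x) →
        ‖∫ τ in (0 : ℝ)..s, (t - τ) ^ (γ - 1) • semS N h0 h1 (t - τ) (h τ)‖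
          ≤ C * ‖duhamel γ (semS N h0 h1) h s‖)
    {s t M : ℝ} (hs : 0 ≤ s) (hst : s < t) {w₀ : C₀(Sp N, ℝ)} (hw₀ : ∀ x, 0 ≤ w₀ x)
    {w h : ℝ → C₀(Sp N, ℝ)} (hh : ContinuousOn h (Set.Icc 0 t))
    (hn : ∀ τ ∈ Set.Icc 0 t, ∀ x, 0 ≤ h τ x) (hM : ∀ τ ∈ Set.Ico s t, ‖h τ‖ ≤ M)
    (hws : w s = semP N h0 h1 s w₀ + duhamel γ (semS N h0 h1) h s)
    (hwt : w t = semP N h0 h1 t w₀ + duhamel γ (semS N h0 h1) h t) :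
    ‖w t‖ ≤ ‖w₀‖ + C * ‖w s‖ + 1 / Real.Gamma γ * M * ((t - s) ^ γ / γ) := by
  have hsub : Set.Icc 0 s ⊆ Set.Icc 0 t := Set.Icc_subset_Icc_right hst.le
  have hD : ‖duhamel γ (semS N h0 h1) h s‖ ≤ ‖w s‖ := by
    refine norm_le_norm_of_le (duhamel_semS_nonneg h0 h1 hs (hh.mono hsub) fun τ hτ => hn τ (hsub hτ))
      fun x => ?_
    rw [hws, ZeroAtInftyContinuousMap.add_apply]
    exact le_add_of_nonneg_left (semP_nonneg h0 h1 s hw₀ x)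
  have e1 := (hC s t hs hst h (hh.mono hsub) fun τ hτ => hn τ (hsub hτ)).trans
    (mul_le_mul_of_nonneg_left hD hC0)
  have e2 := norm_integral_recent_le h0 h1 hst.le hM
  rw [hwt, duhamel_split h0 h1 hs hst.le hh]
  refine (norm_add_le _ _).trans ?_
  have e3 := norm_add_le (∫ τ in (0 : ℝ)..s, (t - τ) ^ (γ - 1) • semS N h0 h1 (t - τ) (h τ))
    (∫ τ in s..t, (t - τ) ^ (γ - 1) • semS N h0 h1 (t - τ) (h τ))
  linarith [norm_semP_le h0 h1 t w₀]

variable {u₀ v₀ : C₀(Sp N, ℝ)} {T : ℝ} {U : ℝ → C₀(Sp N, ℝ) × C₀(Sp N, ℝ)}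

/-- A solution of moderate size at one time stays bounded for a time depending only on that size. -/
lemma exists_time_of_norm_le (h0 : 0 < γ) (h1 : γ < 1) (hp : 1 < p) (hq : 1 < q)
    (hu₀ : ∀ x, 0 ≤ u₀ x) (hv₀ : ∀ x, 0 ≤ v₀ x) {K : ℝ} (hK : 0 ≤ K) :
    ∃ δ R : ℝ, 0 < δ ∧ ∀ (s b : ℝ) (U : ℝ → C₀(Sp N, ℝ) × C₀(Sp N, ℝ)), 0 ≤ s → b ≤ s + δ →
      IsVolterraSol γ (semS₂ N h0 h1) (freeEvolution h0 h1 u₀ v₀)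
        (crossPower N (one_pos.trans hp) (one_pos.trans hq)) b U →
      ‖U s‖ ≤ K → ∀ t ∈ Set.Icc s b, ‖U t‖ < R := by
  obtain ⟨C, hC0, hC⟩ := exists_norm_history_le N h0 h1
  have hΓ := Real.Gamma_pos_of_pos h0
  -- A collects the data and the past; the extra K gives R > K, so the bound R is not yet reached at
  -- time s. δ is then chosen so that the recent sources, bounded by M, contribute less than 1.
  set A := ‖u₀‖ + ‖v₀‖ + C * K + K with hA
  have hA0 : 0 ≤ A := by positivity
  set R := A + 1 with hR
  have hR0 : 0 ≤ R := by positivity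
  set M := R ^ p + R ^ q with hM
  have hM0 : 0 ≤ M := add_nonneg (Real.rpow_nonneg hR0 _) (Real.rpow_nonneg hR0 _)
  obtain ⟨δ, hδ, hδM⟩ : ∃ δ : ℝ, 0 < δ ∧ 1 / Real.Gamma γ * M * (δ ^ γ / γ) < 1 := by
    have hc : Continuous fun δ : ℝ => 1 / Real.Gamma γ * M * (δ ^ γ / γ) :=
      continuous_const.mul ((Real.continuous_rpow_const h0.le).div_const _)
    have hev : ∀ᶠ δ in 𝓝 (0 : ℝ), 1 / Real.Gamma γ * M * (δ ^ γ / γ) < 1 :=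
      hc.continuousAt.eventually (gt_mem_nhds (by simp [Real.zero_rpow h0.ne']))
    obtain ⟨δ, h, hpos⟩ := ((hev.filter_mono (nhdsWithin_le_nhds (s := Set.Ioi 0))).and
      self_mem_nhdsWithin).exists
    exact ⟨δ, hpos, h⟩
  refine ⟨δ, R, hδ, fun s b U hs hb hU hUs => ?_⟩
  by_contra! hcon
  obtain ⟨t₁, ht₁, hRt₁⟩ := hcon
  have hcU : ContinuousOn (fun t => ‖U t‖) (Set.Icc s b) :=
    hU.cont.norm.mono (Set.Icc_subset_Icc_left hs)
  have hcomp : IsCompact (Set.Icc s b ∩ (fun t => ‖U t‖) ⁻¹' Set.Ici R) :=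
    isCompact_Icc.of_isClosed_subset (hcU.preimage_isClosed_of_isClosed isClosed_Icc isClosed_Ici)
      Set.inter_subset_left
  -- The first time in [s,b] at which the norm is at least R; before it the sources are bounded by
  -- M, which forces the norm at t below R.
  obtain ⟨t, ⟨ht, hRt⟩, hleast⟩ := hcomp.exists_isLeast ⟨t₁, ht₁, hRt₁⟩
  have hlt : ∀ τ ∈ Set.Ico s t, ‖U τ‖ ≤ R := fun τ hτ => by
    by_contra! h
    exact absurd (hleast ⟨⟨hτ.1, hτ.2.le.trans ht.2⟩, h.le⟩) (not_le.2 hτ.2)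
  have hst : s < t := by
    refine lt_of_le_of_ne ht.1 fun h => ?_
    rw [← h] at hRt
    have : R ≤ K := (Set.mem_Ici.1 hRt).trans hUs
    have h2 : 0 ≤ ‖u₀‖ + ‖v₀‖ + C * K := by positivity
    linarith
  have ht0 : t ∈ Set.Icc 0 b := ⟨hs.trans ht.1, ht.2⟩
  have hs0 : s ∈ Set.Icc 0 b := ⟨hs, ht.1.trans ht.2⟩
  have hcF := (hU.continuousOn_crossPower h0 h1 hp hq).mono (Set.Icc_subset_Icc_right ht.2)
  have hδt : 1 / Real.Gamma γ * M * ((t - s) ^ γ / γ) < 1 := by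
    refine lt_of_le_of_lt (mul_le_mul_of_nonneg_left (div_le_div_of_nonneg_right
      (Real.rpow_le_rpow (by linarith) (by linarith [ht.2]) h0.le) h0.le) (by positivity)) hδM
  have b1 := norm_component_le h0 h1 hC0 hC hs hst hu₀ (w := fun τ => (U τ).1)
    (h := fun τ => absRpow N (one_pos.trans hp) (U τ).2) (M := M) hcF.fst
    (fun τ _ x => absRpow_nonneg _ _ x) (fun τ hτ => (norm_absRpow_le _ _).trans
      ((Real.rpow_le_rpow (norm_nonneg _) ((norm_snd_le _).trans (hlt τ hτ)) (by linarith)).trans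
        (le_add_of_nonneg_right (Real.rpow_nonneg hR0 _))))
    (hU.fst_eq h0 h1 hp hq hs0) (hU.fst_eq h0 h1 hp hq ht0)
  have b2 := norm_component_le h0 h1 hC0 hC hs hst hv₀ (w := fun τ => (U τ).2)
    (h := fun τ => absRpow N (one_pos.trans hq) (U τ).1) (M := M) hcF.snd
    (fun τ _ x => absRpow_nonneg _ _ x) (fun τ hτ => (norm_absRpow_le _ _).trans
      ((Real.rpow_le_rpow (norm_nonneg _) ((norm_fst_le _).trans (hlt τ hτ)) (by linarith)).trans
        (le_add_of_nonneg_left (Real.rpow_nonneg hR0 _))))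
    (hU.snd_eq h0 h1 hp hq hs0) (hU.snd_eq h0 h1 hp hq ht0)
  have c1 : C * ‖(U s).1‖ ≤ C * K := mul_le_mul_of_nonneg_left ((norm_fst_le _).trans hUs) hC0
  have c2 : C * ‖(U s).2‖ ≤ C * K := mul_le_mul_of_nonneg_left ((norm_snd_le _).trans hUs) hC0
  have hfin : ‖U t‖ < R := by
    rw [Prod.norm_def]
    refine max_lt ?_ ?_
    · linarith [norm_nonneg v₀]
    · linarith [norm_nonneg u₀]
  exact absurd hfin (not_lt.2 hRt)

/-- The norm of a solution that cannot be continued tends to infinity. -/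
lemma tendsto_norm_atTop (h0 : 0 < γ) (h1 : γ < 1) (hp : 1 < p) (hq : 1 < q)
    (hu₀ : ∀ x, 0 ≤ u₀ x) (hv₀ : ∀ x, 0 ≤ v₀ x) (hT : 0 < T)
    (hU : ∀ T' < T, IsVolterraSol γ (semS₂ N h0 h1) (freeEvolution h0 h1 u₀ v₀)
      (crossPower N (one_pos.trans hp) (one_pos.trans hq)) T' U)
    (hmax : ∀ T' U', 0 < T' → IsVolterraSol γ (semS₂ N h0 h1) (freeEvolution h0 h1 u₀ v₀)
      (crossPower N (one_pos.trans hp) (one_pos.trans hq)) T' U' → T' < T) :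
    Tendsto (fun t => ‖U t‖) (𝓝[<] T) atTop := by
  by_contra hcon
  rw [tendsto_atTop] at hcon
  push Not at hcon
  obtain ⟨K, hK⟩ := hcon
  have hK0 : 0 ≤ K := by
    obtain ⟨t, ht⟩ := hK.exists
    exact (norm_nonneg _).trans ht.le
  obtain ⟨δ, R, hδ, hR⟩ := exists_time_of_norm_le (N := N) h0 h1 hp hq hu₀ hv₀ hK0
  have hev : ∀ᶠ t in 𝓝[<] T, t ∈ Set.Ioo (max 0 (T - δ)) T :=
    Ioo_mem_nhdsLT (max_lt hT (by linarith))
  -- A time within δ of T at which the norm is below K. The solution is then bounded on all of [0,T)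
  -- and can be continued past T.
  obtain ⟨s, hsK, hs1, hsT⟩ := (hK.and_eventually hev).exists
  rw [max_lt_iff] at hs1
  obtain ⟨R', hR'⟩ := isCompact_Icc.exists_bound_of_continuousOn (hU s hsT).cont
  have hbound : ∀ t, 0 ≤ t → t < T → ‖U t‖ ≤ max R R' := fun t ht0 htT => by
    rcases le_total t s with h | h
    · exact (hR' t ⟨ht0, h⟩).trans (le_max_right _ _)
    · exact ((hR s t U hs1.1.le (by linarith) (hU t htT) hsK.le t ⟨h, le_rfl⟩).le).trans
        (le_max_left _ _)
  obtain ⟨T', U', hTT', hU'⟩ := exists_isVolterraSol_extension h0 (continuous_semS₂ h0 h1)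
    (norm_semS₂_le h0 h1) (one_div_nonneg.2 (Real.Gamma_pos_of_pos h0).le)
    (continuous_freeEvolution h0 h1 u₀ v₀) (hasLipschitzTruncations_crossPower hp hq) hT.le
    (fun T' _ h => hU T' h) hbound
  exact absurd (hmax T' U' (hT.trans hTT') hU') (not_lt.2 hTT'.le)

end

end FracDiff

end

theorem theorem3p5 (N : ℕ) (hN : 1 ≤ N) (γ p q : ℝ) (hγ0 : 0 < γ) (hγ1 : γ < 1)
    (hp : 1 < p) (hpq : p ≤ q) (u₀ v₀ : C₀(FracDiff.Sp N, ℝ))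
    (hu₀ : ∀ x, 0 ≤ u₀ x) (hv₀ : ∀ x, 0 ≤ v₀ x)
    (hZ₀ : (2 : ℝ) ^ (p / (p - 1)) < FracDiff.Z0 N u₀ v₀) :
    ∃ (T : ℝ) (u v : ℝ → C₀(FracDiff.Sp N, ℝ)),
      FracDiff.IsMaximalMildSolution N γ γ (fun s => |s| ^ p) (fun s => |s| ^ q) u₀ v₀ T u v ∧
      Filter.Tendsto (fun t => ‖u t‖ + ‖v t‖) (nhdsWithin T (Set.Iio T)) Filter.atTop ∧
      T ≤ (Real.log (1 - (2 : ℝ) ^ p * FracDiff.Z0 N u₀ v₀ ^ (1 - p)) / (2 * (1 - p)) *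
        Real.Gamma (γ + 1)) ^ (1 / γ) := by
  have hq : 1 < q := hp.trans_le hpq
  have hΓ := Real.Gamma_pos_of_pos hγ0
  obtain ⟨T, U, hT, hTB, hsol, hmax⟩ := FracDiff.exists_maximal_isVolterraSol hγ0
    (FracDiff.continuous_semS₂ hγ0 hγ1) (FracDiff.norm_semS₂_le hγ0 hγ1) (one_div_nonneg.2 hΓ.le)
    (FracDiff.continuous_freeEvolution hγ0 hγ1 u₀ v₀)
    (FracDiff.hasLipschitzTruncations_crossPower hp hq)
    fun T U _ hU => (hU.lt_bernoulliTime hN hγ0 hγ1 hp hq hpq hu₀ hv₀ hZ₀).le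
  refine ⟨T, fun t => (U t).1, fun t => (U t).2, ⟨hT, fun T' _ hT' => ?_, fun T' u' v' hT' h => ?_⟩,
    ?_, hTB⟩
  · exact (FracDiff.isMildSolution_iff hγ0 hγ1 hp hq).2 (hsol T' hT')
  · obtain ⟨hlt, heq⟩ := hmax T' _ hT' ((FracDiff.isMildSolution_iff hγ0 hγ1 hp hq).1 h)
    exact ⟨hlt, fun t ht => ⟨congrArg Prod.fst (heq t ht), congrArg Prod.snd (heq t ht)⟩⟩
  · have h := FracDiff.tendsto_norm_atTop hγ0 hγ1 hp hq hu₀ hv₀ hT hsol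
      fun T' U' hT' h => (hmax T' U' hT' h).1
    refine Filter.tendsto_atTop_mono (fun t => ?_) h
    rw [Prod.norm_def]
    exact max_le_add_of_nonneg (norm_nonneg _) (norm_nonneg _)
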